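/- Let $X=\mathbb{P}^1_{\mathbb{Z}}=\operatorname{Proj}\mathbb{Z}[x_0,x_1]$, with Serre's twisting sheaves $\mathcal{O}_X(n)$, $n\in\mathbb{Z}$. For every locally free sheaf $\mathcal{E}$ of $\mathcal{O}_X$-modules of rank two there are integers $a\ge b$, a closed subscheme $Z\subset X$ which is a local complete intersection of codimension two (possibly empty), and a short exact sequence of $\mathcal{O}_X$-modules $$0\longrightarrow \mathcal{O}_X(a)\longrightarrow \mathcal{E}\longrightarrow \mathcal{I}_Z(b)\longrightarrow 0 .$$ Here $\mathcal{I}_Z=\ker(\mathcal{O}_X\to\mathcal{O}_Z)$ is the ideal sheaf of $Z$ and $\mathcal{I}_Z(b)=\mathcal{I}_Z\otimes_{\mathcal{O}_X}\mathcal{O}_X(b)$. That $Z$ is a local complete intersection of codimension two means that each point of $Z$ has an affine open neighbourhood $U$ in $X$ on which the ideal of $Z$ is generated by a regular sequence of length two in $\mathcal{O}_X(U)$. -/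

import Mathlib

open AlgebraicGeometry CategoryTheory TopologicalSpace Opposite

noncomputable section

namespace ProjTwist

variable {A σ : Type*} [CommRing A] [SetLike σ A] [AddSubgroupClass σ A]
variable (𝒜 : ℕ → σ) [GradedRing 𝒜] (n : ℤ)

/-- The localization `A_𝔭` at the homogeneous prime `𝔭` of a point of `Proj 𝒜`. -/
abbrev At (x : ProjectiveSpectrum 𝒜) : Type _ :=
  Localization x.asHomogeneousIdeal.toIdeal.primeCompl

variable {𝒜} in
/-- A dependent function `x ↦ f x ∈ A_𝔭ₓ` on an open set is a fraction of degree `n` if it is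
given by one fraction `r / s` with `r`, `s` homogeneous and `deg r = deg s + n`. -/
def IsFraction {U : Opens (ProjectiveSpectrum.top 𝒜)} (f : ∀ x : U, At 𝒜 x.1) : Prop :=
  ∃ (i j : ℕ) (_ : (i : ℤ) = j + n) (r : 𝒜 i) (s : 𝒜 j)
    (hs : ∀ x : U, s.1 ∉ ProjectiveSpectrum.asHomogeneousIdeal x.1),
    ∀ x : U, f x = Localization.mk r.1 ⟨s.1, hs x⟩

/-- Being a fraction of degree `n` passes to smaller open sets. -/
def isFractionPrelocal :
    TopCat.PrelocalPredicate fun x : ProjectiveSpectrum.top 𝒜 => At 𝒜 x where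
  pred f := IsFraction n f
  res := by
    rintro V U k f ⟨i, j, h, r, s, hs, w⟩
    exact ⟨i, j, h, r, s, (hs <| k ·), (w <| k ·)⟩

/-- Being locally a fraction of degree `n`. -/
def isLocallyFraction :
    TopCat.LocalPredicate fun x : ProjectiveSpectrum.top 𝒜 => At 𝒜 x :=
  (isFractionPrelocal 𝒜 n).sheafify

variable {𝒜 n} in
lemma isLocallyFraction_zero (U : Opens (ProjectiveSpectrum.top 𝒜)) :
    (isLocallyFraction 𝒜 n).pred (0 : ∀ x : U, At 𝒜 x.1) := by
  intro x
  obtain ⟨d, hd, s, hs, hsx⟩ : ∃ d : ℕ, 0 < d ∧ ∃ s ∈ 𝒜 d,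
      s ∉ ProjectiveSpectrum.asHomogeneousIdeal x.1 := by
    have hx := ProjectiveSpectrum.not_irrelevant_le x.1
    contrapose! hx
    classical
    intro a ha
    rw [← DirectSum.sum_support_decompose 𝒜 a]
    refine Ideal.sum_mem _ fun d _ => ?_
    rcases Nat.eq_zero_or_pos d with rfl | hd
    · have h0 : (DirectSum.decompose 𝒜 a 0 : A) = 0 :=
        (HomogeneousIdeal.mem_irrelevant_iff 𝒜 a).mp ha
      rw [h0]
      exact Ideal.zero_mem _
    · exact hx d hd _ (SetLike.coe_mem _)
  refine ⟨U ⊓ ProjectiveSpectrum.basicOpen 𝒜 s, ⟨x.2, hsx⟩, Opens.infLELeft _ _,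
    ((n.natAbs * d : ℕ) + n).toNat, n.natAbs * d, ?_, ⟨0, zero_mem _⟩,
    ⟨s ^ n.natAbs, by simpa using SetLike.pow_mem_graded n.natAbs hs⟩, fun y hy => ?_, fun y => ?_⟩
  · have : (n.natAbs : ℤ) ≤ n.natAbs * d := by
      exact_mod_cast Nat.le_mul_of_pos_right _ hd
    have h := Nat.cast_mul (α := ℤ) n.natAbs d
    generalize n.natAbs * d = e at *
    omega
  · exact y.2.2 (y.1.isPrime.mem_of_pow_mem _ hy)
  · exact (Localization.mk_zero _).symm

variable {𝒜 n} in
lemma isLocallyFraction_add {U : Opens (ProjectiveSpectrum.top 𝒜)} {f g : ∀ x : U, At 𝒜 x.1}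
    (hf : (isLocallyFraction 𝒜 n).pred f) (hg : (isLocallyFraction 𝒜 n).pred g) :
    (isLocallyFraction 𝒜 n).pred (f + g) := by
  intro x
  obtain ⟨V, hxV, k, i, j, h, ⟨r, hr⟩, ⟨s, hs⟩, hs', w⟩ := hf x
  obtain ⟨V', hxV', k', i', j', h', ⟨r', hr'⟩, ⟨t, ht⟩, ht', w'⟩ := hg x
  refine ⟨V ⊓ V', ⟨hxV, hxV'⟩, Opens.infLELeft _ _ ≫ k, i + j', j + j', by push_cast; omega,
    ⟨s * r' + t * r, add_mem ?_ ?_⟩, ⟨s * t, SetLike.mul_mem_graded hs ht⟩, fun y =>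
      (ProjectiveSpectrum.isPrime y.1).mul_notMem (hs' ⟨y.1, y.2.1⟩) (ht' ⟨y.1, y.2.2⟩),
      fun y => ?_⟩
  · rw [show i + j' = j + i' by omega]
    exact SetLike.mul_mem_graded hs hr'
  · rw [add_comm i]
    exact SetLike.mul_mem_graded ht hr
  · exact (congrArg₂ (· + ·) (w ⟨y.1, y.2.1⟩) (w' ⟨y.1, y.2.2⟩)).trans (Localization.add_mk _ _ _ _)

variable {𝒜 n} in
lemma isLocallyFraction_neg {U : Opens (ProjectiveSpectrum.top 𝒜)} {f : ∀ x : U, At 𝒜 x.1}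
    (hf : (isLocallyFraction 𝒜 n).pred f) : (isLocallyFraction 𝒜 n).pred (-f) := by
  intro x
  obtain ⟨V, hxV, k, i, j, h, ⟨r, hr⟩, s, hs, w⟩ := hf x
  exact ⟨V, hxV, k, i, j, h, ⟨-r, neg_mem hr⟩, s, hs, fun y =>
    (congrArg (- ·) (w y)).trans (Localization.neg_mk _ _)⟩

/-- The sections of `𝒪(n)` over `U`: the dependent functions `x ↦ f x ∈ A_𝔭ₓ` on `U` which are
locally fractions of degree `n`. -/
def sections (U : Opens (ProjectiveSpectrum.top 𝒜)) : AddSubgroup (∀ x : U, At 𝒜 x.1) where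
  carrier := {f | (isLocallyFraction 𝒜 n).pred f}
  zero_mem' := isLocallyFraction_zero U
  add_mem' := isLocallyFraction_add
  neg_mem' := isLocallyFraction_neg

lemma smul_mem_sections {U : Opens (ProjectiveSpectrum.top 𝒜)}
    (a : (ProjectiveSpectrum.Proj.structureSheaf 𝒜).1.obj (op U)) (f : sections 𝒜 n U) :
    (fun x : U => (a.1 x).val * f.1 x) ∈ sections 𝒜 n U := by
  intro x
  obtain ⟨V, hxV, k, d, ⟨r, hr⟩, ⟨s, hs⟩, hs', w⟩ := a.2 x
  obtain ⟨V', hxV', k', i', j', h', ⟨r', hr'⟩, ⟨t, ht⟩, ht', w'⟩ := f.2 x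
  refine ⟨V ⊓ V', ⟨hxV, hxV'⟩, Opens.infLELeft _ _ ≫ k, d + i', d + j', by push_cast; omega,
    ⟨r * r', SetLike.mul_mem_graded hr hr'⟩, ⟨s * t, SetLike.mul_mem_graded hs ht⟩, fun y =>
      (ProjectiveSpectrum.isPrime y.1).mul_notMem (hs' ⟨y.1, y.2.1⟩) (ht' ⟨y.1, y.2.2⟩),
      fun y => ?_⟩
  exact (congrArg₂ (· * ·) (congrArg HomogeneousLocalization.val (w ⟨y.1, y.2.1⟩))
    (w' ⟨y.1, y.2.2⟩)).trans (Localization.mk_mul _ _ _ _)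

/-- The presheaf of abelian groups underlying `𝒪(n)`. -/
def presheaf : TopCat.Presheaf Ab (ProjectiveSpectrum.top 𝒜) where
  obj U := AddCommGrpCat.of (sections 𝒜 n U.unop)
  map i := AddCommGrpCat.ofHom
    { toFun := (TopCat.subsheafToTypes (isLocallyFraction 𝒜 n)).1.map i
      map_zero' := rfl
      map_add' := fun _ _ => rfl }

/-- A section `a` of the structure sheaf, with values in the degree zero part of `A_𝔭`, acts on
sections of `𝒪(n)` by pointwise multiplication in `A_𝔭`. -/
instance instModule (U : (Opens (ProjectiveSpectrum.top 𝒜))ᵒᵖ) :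
    Module ((ProjectiveSpectrum.Proj.structureSheaf 𝒜).1.obj U) ((presheaf 𝒜 n).obj U) where
  smul a f := (⟨fun x => (a.1 x).val * f.1 x, smul_mem_sections 𝒜 n a f⟩ : sections 𝒜 n U.unop)
  one_smul f := Subtype.ext (funext fun x => (congrArg (· * f.1 x) HomogeneousLocalization.val_one).trans (one_mul _))
  mul_smul _ _ f := Subtype.ext (funext fun x => 
    (congrArg (· * f.1 x) (HomogeneousLocalization.val_mul _ _)).trans (mul_assoc _ _ _))
  smul_zero _ := Subtype.ext (funext fun _ => mul_zero _)
  smul_add _ f g := Subtype.ext (funext fun x => mul_add _ (f.1 x) (g.1 x))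
  add_smul _ _ f := Subtype.ext (funext fun x => 
    (congrArg (· * f.1 x) (HomogeneousLocalization.val_add _ _)).trans (add_mul _ _ _))
  zero_smul f := Subtype.ext (funext fun x => 
    (congrArg (· * f.1 x) HomogeneousLocalization.val_zero).trans (zero_mul _))

end ProjTwist

universe u

/-- Serre's twisting sheaf `𝒪(n)` on `Proj 𝒜`. -/
def twistingSheaf {A : Type u} {σ : Type*} [CommRing A] [SetLike σ A] [AddSubgroupClass σ A]
    (𝒜 : ℕ → σ) [GradedRing 𝒜] (n : ℤ) : (Proj 𝒜).Modules where
  val :=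
    letI (U : (Opens (Proj 𝒜))ᵒᵖ) :
        Module ((Proj 𝒜).ringCatSheaf.obj.obj U) ((ProjTwist.presheaf 𝒜 n).obj U) :=
      ProjTwist.instModule 𝒜 n U
    .ofPresheaf (ProjTwist.presheaf 𝒜 n) fun _ _ _ _ _ ↦ rfl
  isSheaf := (TopCat.Presheaf.isSheaf_iff_isSheaf_comp (forget AddCommGrpCat) _).2
    (TopCat.subsheafToTypes (ProjTwist.isLocallyFraction 𝒜 n)).2

/-- The tensor product of two `𝒪_X`-modules: the sheaf associated with
`U ↦ M(U) ⊗ N(U)`, the tensor product being over `𝒪_X(U)`. -/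
def tensorModules {X : Scheme.{u}} (M N : X.Modules) : X.Modules :=
  (PresheafOfModules.sheafification (𝟙 X.ringCatSheaf.obj)).obj
    (PresheafOfModules.Monoidal.tensorObj (R := X.presheaf) M.val N.val)

/-- The structure sheaf `𝒪_X` as a module over itself. -/
def structureModule (X : Scheme.{u}) : X.Modules :=
  SheafOfModules.unit X.ringCatSheaf

/-- The homomorphism `𝒪_X ⟶ i_* 𝒪_Z` belonging to a morphism `i : Z ⟶ X`. -/
def structureModuleHom {Z X : Scheme.{u}} (i : Z ⟶ X) :
    structureModule X ⟶ (Scheme.Modules.pushforward i).obj (structureModule Z) :=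
  SheafOfModules.unitToPushforwardObjUnit i.toRingCatSheafHom

/-- The sheaf of ideals `𝓘_Z`, that is, the kernel of `𝒪_X ⟶ i_* 𝒪_Z`, of a closed subscheme
given by a closed immersion `i : Z ⟶ X`. -/
def idealSheafModule {Z X : Scheme.{u}} (i : Z ⟶ X) [IsClosedImmersion i] : X.Modules :=
  Limits.kernel (structureModuleHom i)

/-- The closed subscheme given by `i : Z ⟶ X` is a local complete intersection of codimension `c`:
around each of its points there is an affine open `U` of `X` on which the ideal of `Z` is generated
by a regular sequence of length `c` in `Γ(X, U)`. (It may be empty.) -/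
def IsLocalCompleteIntersection {Z X : Scheme.{u}} (i : Z ⟶ X) [IsClosedImmersion i] (c : ℕ) :
    Prop :=
  ∀ z : Z, ∃ U : X.Opens, IsAffineOpen U ∧ i z ∈ U ∧ ∃ s : List Γ(X, U), s.length = c ∧
    RingTheory.Sequence.IsRegular Γ(X, U) s ∧ Ideal.ofList s = RingHom.ker (i.app U).hom

/-- An `𝒪_X`-module is locally free of rank `r` if every point has an open neighbourhood `U` on
which it is isomorphic to `𝒪_U ^ r`. -/
def IsLocallyFreeOfRank {X : Scheme.{u}} (E : X.Modules) (r : ℕ) : Prop :=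
  ∀ x : X, ∃ U : X.Opens, x ∈ U ∧
    Nonempty (E.restrict U.ι ≅ (SheafOfModules.free (ULift.{u} (Fin r)) : (U : Scheme.{u}).Modules))

attribute [local instance] MvPolynomial.gradedAlgebra

/-- The projective line over `ℤ`, that is, `Proj ℤ[x₀, x₁]` with the grading by degree. -/
def P1Z : Scheme.{0} :=
  Proj (MvPolynomial.homogeneousSubmodule (Fin 2) ℤ)

/-- The line bundle `𝒪(n)` on the projective line over `ℤ`. -/
def OP1Z (n : ℤ) : P1Z.Modules :=
  twistingSheaf (MvPolynomial.homogeneousSubmodule (Fin 2) ℤ) n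

/-- The twist `F(n) = F ⊗ 𝒪(n)` of an `𝒪`-module on the projective line over `ℤ`. -/
def twistP1Z (F : P1Z.Modules) (n : ℤ) : P1Z.Modules :=
  tensorModules F (OP1Z n)

end

-- On each of the two standard charts the functions form `ℤ[X]`, a noetherian factorial domain, and
-- a rank two bundle `E` becomes a finite projective module `M₀` or `M₁`. Both embed in the module
-- `N` of sections over the overlap, a module over the Laurent polynomials in `T = x₁ / x₀`. A
-- homomorphism `𝒪(a) → E` is a pair `s₀`, `s₁` with `s₁ = T ^ a • s₀` in `N`; a homomorphism `E →
-- 𝒪(b)` is a pair of functionals with `T ^ b * g₁ = g₀` on the overlap.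
--
-- The degrees `a` of nonzero pairs are bounded above (`exists_bound_of_sections`), so a largest one
-- exists. Removing common factors can only raise the degree (`exists_primitive_pair`), hence the
-- largest `a` is attained by a primitive pair. Over a factorial domain a primitive element `s` of a
-- rank two module spans the kernel of a functional whose values have no common factor: take a
-- nonzero coordinate of `m ↦ s ∧ m` and divide out its content
-- (`Primitive.exists_coprime_functional`). The functionals on the two charts can be matched up to a
-- unit `±T ^ j`, so they glue to `E → 𝒪(b)` with kernel `𝒪(a)` (`exists_coprime_other_chart`).
-- Where `E` has a basis, the image is generated by two elements without common factor. In a domain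
-- these form a regular sequence unless they generate the unit ideal, so the image is `𝓘_Z(b)` with
-- `Z` a local complete intersection of codimension two.
--
-- For `b ≤ a`: the values of a coprime functional over `ℤ[X]` include a nonzero integer
-- (`Coprime.exists_int`). If `b > a`, a suitable integer times `x₁ ^ (b - a - 1)` lifts to
-- `E(-a-1)` on each chart. The two lifts differ by a cocycle of `𝒪(-1)`, which splits because
-- `H¹(𝒪(-1)) = 0` (`exists_T_mul_sub`). This gives a nonzero homomorphism `𝒪(a+1) → E`, against
-- maximality.
--
-- To return to sheaves, local freeness gives quasi-coherence, so that sections over affine open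
-- sets localize. Homomorphisms and the ideal sheaf are then built from data on the charts, and
-- exactness is checked locally on sections.

universe u

attribute [local instance] MvPolynomial.gradedAlgebra

/-! ### Primitive elements and coprime functionals over a factorial domain -/

namespace BundleAlgebra

open Polynomial

section Primitive

variable {R M : Type*} [CommRing R] [AddCommGroup M] [Module R M]

/-- An element `s` of a module is primitive if every relation `x • m = y • s` forces `x ∣ y`. -/
def Primitive (R : Type*) {M : Type*} [CommRing R] [AddCommGroup M] [Module R M] (s : M) : Prop :=
  ∀ (x y : R) (m : M), x • m = y • s → x ∣ y

/-- A functional is coprime if its values have no common divisor, in the strong sense that this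
remains true after multiplication by any `y`. -/
def Coprime (φ : M →ₗ[R] R) : Prop :=
  ∀ x y : R, (∀ m, x ∣ y * φ m) → x ∣ y

lemma Primitive.ne_zero [Nontrivial R] {s : M} (hs : Primitive R s) : s ≠ 0 := by
  rintro rfl
  exact one_ne_zero (zero_dvd_iff.mp (hs 0 1 0 (by simp)))

/-- In a free module containing `M` as a direct summand, divide the coordinates of `s` by their gcd
`c`. The quotient vector lies in `M` again, because the projector `g ∘ f` fixes it after
multiplication by `c ≠ 0`. -/
lemma exists_primitive [IsDomain R] [UniqueFactorizationMonoid R] [Module.Finite R M]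
    [Module.Projective R M] {s : M} (hs : s ≠ 0) :
    ∃ (c : R) (σ : M), s = c • σ ∧ Primitive R σ := by
  classical
  obtain ⟨n, f, g, -, -, hfg⟩ := Module.Finite.exists_comp_eq_id_of_projective R M
  have hfg' (m : M) : f (g m) = m := LinearMap.congr_fun hfg m
  let : NormalizedGCDMonoid R := Classical.arbitrary _
  have hne : (Finset.univ : Finset (Fin n)).Nonempty := by
    by_contra h
    rw [Finset.univ_nonempty_iff, not_nonempty_iff] at h
    exact hs (by rw [← hfg' s, Subsingleton.elim (g s) 0, map_zero])
  obtain ⟨w, hw, hw1⟩ := Finset.extract_gcd (g s) hne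
  set c := Finset.univ.gcd (g s)
  have hcw : g s = c • w := funext fun i => hw i (Finset.mem_univ i)
  have hc : c ≠ 0 := by
    intro h
    apply hs
    rw [← hfg' s, hcw, h, zero_smul, map_zero]
  have hsw : s = c • f w := by rw [← map_smul, ← hcw, hfg']
  have hgw : g (f w) = w := by
    have : c • g (f w) = c • w := by rw [← map_smul, ← hsw, hcw]
    exact funext fun i => mul_left_cancel₀ hc (congrFun this i)
  refine ⟨c, f w, hsw, fun x y m h => ?_⟩
  have h' : ∀ i, x ∣ y * w i := fun i => ⟨g m i, by
    have := congrFun (congrArg g h) i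
    rw [map_smul, map_smul, hgw] at this
    exact this.symm⟩
  have := Finset.dvd_gcd (s := Finset.univ) (f := fun i => y * w i) fun i _ => h' i
  have h1 := Finset.gcd_mul_left' Finset.univ w y
  rw [hw1, mul_one] at h1
  exact this.trans h1.dvd

lemma exists_smul_eq_of_forall_dvd [IsDomain R] {φ : M →ₗ[R] R} {c : R} (hc : c ≠ 0)
    (h : ∀ m, c ∣ φ m) : ∃ ψ : M →ₗ[R] R, c • ψ = φ := by
  choose ψ hψ using h
  refine ⟨{ toFun := ψ, map_add' := fun m n => ?_, map_smul' := fun r m => ?_ }, ?_⟩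
  · apply mul_left_cancel₀ hc
    rw [mul_add, ← hψ, ← hψ, ← hψ, map_add]
  · apply mul_left_cancel₀ hc
    simp only [RingHom.id_apply, smul_eq_mul]
    rw [← hψ, map_smul, hψ m, smul_eq_mul]
    ring
  · ext m
    exact (hψ m).symm

/-- If `x ≠ 0` divides all values of `y • φ`, the quotients form a functional `ψ` with `x • ψ = y •
φ`, a relation in the dual module. Thus `exists_primitive`, applied to the dual, yields coprime
functionals. -/
lemma Primitive.coprime [IsDomain R] {φ : M →ₗ[R] R} (hφ : Primitive R φ) :
    Coprime φ := by
  intro x y h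
  obtain rfl | hx := eq_or_ne x 0
  · exact hφ 0 y 0 (by ext m; simpa using (zero_dvd_iff.mp (h m)).symm)
  · obtain ⟨ψ, hψ⟩ := exists_smul_eq_of_forall_dvd (φ := y • φ) hx h
    exact hφ x y ψ hψ

lemma exists_coprime [IsDomain R] [UniqueFactorizationMonoid R] [Module.Finite R M]
    [Module.Projective R M] {φ : M →ₗ[R] R} (hφ : φ ≠ 0) :
    ∃ (c : R) (ψ : M →ₗ[R] R), φ = c • ψ ∧ Coprime ψ := by
  obtain ⟨c, ψ, h, hψ⟩ := exists_primitive (R := R) (M := Module.Dual R M) hφ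
  exact ⟨c, ψ, h, Primitive.coprime hψ⟩

/-- `M` has generic rank two: there are two linearly independent elements such that every element
has a nonzero multiple in their span. -/
def RankTwo (R M : Type*) [CommRing R] [AddCommGroup M] [Module R M] : Prop :=
  ∃ e₁ e₂ : M, (∀ a b : R, a • e₁ + b • e₂ = 0 → a = 0 ∧ b = 0) ∧
    ∀ m : M, ∃ r : R, r ≠ 0 ∧ ∃ a b : R, r • m = a • e₁ + b • e₂

/-- The coordinates of `m` and `n` solve the same nontrivial linear equation in two unknowns, so
their determinant vanishes. -/
lemma RankTwo.proportional [IsDomain R] (h : RankTwo R M) {φ : M →ₗ[R] R} (hφ : φ ≠ 0)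
    {m n : M} (hm : φ m = 0) (hn : φ n = 0) (hm0 : m ≠ 0) [Module.IsTorsionFree R M] :
    ∃ r : R, r ≠ 0 ∧ ∃ c : R, r • n = c • m := by
  obtain ⟨e₁, e₂, hli, hsp⟩ := h
  have hφ12 : φ e₁ ≠ 0 ∨ φ e₂ ≠ 0 := by
    by_contra! hcon
    apply hφ
    ext x
    obtain ⟨r, hr, a, b, hx⟩ := hsp x
    have := congrArg φ hx
    simp only [map_add, map_smul, smul_eq_mul, hcon.1, hcon.2, mul_zero, add_zero] at this
    simpa using (mul_eq_zero.mp this).resolve_left hr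
  obtain ⟨r, hr, a, b, h1⟩ := hsp m
  obtain ⟨r', hr', a', b', h2⟩ := hsp n
  have k1 : a * φ e₁ + b * φ e₂ = 0 := by
    have := congrArg φ h1
    simp only [map_add, map_smul, smul_eq_mul, hm, mul_zero] at this
    exact this.symm
  have k2 : a' * φ e₁ + b' * φ e₂ = 0 := by
    have := congrArg φ h2
    simp only [map_add, map_smul, smul_eq_mul, hn, mul_zero] at this
    exact this.symm
  have hdet : a * b' - a' * b = 0 := by
    rcases hφ12 with h | h
    · refine (mul_eq_zero.mp (?_ : (a * b' - a' * b) * φ e₁ = 0)).resolve_right h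
      linear_combination b' * k1 - b * k2
    · refine (mul_eq_zero.mp (?_ : (a * b' - a' * b) * φ e₂ = 0)).resolve_right h
      linear_combination -a' * k1 + a * k2
  have hab : a ≠ 0 ∨ b ≠ 0 := by
    by_contra! hcon
    rw [hcon.1, hcon.2, zero_smul, zero_smul, add_zero] at h1
    exact (smul_ne_zero hr hm0) h1
  rcases hab with h | h
  · refine ⟨a * r', mul_ne_zero h hr', a' * r, ?_⟩
    rw [mul_smul, mul_smul, h1, h2, smul_add, smul_add, smul_smul, smul_smul, smul_smul, smul_smul,
      mul_comm a a', sub_eq_zero.mp hdet]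
  · refine ⟨b * r', mul_ne_zero h hr', b' * r, ?_⟩
    rw [mul_smul, mul_smul, h1, h2, smul_add, smul_add, smul_smul, smul_smul, smul_smul, smul_smul,
      mul_comm b b', mul_comm b a', mul_comm b' a, sub_eq_zero.mp hdet]

/-- A primitive element of a module of rank two is the kernel generator of a coprime functional. -/
lemma Primitive.exists_coprime_functional [IsDomain R] [UniqueFactorizationMonoid R]
    [Module.Finite R M] [Module.Projective R M] [Module.IsTorsionFree R M] (h : RankTwo R M) {s : M}
    (hs : Primitive R s) :
    ∃ g : M →ₗ[R] R, Coprime g ∧ ∀ m, g m = 0 ↔ ∃ c : R, m = c • s := by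
  obtain ⟨n, f, γ, -, -, hfγ⟩ := Module.Finite.exists_comp_eq_id_of_projective R M
  have hγ : Function.Injective γ := Function.LeftInverse.injective (g := f)
    fun m => LinearMap.congr_fun hfγ m
  let φ (i : Fin n) : M →ₗ[R] R := LinearMap.proj i ∘ₗ γ
  -- The functional `l i j` is a coordinate of `m ↦ s ∧ m`. If it vanished for all `j`, with `φ i s
  -- ≠ 0`, every `m` would be proportional to `s`, which rank two excludes.
  let l (i j : Fin n) : M →ₗ[R] R := φ i s • φ j - φ j s • φ i
  have hls (i j : Fin n) : l i j s = 0 := by simp [l, mul_comm]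
  obtain ⟨i, hi⟩ : ∃ i, φ i s ≠ 0 := by
    by_contra! hcon
    exact hs.ne_zero (hγ (by rw [map_zero]; exact funext hcon))
  obtain ⟨j, hj⟩ : ∃ j, l i j ≠ 0 := by
    by_contra! hcon
    have key (m : M) : φ i s • m = φ i m • s := by
      apply hγ
      ext j
      have := LinearMap.congr_fun (hcon j) m
      simp only [l, LinearMap.sub_apply, LinearMap.smul_apply, LinearMap.zero_apply, smul_eq_mul,
        sub_eq_zero] at this
      simp only [map_smul, Pi.smul_apply, smul_eq_mul]
      exact this.trans (mul_comm _ _)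
    obtain ⟨e₁, e₂, hli, -⟩ := h
    have h3 : (φ i e₂ * φ i s) • e₁ + (-(φ i e₁ * φ i s)) • e₂ = 0 := by
      rw [neg_smul, mul_smul, mul_smul, key e₁, key e₂, smul_smul, smul_smul, mul_comm,
        add_neg_cancel]
    have h4 := (mul_eq_zero.mp (hli _ _ h3).1).resolve_right hi
    have h5 : (0 : R) • e₁ + φ i s • e₂ = 0 := by rw [key, h4]; simp
    exact hi (hli _ _ h5).2
  obtain ⟨c, g, hcg, hg⟩ := exists_coprime hj
  have hc : c ≠ 0 := by
    rintro rfl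
    exact hj (by rw [hcg, zero_smul])
  have hgs : g s = 0 := by
    have := hls i j
    rw [hcg, LinearMap.smul_apply, smul_eq_mul] at this
    exact (mul_eq_zero.mp this).resolve_left hc
  have hg0 : g ≠ 0 := by
    rintro rfl
    exact hj (by rw [hcg, smul_zero])
  refine ⟨g, hg, fun m => ⟨fun hm => ?_, ?_⟩⟩
  · obtain ⟨r, hr, d, hd⟩ := h.proportional hg0 hgs hm hs.ne_zero
    obtain ⟨e, rfl⟩ := hs r d m hd
    refine ⟨e, smul_right_injective M hr ?_⟩
    simp only [hd, smul_smul]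
  · rintro ⟨c, rfl⟩
    rw [map_smul, hgs, smul_zero]

end Primitive

/-- Over `ℚ[X]` the values generate a principal ideal `(h)`. By Gauss's lemma the primitive part of
an integral multiple of `h` divides every value already over `ℤ[X]`, so it is a unit by coprimality
and `h` is a nonzero constant. Clearing denominators in the resulting expression of `1` gives the
integer. -/
lemma Coprime.exists_int {M : Type*} [AddCommGroup M] [Module ℤ[X] M] {φ : M →ₗ[ℤ[X]] ℤ[X]}
    (hφ : Coprime φ) : ∃ N : ℤ, N ≠ 0 ∧ ∃ m, φ m = C N := by
  let : Algebra ℤ[X] ℚ[X] := (Polynomial.mapRingHom (Int.castRingHom ℚ)).toAlgebra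
  have : IsLocalization (Submonoid.map (C : ℤ →+* ℤ[X]) (nonZeroDivisors ℤ)) ℚ[X] :=
    Polynomial.isLocalization (nonZeroDivisors ℤ) ℚ
  have hmap (p : ℤ[X]) : algebraMap ℤ[X] ℚ[X] p = p.map (Int.castRingHom ℚ) := rfl
  let I : Ideal ℤ[X] := LinearMap.range φ
  let J : Ideal ℚ[X] := I.map (algebraMap ℤ[X] ℚ[X])
  obtain ⟨h, hh⟩ := (IsPrincipalIdealRing.principal J).principal
  have hmem (q : ℚ[X]) : q ∈ J ↔ h ∣ q := by
    rw [hh, Ideal.submodule_span_eq, Ideal.mem_span_singleton]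
  have hφJ (m : M) : h ∣ (φ m).map (Int.castRingHom ℚ) :=
    (hmem _).mp (Ideal.mem_map_of_mem _ (⟨m, rfl⟩ : φ m ∈ I))
  obtain ⟨⟨p, ⟨_, N, hN, rfl⟩⟩, hp⟩ :=
    IsLocalization.surj (Submonoid.map (C : ℤ →+* ℤ[X]) (nonZeroDivisors ℤ)) h
  have hNu : IsUnit (algebraMap ℤ[X] ℚ[X] (C N)) := by
    rw [hmap, Polynomial.map_C, Polynomial.isUnit_C]
    exact isUnit_iff_ne_zero.mpr (by simpa using nonZeroDivisors.ne_zero hN)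
  simp only [hmap] at hp hNu
  have hpp : IsUnit p.primPart := by
    rw [isUnit_iff_dvd_one]
    refine hφ _ _ fun m => ?_
    rw [one_mul, IsPrimitive.Int.dvd_iff_map_cast_dvd_map_cast _ _ p.isPrimitive_primPart]
    refine dvd_trans ?_ (hφJ m)
    rw [← hNu.dvd_mul_right, hp]
    exact Polynomial.map_dvd _ p.primPart_dvd
  have hp0 : p ≠ 0 := by
    rintro rfl
    rw [Polynomial.map_zero] at hp
    have h0 : h = 0 := (hNu.mul_left_eq_zero).mp hp
    refine one_ne_zero (zero_dvd_iff.mp (hφ 0 1 fun m => ?_))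
    have := hφJ m
    rw [h0, zero_dvd_iff, Polynomial.map_eq_zero_iff (RingHom.injective_int _)] at this
    rw [this, mul_zero]
  have hu : IsUnit h := by
    apply isUnit_of_mul_isUnit_left (y := (C N : ℤ[X]).map (Int.castRingHom ℚ))
    rw [hp, p.eq_C_content_mul_primPart, Polynomial.map_mul]
    refine IsUnit.mul ?_ (hpp.map (Polynomial.mapRingHom (Int.castRingHom ℚ)))
    rw [Polynomial.map_C, Polynomial.isUnit_C]
    exact isUnit_iff_ne_zero.mpr (by simpa [content_eq_zero_iff] using hp0)
  have h1 : (1 : ℚ[X]) ∈ J := (hmem _).mpr hu.dvd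
  obtain ⟨⟨⟨_, m, rfl⟩, ⟨_, n, hn, rfl⟩⟩, hx⟩ := (IsLocalization.mem_map_algebraMap_iff
    (Submonoid.map (C : ℤ →+* ℤ[X]) (nonZeroDivisors ℤ)) ℚ[X]).mp h1
  refine ⟨n, nonZeroDivisors.ne_zero hn, m, ?_⟩
  rw [one_mul] at hx
  exact (Polynomial.map_injective _ (RingHom.injective_int (Int.castRingHom ℚ)) hx).symm

end BundleAlgebra

/-! ### Laurent polynomials and the two charts -/

namespace BundleAlgebra

open Polynomial LaurentPolynomial

/-- `ρ : M → N` exhibits `N` as the localization at `X` of the `ℤ[X]`-module `M`, the module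
structure on `N` over the Laurent polynomials being restricted along `ι`. -/
structure ChartMap (ι : ℤ[X] →+* ℤ[T;T⁻¹]) (M N : Type*) [AddCommGroup M] [AddCommGroup N]
    [Module ℤ[X] M] [Module ℤ[T;T⁻¹] N] where
  toFun : M →+ N
  map_smul (p : ℤ[X]) (m : M) : toFun (p • m) = ι p • toFun m
  injective : Function.Injective toFun
  surj (n : N) : ∃ (k : ℕ) (m : M), ι (X ^ k) • n = toFun m

/-- The properties of the two embeddings of `ℤ[X]` in the Laurent polynomials which are used. -/
structure IsChart (ι : ℤ[X] →+* ℤ[T;T⁻¹]) : Prop where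
  injective : Function.Injective ι
  isUnit : IsUnit (ι X)
  surj (x : ℤ[T;T⁻¹]) : ∃ (k : ℕ) (p : ℤ[X]), ι (X ^ k) * x = ι p
  map_C (n : ℤ) : ι (Polynomial.C n) = LaurentPolynomial.C n

/-- The embedding belonging to the chart at infinity. -/
noncomputable def invLaurent : ℤ[X] →+* ℤ[T;T⁻¹] :=
  (invert (R := ℤ) : ℤ[T;T⁻¹] →+* ℤ[T;T⁻¹]).comp toLaurent

lemma invLaurent_apply (p : ℤ[X]) : invLaurent p = invert (toLaurent p) := rfl

lemma invLaurent_X_pow (k : ℕ) : invLaurent (X ^ k) = T (-k) := by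
  rw [invLaurent_apply, toLaurent_X_pow, invert_T]

lemma isChart_toLaurent : IsChart (toLaurent (R := ℤ)) where
  injective := toLaurent_injective
  isUnit := by rw [toLaurent_X]; exact isUnit_T 1
  surj x := by
    obtain ⟨n, f, hf⟩ := exists_T_pow x
    exact ⟨n, f, by rw [hf, toLaurent_X_pow, mul_comm]⟩
  map_C := toLaurent_C

lemma isChart_invLaurent : IsChart invLaurent where
  injective := (invert (R := ℤ)).injective.comp toLaurent_injective
  isUnit := by
    rw [← pow_one X, invLaurent_X_pow]; exact isUnit_T _
  surj x := by
    obtain ⟨n, f, hf⟩ := exists_T_pow (invert x)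
    refine ⟨n, f, ?_⟩
    rw [invLaurent_apply f, hf, map_mul, invert_T, invLaurent_X_pow, mul_comm]
    congr 1
    exact ((involutive_invert (R := ℤ)) x).symm
  map_C n := by rw [invLaurent_apply, toLaurent_C, invert_C]

lemma IsChart.isUnit_X_pow {ι : ℤ[X] →+* ℤ[T;T⁻¹]} (hι : IsChart ι) (k : ℕ) :
    IsUnit (ι (X ^ k)) := by
  rw [map_pow]; exact hι.isUnit.pow k

section

variable {ι : ℤ[X] →+* ℤ[T;T⁻¹]} {M N : Type*} [AddCommGroup M] [AddCommGroup N]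
    [Module ℤ[X] M] [Module ℤ[T;T⁻¹] N]

/-- Powers of `X` are units among the Laurent polynomials, so a relation over them can be cleared of
denominators, used over `ℤ[X]`, and its conclusion carried back. -/
lemma ChartMap.primitive (hι : IsChart ι) (ρ : ChartMap ι M N) {s : M}
    (hs : Primitive ℤ[X] s) : Primitive ℤ[T;T⁻¹] (ρ.toFun s) := by
  intro x y n h
  obtain ⟨i, x', hx⟩ := hι.surj x
  obtain ⟨j, y', hy⟩ := hι.surj y
  obtain ⟨k, m, hm⟩ := ρ.surj n
  have h1 : (X ^ j * x') • m = (X ^ (i + k) * y') • s := by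
    apply ρ.injective
    rw [ρ.map_smul, ρ.map_smul, ← hm, map_mul, map_mul, ← hx, ← hy, smul_smul, pow_add, map_mul,
      show ι (X ^ j) * (ι (X ^ i) * x) * ι (X ^ k) = ι (X ^ j) * ι (X ^ i) * ι (X ^ k) * x by ring,
      mul_smul, h, smul_smul]
    congr 1
    ring
  have h2 := map_dvd ι (hs _ _ _ h1)
  rw [map_mul, map_mul, ← hx, ← hy, (hι.isUnit_X_pow (i + k)).dvd_mul_left,
    (hι.isUnit_X_pow j).dvd_mul_left,
    (hι.isUnit_X_pow j).mul_left_dvd, (hι.isUnit_X_pow i).mul_left_dvd] at h2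
  exact h2

lemma ChartMap.smul_eq_zero [Module.IsTorsionFree ℤ[X] M] (hι : IsChart ι) (ρ : ChartMap ι M N)
    {x : ℤ[T;T⁻¹]} {n : N} (h : x • n = 0) : x = 0 ∨ n = 0 := by
  obtain ⟨i, x', hx⟩ := hι.surj x
  obtain ⟨k, m, hm⟩ := ρ.surj n
  have h1 : x' • m = 0 := by
    apply ρ.injective
    rw [ρ.map_smul, ← hm, ← hx, smul_smul, mul_right_comm, mul_smul, h, smul_zero, map_zero]
  rcases _root_.smul_eq_zero.mp h1 with rfl | rfl
  · left
    rw [map_zero] at hx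
    exact ((hι.isUnit_X_pow i).mul_right_eq_zero).mp hx
  · right
    rw [map_zero] at hm
    exact ((hι.isUnit_X_pow k).smul_eq_zero).mp hm

/-- Clearing denominators in `u` and in its inverse gives two polynomials whose product is a power
of the prime `X`. -/
lemma IsChart.unit_eq (hι : IsChart ι) {u : ℤ[T;T⁻¹]} (hu : IsUnit u) :
    ∃ (ε : ℤ) (i j : ℕ), IsUnit ε ∧ ι (X ^ i) * u = LaurentPolynomial.C ε * ι (X ^ j) := by
  obtain ⟨v, hv⟩ := hu.exists_right_inv
  obtain ⟨i, p, hp⟩ := hι.surj u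
  obtain ⟨j, q, hq⟩ := hι.surj v
  have hpq : p * q = X ^ (i + j) := by
    apply hι.injective
    rw [map_mul, ← hp, ← hq, pow_add, map_mul,
      show ι (X ^ i) * u * (ι (X ^ j) * v) = ι (X ^ i) * ι (X ^ j) * (u * v) by ring, hv, mul_one]
  obtain ⟨k, -, hk⟩ := (dvd_prime_pow prime_X _).mp (Dvd.intro _ hpq)
  obtain ⟨w, hw⟩ := hk.symm
  obtain ⟨ε, hε, hεw⟩ := Polynomial.isUnit_iff.mp w.isUnit
  refine ⟨ε, i, k, hε, ?_⟩
  rw [hp, ← hw, ← hεw, map_mul, hι.map_C, mul_comm]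

end

lemma exists_eq_T_of_isUnit {u : ℤ[T;T⁻¹]} (hu : IsUnit u) :
    ∃ (ε : ℤ) (j : ℤ), IsUnit ε ∧ u = LaurentPolynomial.C ε * T j := by
  obtain ⟨ε, i, j, hε, h⟩ := isChart_toLaurent.unit_eq hu
  refine ⟨ε, j - i, hε, ?_⟩
  rw [toLaurent_X_pow, toLaurent_X_pow] at h
  rw [sub_eq_neg_add, T_add, show LaurentPolynomial.C ε * (T (-(i : ℤ)) * T (j : ℤ)) =
    T (-(i : ℤ)) * (LaurentPolynomial.C ε * T (j : ℤ)) by ring, ← h, ← mul_assoc, ← T_add]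
  simp

/-- This is the vanishing of the global sections of `𝒪(j)` for `j < 0`. Reversing `q` turns the
equation into one between polynomials, in which a nonzero `p` would make the degree of the left side
exceed that of the right. -/
lemma toLaurent_eq_zero_of_eq {p q : ℤ[X]} {j : ℤ} (hj : j < 0)
    (h : toLaurent p = T j * invLaurent q) : p = 0 := by
  obtain ⟨k, rfl⟩ := Int.exists_eq_neg_ofNat hj.le
  have h1 : X ^ (q.natDegree + k) * p = q.reverse := by
    apply toLaurent_injective
    rw [map_mul, toLaurent_X_pow, h, toLaurent_reverse, invLaurent_apply, ← mul_assoc, ← T_add,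
      mul_comm]
    congr 2
    push_cast
    ring
  by_contra hp
  have h2 := q.reverse_natDegree_le
  rw [← h1, natDegree_mul (pow_ne_zero _ X_ne_zero) hp, natDegree_X_pow] at h2
  omega

/-- Every Laurent polynomial is a difference of one with positive and one with nonpositive
exponents. -/
lemma exists_T_mul_sub (x : ℤ[T;T⁻¹]) :
    ∃ p q : ℤ[X], x = T 1 * toLaurent p - invLaurent q := by
  -- This is `H¹(𝒪(-1)) = 0` in Čech form: positive exponents come from one chart, nonpositive ones
  -- from the other, and none is missed.
  induction x using LaurentPolynomial.induction_on' with
  | add f g hf hg =>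
    obtain ⟨p, q, rfl⟩ := hf
    obtain ⟨p', q', rfl⟩ := hg
    exact ⟨p + p', q + q', by simp only [map_add]; ring⟩
  | C_mul_T n a =>
    rcases le_or_gt n 0 with hn | hn
    · obtain ⟨k, rfl⟩ := Int.exists_eq_neg_ofNat hn
      refine ⟨0, -(Polynomial.C a * X ^ k), ?_⟩
      rw [map_neg, map_mul, invLaurent_X_pow, isChart_invLaurent.map_C]
      simp
    · obtain ⟨k, rfl⟩ := Int.eq_ofNat_of_zero_le hn.le
      obtain ⟨k, rfl⟩ := Nat.exists_eq_succ_of_ne_zero (n := k) (by omega)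
      refine ⟨Polynomial.C a * X ^ k, 0, ?_⟩
      rw [map_mul, toLaurent_X_pow, toLaurent_C]
      simp only [map_zero, sub_zero, Nat.succ_eq_add_one, Nat.cast_add, T_add, Nat.cast_one]
      ring

end BundleAlgebra

/-! ### Rank two bundles as gluing data -/

namespace BundleAlgebra

open Polynomial LaurentPolynomial

lemma ChartMap.exists_extend {ι : ℤ[X] →+* ℤ[T;T⁻¹]} {M N : Type*} [AddCommGroup M]
    [AddCommGroup N] [Module ℤ[X] M] [Module ℤ[T;T⁻¹] N] (hι : IsChart ι) (ρ : ChartMap ι M N)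
    (φ : M →ₗ[ℤ[X]] ℤ[X]) :
    ∃ ψ : N →ₗ[ℤ[T;T⁻¹]] ℤ[T;T⁻¹], ∀ m, ψ (ρ.toFun m) = ι (φ m) := by
  -- The value `z` is required to fit every representation of `n` as a fraction at once; this makes
  -- additivity and linearity checks on any convenient representation.
  have hex (n : N) : ∃ z : ℤ[T;T⁻¹], ∀ (k : ℕ) (m : M), ι (X ^ k) • n = ρ.toFun m →
      ι (X ^ k) * z = ι (φ m) := by
    obtain ⟨k, m, hm⟩ := ρ.surj n
    obtain ⟨z, hz⟩ : ∃ z, ι (φ m) = ι (X ^ k) * z := (hι.isUnit_X_pow k).dvd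
    refine ⟨z, fun k' m' hm' => ?_⟩
    have h1 : (X ^ k' : ℤ[X]) • m = (X ^ k : ℤ[X]) • m' := by
      apply ρ.injective
      rw [ρ.map_smul, ρ.map_smul, ← hm, ← hm', smul_smul, smul_smul, mul_comm]
    have h2 : ι (φ ((X ^ k' : ℤ[X]) • m)) = ι (φ ((X ^ k : ℤ[X]) • m')) := by rw [h1]
    rw [LinearMap.map_smul, LinearMap.map_smul, smul_eq_mul, smul_eq_mul, map_mul ι, map_mul ι,
      hz] at h2
    apply (hι.isUnit_X_pow k).mul_left_cancel
    rw [← h2]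
    ring
  choose ψ hψ using hex
  have hψ' (n : N) (k : ℕ) (m : M) (z : ℤ[T;T⁻¹]) (h : ι (X ^ k) • n = ρ.toFun m)
      (hz : ι (X ^ k) * z = ι (φ m)) : ψ n = z :=
    (hι.isUnit_X_pow k).mul_left_cancel ((hψ n k m h).trans hz.symm)
  refine ⟨{ toFun := ψ, map_add' := fun n n' => ?_, map_smul' := fun x n => ?_ }, fun m => ?_⟩
  · obtain ⟨k, m, hm⟩ := ρ.surj n
    obtain ⟨k', m', hm'⟩ := ρ.surj n'
    have h1 := hψ n k m hm
    have h2 := hψ n' k' m' hm'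
    refine hψ' _ (k + k') ((X ^ k' : ℤ[X]) • m + (X ^ k : ℤ[X]) • m') _ ?_ ?_
    · rw [map_add, ρ.map_smul, ρ.map_smul, ← hm, ← hm', smul_smul, smul_smul, smul_add, pow_add,
        map_mul, mul_comm]
    · rw [map_add, LinearMap.map_smul, LinearMap.map_smul, smul_eq_mul, smul_eq_mul, map_add,
        map_mul, map_mul ι _ (φ m'), ← h1, ← h2, pow_add, map_mul]
      ring
  · obtain ⟨k, m, hm⟩ := ρ.surj n
    obtain ⟨i, p, hp⟩ := hι.surj x
    have h1 := hψ n k m hm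
    refine hψ' _ (i + k) (p • m) _ ?_ ?_
    · rw [ρ.map_smul, ← hm, ← hp, smul_smul, smul_smul, pow_add, map_mul]
      congr 1
      ring
    · rw [LinearMap.map_smul, smul_eq_mul p, map_mul ι p, ← h1, ← hp, pow_add, map_mul,
        RingHom.id_apply, smul_eq_mul]
      ring
  · exact hψ' _ 0 m _ (by simp) (by simp)

section Pair

variable {M₀ M₁ N : Type*} [AddCommGroup M₀] [AddCommGroup M₁] [AddCommGroup N] [Module ℤ[X] M₀]
  [Module ℤ[X] M₁] [Module ℤ[T;T⁻¹] N]

/-- A functional on the first chart extends over the second with a pole. Since `M₁` is finitely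
generated the pole order is bounded by some `K`, and the functional becomes a homomorphism to
`𝒪(K)`. Compatibility is stated for pairs that agree up to `T k`, because an element of `M₀` has a
partner in `M₁` only after such a factor. -/
lemma exists_extend_other_chart [Module.Finite ℤ[X] M₁] (ρ₀ : ChartMap toLaurent M₀ N)
    (ρ₁ : ChartMap invLaurent M₁ N) (φ : M₀ →ₗ[ℤ[X]] ℤ[X]) :
    ∃ (K : ℤ) (φ₁ : M₁ →ₗ[ℤ[X]] ℤ[X]), ∀ (m₀ : M₀) (m₁ : M₁) (k : ℤ),
      ρ₁.toFun m₁ = (T k : ℤ[T;T⁻¹]) • ρ₀.toFun m₀ →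
      T K * invLaurent (φ₁ m₁) = T k * toLaurent (φ m₀) := by
  classical
  obtain ⟨ψ, hψ⟩ := ρ₀.exists_extend isChart_toLaurent φ
  obtain ⟨t, ht⟩ := Module.Finite.fg_top (R := ℤ[X]) (M := M₁)
  choose d p hp using fun m => isChart_invLaurent.surj (ψ (ρ₁.toFun m))
  let K : ℕ := ∑ m ∈ t, d m
  have hex (m : M₁) : ∃ r, invLaurent (X ^ K) * ψ (ρ₁.toFun m) = invLaurent r := by
    have hm : m ∈ Submodule.span ℤ[X] (t : Set M₁) := by rw [ht]; trivial
    induction hm using Submodule.span_induction with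
    | mem m hm =>
      refine ⟨X ^ (K - d m) * p m, ?_⟩
      have hK : d m ≤ K := Finset.single_le_sum (fun _ _ => Nat.zero_le _) hm
      rw [map_mul, ← hp, ← mul_assoc, ← map_mul, ← pow_add, Nat.sub_add_cancel hK]
    | zero => exact ⟨0, by simp⟩
    | add x y _ _ hx hy =>
      obtain ⟨r, hr⟩ := hx
      obtain ⟨r', hr'⟩ := hy
      exact ⟨r + r', by rw [map_add, map_add, map_add, mul_add, hr, hr']⟩
    | smul a x _ hx =>
      obtain ⟨r, hr⟩ := hx
      exact ⟨a * r, by rw [ρ₁.map_smul, map_smul, smul_eq_mul, mul_left_comm, hr, map_mul]⟩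
  choose φ₁ hφ₁ using hex
  refine ⟨K, { toFun := φ₁, map_add' := fun m n => ?_, map_smul' := fun r m => ?_ },
    fun m₀ m₁ k h => ?_⟩
  · apply isChart_invLaurent.injective
    rw [map_add, ← hφ₁, ← hφ₁, ← hφ₁, map_add, map_add, mul_add]
  · apply isChart_invLaurent.injective
    rw [RingHom.id_apply, smul_eq_mul, map_mul, ← hφ₁, ← hφ₁, ρ₁.map_smul, map_smul, smul_eq_mul,
      mul_left_comm]
  · simp only [LinearMap.coe_mk, AddHom.coe_mk]
    rw [← hφ₁, h, map_smul, hψ, smul_eq_mul, invLaurent_X_pow, ← mul_assoc, ← T_add]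
    simp

/-- Write the sections as `γ • σ₀` and `δ • σ₁` with primitive `σ₀`, `σ₁`. Primitivity persists in
`N`, so `T a * γ` and `δ` divide each other on the overlap and differ by a unit `±T ^ j`. Up to
sign, `γ` and `δ` then form a nonzero section of `𝒪(j - a)`, whence `a ≤ j`. -/
lemma exists_primitive_pair [Module.Finite ℤ[X] M₀] [Module.Finite ℤ[X] M₁]
    [Module.Projective ℤ[X] M₀] [Module.Projective ℤ[X] M₁] [Module.IsTorsionFree ℤ[X] M₁]
    (ρ₀ : ChartMap toLaurent M₀ N) (ρ₁ : ChartMap invLaurent M₁ N) {s₀ : M₀} (h₀ : s₀ ≠ 0)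
    {s₁ : M₁} {a : ℤ}
    (h : ρ₁.toFun s₁ = (T a : ℤ[T;T⁻¹]) • ρ₀.toFun s₀) :
    ∃ (σ₀ : M₀) (σ₁ : M₁) (a' : ℤ), Primitive ℤ[X] σ₀ ∧ Primitive ℤ[X] σ₁ ∧ a ≤ a' ∧
      ρ₁.toFun σ₁ = (T a' : ℤ[T;T⁻¹]) • ρ₀.toFun σ₀ := by
  have h₁ : s₁ ≠ 0 := by
    rintro rfl
    rw [map_zero] at h
    exact h₀ (ρ₀.injective (((isUnit_T a).smul_eq_zero.mp h.symm).trans (map_zero _).symm))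
  obtain ⟨γ, σ₀, rfl, hσ₀⟩ := exists_primitive (R := ℤ[X]) h₀
  obtain ⟨δ, σ₁, rfl, hσ₁⟩ := exists_primitive (R := ℤ[X]) h₁
  rw [ρ₀.map_smul, ρ₁.map_smul, smul_smul] at h
  have hd₁ := ρ₀.primitive isChart_toLaurent hσ₀ _ _ _ h
  have hd₂ := ρ₁.primitive isChart_invLaurent hσ₁ _ _ _ h.symm
  obtain ⟨u, hu⟩ := associated_of_dvd_dvd hd₁ hd₂
  obtain ⟨ε, j, hε, huj⟩ := exists_eq_T_of_isUnit u.isUnit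
  have hδ : invLaurent δ ≠ 0 := by
    rw [map_ne_zero_iff _ isChart_invLaurent.injective]
    rintro rfl
    exact h₁ (zero_smul _ _)
  have hγ : γ ≠ 0 := by
    rintro rfl
    exact h₀ (zero_smul _ _)
  have h2 : ρ₁.toFun σ₁ = (u : ℤ[T;T⁻¹]) • ρ₀.toFun σ₀ := by
    rw [← hu, mul_smul] at h
    have : invLaurent δ • (ρ₁.toFun σ₁ - (u : ℤ[T;T⁻¹]) • ρ₀.toFun σ₀) = 0 := by
      rw [smul_sub, h, sub_self]
    exact sub_eq_zero.mp ((ρ₁.smul_eq_zero isChart_invLaurent this).resolve_left hδ)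
  -- The sign `ε` is absorbed in `σ₀`, so that the transition factor is exactly a power of `T`.
  refine ⟨Polynomial.C ε • σ₀, σ₁, j, ?_, hσ₁, ?_, ?_⟩
  · intro x y m hxy
    rw [smul_smul] at hxy
    have := hσ₀ _ _ _ hxy
    rwa [(Polynomial.isUnit_C.mpr hε).dvd_mul_right] at this
  · by_contra! hlt
    apply hγ
    refine toLaurent_eq_zero_of_eq (p := γ) (q := Polynomial.C ε * δ) (j := j - a) (by omega) ?_
    rw [map_mul, isChart_invLaurent.map_C]
    apply (isUnit_T a).mul_left_cancel
    rw [← hu, huj, ← mul_assoc (T a), ← T_add, add_sub_cancel]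
    ring
  · rw [h2, huj, ρ₀.map_smul, isChart_toLaurent.map_C, smul_smul, mul_comm]

/-- The coordinates of `M₀` in a free module extend to homomorphisms to `𝒪(K i)`. They take a
section of degree `a` to sections of `𝒪(K i - a)`, which all vanish once `a` exceeds every `K i`. -/
lemma exists_bound_of_sections [Module.Finite ℤ[X] M₀] [Module.Projective ℤ[X] M₀]
    [Module.Finite ℤ[X] M₁] (ρ₀ : ChartMap toLaurent M₀ N) (ρ₁ : ChartMap invLaurent M₁ N) :
    ∃ B : ℤ, ∀ (a : ℤ) (s₀ : M₀) (s₁ : M₁), s₀ ≠ 0 →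
      ρ₁.toFun s₁ = (T a : ℤ[T;T⁻¹]) • ρ₀.toFun s₀ → a ≤ B := by
  obtain ⟨n, f, γ, -, -, hfγ⟩ := Module.Finite.exists_comp_eq_id_of_projective ℤ[X] M₀
  have hγ : Function.Injective γ := Function.LeftInverse.injective (g := f)
    fun m => LinearMap.congr_fun hfγ m
  choose K φ₁ hφ using fun i : Fin n =>
    exists_extend_other_chart ρ₀ ρ₁ (LinearMap.proj i ∘ₗ γ)
  obtain ⟨B, hB⟩ := (Set.finite_range K).bddAbove
  refine ⟨B, fun a s₀ s₁ hs h => ?_⟩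
  by_contra! hlt
  apply hs
  apply hγ
  ext1 i
  have h1 := hφ i s₀ s₁ a h
  have hi : K i ≤ B := hB ⟨i, rfl⟩
  rw [map_zero, Pi.zero_apply]
  refine toLaurent_eq_zero_of_eq (j := K i - a) (q := φ₁ i s₁) (by omega) ?_
  apply (isUnit_T a).mul_left_cancel
  refine h1.symm.trans ?_
  rw [← mul_assoc, ← T_add, add_sub_cancel]

/-- Up to a power of the unit `ι X`, the element `x` is a polynomial `p` not divisible by `X`. Being
prime to the denominators, `p` divides the values of `g` over `ℤ[X]`, so coprimality makes it a
unit. -/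
lemma IsChart.isUnit_of_forall_dvd {ι : ℤ[X] →+* ℤ[T;T⁻¹]} (hι : IsChart ι) {g : M₀ →ₗ[ℤ[X]] ℤ[X]}
    (hg : Coprime g) {x : ℤ[T;T⁻¹]} (h : ∀ m, x ∣ ι (g m)) : IsUnit x := by
  obtain ⟨i, x', hx⟩ := hι.surj x
  have hx0 : x' ≠ 0 := by
    rintro rfl
    rw [map_zero, (hι.isUnit_X_pow i).mul_right_eq_zero] at hx
    refine one_ne_zero (zero_dvd_iff.mp (hg 0 1 fun m => ?_))
    have h1 := h m
    rw [hx, zero_dvd_iff, map_eq_zero_iff _ hι.injective] at h1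
    rw [h1, mul_zero]
  obtain ⟨n, p, hp, rfl⟩ := WfDvdMonoid.max_power_factor hx0
    (Polynomial.prime_X (R := ℤ)).irreducible
  have hrel (k : ℕ) : IsRelPrime p (X ^ k) :=
    (((Polynomial.prime_X (R := ℤ)).irreducible.isRelPrime_iff_not_dvd.mpr hp).symm).pow_right
  have hdvd (m : M₀) : p ∣ g m := by
    obtain ⟨y, hy⟩ := h m
    obtain ⟨k, q, hq⟩ := hι.surj y
    refine (hrel (i + k)).dvd_of_dvd_mul_left (Dvd.intro (X ^ n * q) ?_)
    apply hι.injective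
    rw [map_mul (f := ι) (X ^ (i + k)), hy, pow_add, map_mul (f := ι) (X ^ i),
      show ι (X ^ i) * ι (X ^ k) * (x * y) = (ι (X ^ i) * x) * (ι (X ^ k) * y) by ring, hx, hq,
      ← map_mul]
    congr 1
    ring
  have hpu : IsUnit p := isUnit_of_dvd_one (hg p 1 fun m => by rw [one_mul]; exact hdvd m)
  have h2 : IsUnit (ι (X ^ i) * x) := by
    rw [hx, map_mul]
    exact (hι.isUnit_X_pow n).mul (hpu.map ι)
  exact isUnit_of_mul_isUnit_right h2

/-- Extend `g₀` to the second chart and divide by the common factor `δ` of the extension. Since `g₀`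
is coprime, `δ` is invertible on the overlap, hence `±T ^ j`; the division merely shifts the twist
from `K` to `b = K + j`. -/
lemma exists_coprime_other_chart [Module.Finite ℤ[X] M₁] [Module.Projective ℤ[X] M₁]
    [Module.IsTorsionFree ℤ[X] M₁] (ρ₀ : ChartMap toLaurent M₀ N) (ρ₁ : ChartMap invLaurent M₁ N)
    {σ₀ : M₀} {σ₁ : M₁} {a : ℤ}
    (hσ₁ : Primitive ℤ[X] σ₁) (h : ρ₁.toFun σ₁ = (T a : ℤ[T;T⁻¹]) • ρ₀.toFun σ₀)
    {g₀ : M₀ →ₗ[ℤ[X]] ℤ[X]} (hg₀ : Coprime g₀)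
    (hker : ∀ m, g₀ m = 0 ↔ ∃ c : ℤ[X], m = c • σ₀) :
    ∃ (b : ℤ) (g₁ : M₁ →ₗ[ℤ[X]] ℤ[X]), Coprime g₁ ∧
      (∀ m, g₁ m = 0 ↔ ∃ c : ℤ[X], m = c • σ₁) ∧
      ∀ (m₀ : M₀) (m₁ : M₁) (k : ℤ), ρ₁.toFun m₁ = (T k : ℤ[T;T⁻¹]) • ρ₀.toFun m₀ →
        T b * invLaurent (g₁ m₁) = T k * toLaurent (g₀ m₀) := by
  obtain ⟨K, g', hg'⟩ := exists_extend_other_chart ρ₀ ρ₁ g₀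
  have hlift (m₀ : M₀) : ∃ (k : ℕ) (m₁ : M₁),
      ρ₁.toFun m₁ = (T (-k) : ℤ[T;T⁻¹]) • ρ₀.toFun m₀ := by
    obtain ⟨k, m₁, hm⟩ := ρ₁.surj (ρ₀.toFun m₀)
    exact ⟨k, m₁, by rw [← hm, invLaurent_X_pow]⟩
  have hne : g' ≠ 0 := by
    rintro rfl
    refine one_ne_zero (zero_dvd_iff.mp (hg₀ 0 1 fun m => ?_))
    obtain ⟨k, m₁, hm⟩ := hlift m
    have h1 := hg' _ _ _ hm
    rw [LinearMap.zero_apply, map_zero, mul_zero] at h1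
    have h2 := (isUnit_T (R := ℤ) (-k)).mul_right_eq_zero.mp h1.symm
    rw [map_eq_zero_iff _ isChart_toLaurent.injective] at h2
    rw [h2, mul_zero]
  obtain ⟨δ, g₁, rfl, hg₁⟩ := exists_coprime hne
  have hδ : IsUnit (invLaurent δ) := by
    refine isChart_toLaurent.isUnit_of_forall_dvd hg₀ fun m => ?_
    obtain ⟨k, m₁, hm⟩ := hlift m
    have h1 := hg' _ _ _ hm
    rw [LinearMap.smul_apply, smul_eq_mul, map_mul, mul_left_comm] at h1
    exact (isUnit_T (R := ℤ) (-k)).dvd_mul_left.mp (Dvd.intro _ h1)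
  obtain ⟨ε, j, hε, hδ⟩ := exists_eq_T_of_isUnit hδ
  have hε' : IsUnit (Polynomial.C ε) := Polynomial.isUnit_C.mpr hε
  have hcompat : ∀ (m₀ : M₀) (m₁ : M₁) (k : ℤ), ρ₁.toFun m₁ = (T k : ℤ[T;T⁻¹]) • ρ₀.toFun m₀ →
      T (K + j) * invLaurent ((Polynomial.C ε • g₁) m₁) = T k * toLaurent (g₀ m₀) := by
    intro m₀ m₁ k hk
    rw [← hg' _ _ _ hk, LinearMap.smul_apply, LinearMap.smul_apply, smul_eq_mul, smul_eq_mul,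
      map_mul, map_mul, hδ, isChart_invLaurent.map_C, T_add]
    ring
  refine ⟨K + j, Polynomial.C ε • g₁, fun x y hxy => hg₁ x y fun m => ?_,
  fun m => ⟨fun hm => ?_, ?_⟩,
    hcompat⟩
  · have h1 := hxy m
    rwa [LinearMap.smul_apply, smul_eq_mul, mul_left_comm, hε'.dvd_mul_left] at h1
  · obtain ⟨k, m₀, hm₀⟩ := ρ₀.surj (ρ₁.toFun m)
    rw [toLaurent_X_pow] at hm₀
    have h1 : ρ₁.toFun m = (T (-k) : ℤ[T;T⁻¹]) • ρ₀.toFun m₀ := by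
      rw [← hm₀, smul_smul, ← T_add]
      simp
    have h2 := hcompat _ _ _ h1
    rw [hm, map_zero, mul_zero] at h2
    have h3 := (isUnit_T (R := ℤ) (-k)).mul_right_eq_zero.mp h2.symm
    rw [map_eq_zero_iff _ isChart_toLaurent.injective] at h3
    obtain ⟨c, rfl⟩ := (hker _).mp h3
    have h4 : ρ₁.toFun m = (T (-k) * toLaurent c * T (-a)) • ρ₁.toFun σ₁ := by
      rw [h1, h, ρ₀.map_smul, smul_smul, smul_smul, mul_assoc _ (T (-a)), ← T_add]
      simp
    obtain ⟨n, p, hp⟩ := isChart_invLaurent.surj (T (-k) * toLaurent c * T (-a))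
    have h5 : (X ^ n : ℤ[X]) • m = p • σ₁ := by
      apply ρ₁.injective
      rw [ρ₁.map_smul, ρ₁.map_smul, h4, smul_smul, hp]
    obtain ⟨c', rfl⟩ := hσ₁ _ _ _ h5
    refine ⟨c', smul_right_injective _ (pow_ne_zero (M₀ := ℤ[X]) n Polynomial.X_ne_zero) ?_⟩
    simp only [h5, smul_smul]
  · rintro ⟨c, rfl⟩
    have h1 := hcompat _ _ _ h
    rw [(hker σ₀).mpr ⟨1, (one_smul _ _).symm⟩, map_zero, mul_zero] at h1
    have h2 := (isUnit_T (R := ℤ) (K + j)).mul_right_eq_zero.mp h1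
    rw [map_eq_zero_iff _ isChart_invLaurent.injective] at h2
    rw [map_smul, h2, smul_zero]

/-- The sections of a rank two bundle on the projective line: `s₀`, `s₁` define a homomorphism from
the line bundle of degree `a` and `g₀`, `g₁` a homomorphism to the line bundle of degree `b`. -/
theorem exists_extension_data [Module.Finite ℤ[X] M₀] [Module.Finite ℤ[X] M₁]
    [Module.Projective ℤ[X] M₀] [Module.Projective ℤ[X] M₁] [Module.IsTorsionFree ℤ[X] M₀]
    [Module.IsTorsionFree ℤ[X] M₁] (ρ₀ : ChartMap toLaurent M₀ N) (ρ₁ : ChartMap invLaurent M₁ N)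
    (hM₀ : RankTwo ℤ[X] M₀) :
    ∃ (a b : ℤ) (s₀ : M₀) (s₁ : M₁) (g₀ : M₀ →ₗ[ℤ[X]] ℤ[X]) (g₁ : M₁ →ₗ[ℤ[X]] ℤ[X]), b ≤ a ∧
      s₀ ≠ 0 ∧ s₁ ≠ 0 ∧ ρ₁.toFun s₁ = (T a : ℤ[T;T⁻¹]) • ρ₀.toFun s₀ ∧ Coprime g₀ ∧ Coprime g₁ ∧
      (∀ m, g₀ m = 0 ↔ ∃ c : ℤ[X], m = c • s₀) ∧ (∀ m, g₁ m = 0 ↔ ∃ c : ℤ[X], m = c • s₁) ∧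
      ∀ (m₀ : M₀) (m₁ : M₁) (k : ℤ), ρ₁.toFun m₁ = (T k : ℤ[T;T⁻¹]) • ρ₀.toFun m₀ →
        T b * invLaurent (g₁ m₁) = T k * toLaurent (g₀ m₀) := by
  let P (a : ℤ) : Prop := ∃ (s₀ : M₀) (s₁ : M₁), s₀ ≠ 0 ∧
    ρ₁.toFun s₁ = (T a : ℤ[T;T⁻¹]) • ρ₀.toFun s₀
  have hbdd : ∃ B, ∀ a, P a → a ≤ B := by
    obtain ⟨B, hB⟩ := exists_bound_of_sections ρ₀ ρ₁
    exact ⟨B, fun a ⟨s₀, s₁, h₀, h⟩ => hB a s₀ s₁ h₀ h⟩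
  have hex : ∃ a, P a := by
    obtain ⟨e₁, e₂, hli, -⟩ := hM₀
    obtain ⟨k, m₁, hm⟩ := ρ₁.surj (ρ₀.toFun e₁)
    exact ⟨-k, e₁, m₁, fun h => one_ne_zero (hli 1 0 (by simp [h])).1,
      by rw [← hm, invLaurent_X_pow]⟩
  obtain ⟨a, ⟨s₀, s₁, hs₀, hs⟩, hmax⟩ := Int.exists_greatest_of_bdd hbdd hex
  -- By maximality the primitive pair has the same degree `a`.
  obtain ⟨σ₀, σ₁, a', hσ₀, hσ₁, ha, hσ⟩ := exists_primitive_pair ρ₀ ρ₁ hs₀ hs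
  obtain rfl : a = a' := ha.antisymm (hmax _ ⟨σ₀, σ₁, hσ₀.ne_zero, hσ⟩)
  obtain ⟨g₀, hg₀, hker₀⟩ := hσ₀.exists_coprime_functional hM₀
  obtain ⟨b, g₁, hg₁, hker₁, hg⟩ := exists_coprime_other_chart ρ₀ ρ₁ hσ₁ hσ hg₀ hker₀
  refine ⟨a, b, σ₀, σ₁, g₀, g₁, ?_, hσ₀.ne_zero, hσ₁.ne_zero, hσ, hg₀, hg₁, hker₀, hker₁, hg⟩
  -- If `b > a`, the common integer `N₀ * N₁` is lifted along both functionals. The discrepancy of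
  -- the lifts on the overlap is killed by the functional, so it is a multiple `ℓ` of `σ₀`.
  by_contra! hab
  obtain ⟨N₀, hN₀, m₀', hm₀'⟩ := hg₀.exists_int
  obtain ⟨N₁, hN₁, m₁', hm₁'⟩ := hg₁.exists_int
  obtain ⟨m₀, hm₀⟩ : ∃ m₀, g₀ m₀ = Polynomial.C (N₀ * N₁) :=
    ⟨Polynomial.C N₁ • m₀', by rw [map_smul, hm₀', smul_eq_mul, ← map_mul, mul_comm]⟩
  obtain ⟨m₁, hm₁⟩ : ∃ m₁, g₁ m₁ = Polynomial.C (N₀ * N₁) :=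
    ⟨Polynomial.C N₀ • m₁', by rw [map_smul, hm₁', smul_eq_mul, ← map_mul]⟩
  obtain ⟨ℓ, hℓ⟩ : ∃ ℓ : ℤ[T;T⁻¹], ρ₁.toFun m₁ - (T b : ℤ[T;T⁻¹]) • ρ₀.toFun m₀ =
      ℓ • ρ₀.toFun σ₀ := by
    obtain ⟨n, m, hm⟩ := ρ₀.surj (ρ₁.toFun m₁)
    rw [toLaurent_X_pow] at hm
    have h1 : ρ₁.toFun m₁ = (T (-n) : ℤ[T;T⁻¹]) • ρ₀.toFun m := by
      rw [← hm, smul_smul, ← T_add]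
      simp
    have h2 := hg _ _ _ h1
    rw [hm₁, isChart_invLaurent.map_C] at h2
    -- The exponent `b` may be negative; the extra power `X ^ c` keeps both terms inside `M₀`.
    obtain ⟨c, e, hce⟩ : ∃ c e : ℕ, (e : ℤ) = n + c + b :=
      ⟨b.natAbs, (n + b.natAbs + b).toNat, by omega⟩
    have h3 : g₀ ((X ^ c : ℤ[X]) • m - (X ^ e : ℤ[X]) • m₀) = 0 := by
      apply isChart_toLaurent.injective
      have h4 : (T n * T (-n) : ℤ[T;T⁻¹]) = 1 := by rw [← T_add]; simp
      have h5 : (T e : ℤ[T;T⁻¹]) = T n * T c * T b := by rw [hce, T_add, T_add]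
      rw [map_sub, map_sub, LinearMap.map_smul, LinearMap.map_smul, hm₀, map_zero, smul_eq_mul,
        smul_eq_mul, map_mul, map_mul, toLaurent_X_pow, toLaurent_X_pow, toLaurent_C, h5]
      linear_combination -T c * T n * h2 - T c * toLaurent (g₀ m) * h4
    obtain ⟨q, hq⟩ := (hker₀ _).mp h3
    have h4 := congrArg (fun x => (T (-(n + c)) : ℤ[T;T⁻¹]) • ρ₀.toFun x) hq
    refine ⟨T (-(n + c)) * toLaurent q, ?_⟩
    simp only [map_sub, ρ₀.map_smul, toLaurent_X_pow, smul_sub, smul_smul, ← T_add, hce] at h4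
    rw [← h4, h1]
    congr 3 <;> ring
  -- Relative to degree `a + 1` the discrepancy is a cocycle of `𝒪(-1)`, and it is split here.
  obtain ⟨r₀, r₁, hr⟩ := exists_T_mul_sub (T (-a) * ℓ)
  have hℓ' : ℓ = T (a + 1) * toLaurent r₀ - T a * invLaurent r₁ := by
    apply (isUnit_T (R := ℤ) (-a)).mul_left_cancel
    rw [hr, mul_sub, ← mul_assoc, ← mul_assoc, ← T_add, ← T_add]
    simp
  obtain ⟨d, rfl⟩ : ∃ d : ℕ, b = a + 1 + d := ⟨(b - a - 1).toNat, by omega⟩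
  have hsec : P (a + 1) := by
    -- The corrected lifts form a pair of degree `a + 1`. It is nonzero because `g₀` maps its first
    -- member to `X ^ d` times the nonzero constant `N₀ * N₁`.
    refine ⟨(X ^ d : ℤ[X]) • m₀ + r₀ • σ₀, m₁ + r₁ • σ₁, fun h0 => ?_, ?_⟩
    · have h1 := congrArg g₀ h0
      rw [map_add, LinearMap.map_smul, LinearMap.map_smul, (hker₀ σ₀).mpr ⟨1, (one_smul _ _).symm⟩,
        hm₀, smul_zero, add_zero, map_zero, smul_eq_mul, mul_eq_zero, Polynomial.C_eq_zero] at h1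
      exact h1.elim (pow_ne_zero _ Polynomial.X_ne_zero) (mul_ne_zero hN₀ hN₁)
    · rw [map_add, map_add, ρ₀.map_smul, ρ₀.map_smul, ρ₁.map_smul, hσ, eq_add_of_sub_eq hℓ, hℓ',
        toLaurent_X_pow, smul_add, sub_smul, smul_smul, smul_smul, smul_smul, T_add (a + 1),
        mul_comm (invLaurent r₁)]
      abel
  have := hmax _ hsec
  omega

end Pair

end BundleAlgebra

/-! ### Homomorphisms and exactness of sheaves of modules through sections -/

namespace AlgebraicGeometry.Scheme

/-- Restriction of functions to a smaller open set. -/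
noncomputable def resFun (X : Scheme.{u}) {V U : X.Opens} (h : V ≤ U) : Γ(X, U) →+* Γ(X, V) :=
  (X.presheaf.map (homOfLE h).op).hom

section

variable {X : Scheme.{u}} {U V W : X.Opens}

@[simp]
lemma resFun_resFun (h : W ≤ V) (h' : V ≤ U) (r : Γ(X, U)) :
    X.resFun h (X.resFun h' r) = X.resFun (h.trans h') r := by
  simp only [resFun, ← CategoryTheory.comp_apply, ← Functor.map_comp]
  rfl

@[simp]
lemma resFun_self (h : U ≤ U) (r : Γ(X, U)) : X.resFun h r = r := by
  simp [resFun]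

lemma isUnit_resFun_basicOpen (r : Γ(X, U)) (h : V ≤ X.basicOpen r) :
    IsUnit (X.resFun (h.trans (X.basicOpen_le r)) r) := by
  rw [← resFun_resFun h (X.basicOpen_le r)]
  exact (RingedSpace.isUnit_res_basicOpen _ r).map _

end

namespace Modules

variable {X : Scheme.{u}}

/-- Restriction of sections to a smaller open set. -/
noncomputable def res (M : X.Modules) {V U : X.Opens} (h : V ≤ U) : Γ(M, U) →+ Γ(M, V) :=
  (M.presheaf.map (homOfLE h).op).hom

variable {L M N : X.Modules} {U V W : X.Opens}

@[simp]
lemma res_res (h : W ≤ V) (h' : V ≤ U) (m : Γ(M, U)) :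
    M.res h (M.res h' m) = M.res (h.trans h') m := by
  simp only [res, ← AddMonoidHom.comp_apply, ← AddCommGrpCat.hom_comp, ← Functor.map_comp]
  rfl

@[simp]
lemma res_self (h : U ≤ U) (m : Γ(M, U)) : M.res h m = m := by
  simp [res]

@[simp]
lemma res_smul (h : V ≤ U) (r : Γ(X, U)) (m : Γ(M, U)) :
    M.res h (r • m) = X.resFun h r • M.res h m :=
  M.map_smul (homOfLE h) r m

lemma app_res (φ : M ⟶ N) (h : V ≤ U) (m : Γ(M, U)) :
    φ.app V (M.res h m) = N.res h (φ.app U m) :=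
  congr($(φ.mapPresheaf.naturality (homOfLE h).op) m)

lemma eq_of_locally_eq {m n : Γ(M, U)}
    (h : ∀ x ∈ U, ∃ (V : X.Opens) (hV : V ≤ U), x ∈ V ∧ M.res hV m = M.res hV n) : m = n := by
  choose V hV hxV e using h
  exact TopCat.Sheaf.eq_of_locally_eq' ⟨_, M.isSheaf⟩ (fun x : U => V x.1 x.2) U
    (fun x => homOfLE (hV x.1 x.2)) (fun x hx => Opens.mem_iSup.mpr ⟨⟨x, hx⟩, hxV x hx⟩) m n
    fun x => e x.1 x.2

lemma exists_glue {ι : Type u} (V : ι → X.Opens) (hV : ∀ i, V i ≤ U) (hU : U ≤ ⨆ i, V i)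
    (m : ∀ i, Γ(M, V i))
    (h : ∀ i j, M.res (inf_le_left : V i ⊓ V j ≤ _) (m i) = M.res inf_le_right (m j)) :
    ∃ n : Γ(M, U), ∀ i, M.res (hV i) n = m i := by
  obtain ⟨n, hn, -⟩ := TopCat.Sheaf.existsUnique_gluing' ⟨_, M.isSheaf⟩ V U
    (fun i => homOfLE (hV i)) hU m h
  exact ⟨n, hn⟩

/-- The homomorphism given by linear maps on sections which commute with restriction. -/
noncomputable def mkHom (φ : ∀ U : X.Opens, Γ(M, U) → Γ(N, U))
    (add : ∀ U m n, φ U (m + n) = φ U m + φ U n)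
    (smul : ∀ U (r : Γ(X, U)) m, φ U (r • m) = r • φ U m)
    (nat : ∀ (U V : X.Opens) (h : V ≤ U) m, φ V (M.res h m) = N.res h (φ U m)) : M ⟶ N :=
  ⟨PresheafOfModules.homMk
    { app U := AddCommGrpCat.ofHom (AddMonoidHom.mk' (φ U.unop) (add U.unop))
      naturality U V i := by
        ext m
        exact nat U.unop V.unop (leOfHom i.unop) m } fun U => smul U.unop⟩

lemma mkHom_app (φ : ∀ U : X.Opens, Γ(M, U) → Γ(N, U)) (add smul nat) (m : Γ(M, U)) :
    (mkHom φ add smul nat).app U m = φ U m := rfl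

/-- A system of submodules `R U ⊆ M(U) × N(U)` which is compatible with restriction and locally the
graph of a function defines a homomorphism. -/
theorem exists_hom_of_graph (R : ∀ U : X.Opens, Submodule Γ(X, U) (Γ(M, U) × Γ(N, U)))
    (hres : ∀ (U V : X.Opens) (h : V ≤ U) m n, (m, n) ∈ R U → (M.res h m, N.res h n) ∈ R V)
    (hinj : ∀ U n, ((0 : Γ(M, U)), n) ∈ R U → n = 0)
    (hex : ∀ (U : X.Opens) (m : Γ(M, U)), ∀ x ∈ U, ∃ (V : X.Opens) (h : V ≤ U), x ∈ V ∧
      ∃ n, (M.res h m, n) ∈ R V) :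
    ∃ φ : M ⟶ N, ∀ U m n, (m, n) ∈ R U → φ.app U m = n := by
  have huniq (U m n n') (h : (m, n) ∈ R U) (h' : (m, n') ∈ R U) : n = n' := by
    refine sub_eq_zero.mp (hinj _ _ ?_)
    simpa using sub_mem h h'
  -- The relation `Q` is `R` imposed only locally. Unlike `R`, it holds for sections obtained by
  -- gluing, and it still determines `n` from `m`.
  let Q (U : X.Opens) (m : Γ(M, U)) (n : Γ(N, U)) : Prop :=
    ∀ x ∈ U, ∃ (V : X.Opens) (h : V ≤ U), x ∈ V ∧ (M.res h m, N.res h n) ∈ R V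
  have hQex (U m) : ∃ n, Q U m n := by
    choose V h hxV n hn using hex U m
    obtain ⟨n', hn'⟩ := N.exists_glue (U := U) (fun x : U => V x.1 x.2) (fun x => h x.1 x.2)
      (fun x hx => Opens.mem_iSup.mpr ⟨⟨x, hx⟩, hxV x hx⟩) (fun x => n x.1 x.2) fun x y => by
        refine huniq (V x.1 x.2 ⊓ V y.1 y.2) (M.res (inf_le_left.trans (h x.1 x.2)) m) _ _ ?_ ?_
        · simpa using hres _ _ inf_le_left _ _ (hn x.1 x.2)
        · simpa using hres _ (V x.1 x.2 ⊓ V y.1 y.2) inf_le_right _ _ (hn y.1 y.2)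
    exact ⟨n', fun x hx => ⟨V x hx, h x hx, hxV x hx, by rw [hn' ⟨x, hx⟩]; exact hn x hx⟩⟩
  have hQuniq (U m n n') (hn : Q U m n) (hn' : Q U m n') : n = n' := by
    refine N.eq_of_locally_eq fun x hx => ?_
    obtain ⟨V, hV, hxV, h⟩ := hn x hx
    obtain ⟨V', hV', hxV', h'⟩ := hn' x hx
    refine ⟨V ⊓ V', inf_le_left.trans hV, ⟨hxV, hxV'⟩,
      huniq _ (M.res (inf_le_left.trans hV) m) _ _ ?_ ?_⟩
    · simpa using hres _ (V ⊓ V') inf_le_left _ _ h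
    · simpa using hres _ (V ⊓ V') inf_le_right _ _ h'
  choose φ hφ using hQex
  refine ⟨mkHom φ (fun U m n => hQuniq _ _ _ _ (hφ U _) fun x hx => ?_)
    (fun U r m => hQuniq _ _ _ _ (hφ U _) fun x hx => ?_)
    (fun U V h m => hQuniq _ _ _ _ (hφ V _) fun x hx => ?_), fun U m n hmn => ?_⟩
  · obtain ⟨V, hV, hxV, h⟩ := hφ U m x hx
    obtain ⟨V', hV', hxV', h'⟩ := hφ U n x hx
    refine ⟨V ⊓ V', inf_le_left.trans hV, ⟨hxV, hxV'⟩, ?_⟩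
    have h1 := hres _ (V ⊓ V') inf_le_left _ _ h
    have h2 := hres _ (V ⊓ V') inf_le_right _ _ h'
    simpa using add_mem h1 h2
  · obtain ⟨V, hV, hxV, h⟩ := hφ U m x hx
    refine ⟨V, hV, hxV, ?_⟩
    simpa using (R V).smul_mem (X.resFun hV r) h
  · obtain ⟨W, hW, hxW, h'⟩ := hφ U m x (h hx)
    refine ⟨V ⊓ W, inf_le_left, ⟨hx, hxW⟩, ?_⟩
    simpa using hres _ (V ⊓ W) inf_le_right _ _ h'
  · rw [mkHom_app]
    refine hQuniq _ _ _ _ (hφ U m) fun x hx => ⟨U, le_rfl, hx, ?_⟩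
    simpa using hmn

/-- A homomorphism with values locally in the image of an injective homomorphism factors. -/
theorem exists_lift (i : L ⟶ N) (hi : ∀ U, Function.Injective (i.app U)) (G : M ⟶ N)
    (hG : ∀ (U : X.Opens) (m : Γ(M, U)), ∀ x ∈ U, ∃ (V : X.Opens) (h : V ≤ U), x ∈ V ∧
      ∃ l, i.app V l = N.res h (G.app U m)) :
    ∃ g : M ⟶ L, g ≫ i = G := by
  obtain ⟨g, hg⟩ := exists_hom_of_graph (M := M) (N := L)
    (fun U =>
      { carrier := {p | i.app U p.2 = G.app U p.1}
        add_mem' := fun {p q} hp hq => by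
          simp only [Set.mem_ofPred_eq, Prod.fst_add, Prod.snd_add, map_add] at *
          rw [hp, hq]
        zero_mem' := by simp
        smul_mem' := fun r p hp => by
          simp only [Set.mem_ofPred_eq, Prod.smul_fst, Prod.smul_snd, Hom.app_smul] at *
          rw [hp] })
    (fun U V h m n hmn => by
      change i.app V _ = G.app V _
      rw [app_res, app_res]
      exact congrArg _ hmn)
    (fun U n hn => by
      have : i.app U n = G.app U 0 := hn
      rw [map_zero] at this
      exact hi U (this.trans (map_zero _).symm))
    (fun U m x hx => by
      obtain ⟨V, h, hxV, l, hl⟩ := hG U m x hx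
      exact ⟨V, h, hxV, l, by
        change i.app V _ = G.app V _
        rw [hl, app_res]⟩)
  refine ⟨g, ?_⟩
  ext U m
  rw [Hom.comp_app, CategoryTheory.comp_apply]
  refine N.eq_of_locally_eq fun x hx => ?_
  obtain ⟨V, h, hxV, l, hl⟩ := hG U m x hx
  refine ⟨V, h, hxV, ?_⟩
  rw [← app_res, ← app_res, hg V _ l (by change i.app V _ = G.app V _; rw [hl, app_res]), hl]

/-- A homomorphism killed by `g` takes values locally in the image of `f`, so it factors through `f`
by `exists_lift`; thus `f` is a kernel of `g`. Local surjectivity makes `g` an epimorphism because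
sections are determined locally. -/
theorem shortExact_of_sections (f : L ⟶ M) (g : M ⟶ N) (w : f ≫ g = 0)
    (hf : ∀ U, Function.Injective (f.app U))
    (hker : ∀ (U : X.Opens) (m : Γ(M, U)), g.app U m = 0 → ∀ x ∈ U, ∃ (V : X.Opens) (h : V ≤ U),
      x ∈ V ∧ ∃ l, f.app V l = M.res h m)
    (hg : ∀ (U : X.Opens) (n : Γ(N, U)), ∀ x ∈ U, ∃ (V : X.Opens) (h : V ≤ U),
      x ∈ V ∧ ∃ m, g.app V m = N.res h n) :
    (ShortComplex.mk f g w).ShortExact := by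
  have hmono : Mono f := ⟨fun a b hab => by
    ext U m
    apply hf U
    exact congr(($hab).app U m)⟩
  have hepi : Epi g := ⟨fun a b hab => by
    ext U n
    refine eq_of_locally_eq fun x hx => ?_
    obtain ⟨V, h, hxV, m, hm⟩ := hg U n x hx
    refine ⟨V, h, hxV, ?_⟩
    rw [← app_res, ← app_res, ← hm]
    exact congr(($hab).app V m)⟩
  refine ShortComplex.ShortExact.mk' (ShortComplex.exact_of_f_is_kernel _ ?_) hmono hepi
  refine Limits.KernelFork.IsLimit.ofι' _ _ fun {A} k hk => ?_
  have := exists_lift f hf k fun U m x hx => hker U _ congr(($hk).app U m) x hx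
  exact ⟨this.choose, this.choose_spec⟩

end Modules

end AlgebraicGeometry.Scheme

/-! ### Locally free modules are quasi-coherent -/

namespace AlgebraicGeometry.Scheme.Modules

variable {X : Scheme.{u}}

noncomputable section

/-- The presentation of a free module without relations. -/
def freePresentation (X : Scheme.{u}) (I : Type u) :
    SheafOfModules.Presentation (SheafOfModules.free I : SheafOfModules.{u} X.ringCatSheaf) where
  generators := SheafOfModules.free.generatingSections I
  relations :=
    { I := ULift Empty
      s := fun j => Empty.rec _ j.down
      epi := Limits.IsZero.epi (Limits.IsZero.of_iso (Limits.isZero_zero _)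
        (Limits.kernel.ofMono _)) _ }

/-- Modules over the localized site at `U` are modules over the scheme `U`. -/
def overEquivalence (U : X.Opens) :
    SheafOfModules.{u} (X.ringCatSheaf.over U) ≌
      SheafOfModules.{u} (U : Scheme.{u}).ringCatSheaf :=
  overEquiv U

def overUnitIso (U : X.Opens) :
    SheafOfModules.unit (X.ringCatSheaf.over U) ≅
      (overEquivalence U).inverse.obj (SheafOfModules.unit (U : Scheme.{u}).ringCatSheaf) :=
  (overEquivalence U).unitIso.app (SheafOfModules.unit (X.ringCatSheaf.over U))

def overFreeIso (E : SheafOfModules.{u} X.ringCatSheaf) (U : X.Opens) (I : Type u)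
    (e : restrict (X := U) (Y := X) E U.ι ≅ (SheafOfModules.free I : (U : Scheme.{u}).Modules)) :
    (overEquivalence U).functor.obj (SheafOfModules.over E U) ≅
      (SheafOfModules.free I : SheafOfModules.{u} (U : Scheme.{u}).ringCatSheaf) :=
  ((overFunctorEquiv U).app E ≪≫ e : _)

/-- A presentation over an open set from an isomorphism with a free module. -/
def overPresentation (E : SheafOfModules.{u} X.ringCatSheaf) (U : X.Opens) (I : Type u)
    (e : restrict (X := U) (Y := X) E U.ι ≅ (SheafOfModules.free I : (U : Scheme.{u}).Modules)) :
    (SheafOfModules.over E U).Presentation :=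
  SheafOfModules.Presentation.ofIsIso.{u, u, u}
    ((overEquivalence U).inverse.mapIso (overFreeIso E U I e).symm ≪≫
      (overEquivalence U).unitIso.symm.app (SheafOfModules.over E U)).hom
    ((freePresentation (U : Scheme.{u}) I).map (overEquivalence U).inverse (overUnitIso U))

end

/-- On each trivializing open set the module has a presentation without relations, transported from
the free module. -/
lemma isQuasicoherent_of_locallyFree {E : X.Modules} {r : ℕ} (hE : IsLocallyFreeOfRank E r) :
    E.IsQuasicoherent := by
  choose U hxU e using hE
  have hcov : (Opens.grothendieckTopology X).CoversTop U := by
    rw [Opens.coversTop_iff]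
    exact top_le_iff.mp fun x _ => Opens.mem_iSup.mpr ⟨x, hxU x⟩
  let q : SheafOfModules.QuasicoherentData.{u} (R := X.ringCatSheaf) E :=
    { I := X
      X := U
      coversTop := hcov
      presentation := fun x => overPresentation E (U x) _ (e x).some }
  exact q.isQuasicoherent

end AlgebraicGeometry.Scheme.Modules

/-! ### Sections over affine open sets localize -/

namespace AlgebraicGeometry.Scheme.Modules

variable {X : Scheme.{u}}

/-- On the affine open set `U`, the sections over basic open sets are localizations. -/
structure IsLocalizingOn (M : X.Modules) (U : X.Opens) : Prop where
  exists_smul_eq (f : Γ(X, U)) (s : Γ(M, X.basicOpen f)) :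
    ∃ (n : ℕ) (t : Γ(M, U)),
      M.res (X.basicOpen_le f) t = X.resFun (X.basicOpen_le f) (f ^ n) • s
  exists_smul_eq_zero (f : Γ(X, U)) (t : Γ(M, U)) (ht : M.res (X.basicOpen_le f) t = 0) :
    ∃ n : ℕ, f ^ n • t = 0

lemma smul_restrict_fromSpec (E : X.Modules) {U : X.Opens} (hU : IsAffineOpen U)
    (W : (Spec Γ(X, U)).Opens) (hW : hU.fromSpec ''ᵁ W ≤ U) (r : Γ(X, U))
    (x : Γ(E.restrict hU.fromSpec, W)) :
    (E.restrictAppIso hU.fromSpec W).hom (r • x) =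
      X.resFun hW r • (E.restrictAppIso hU.fromSpec W).hom x := by
  rw [smul_Spec_def]
  refine (smul_restrictAppIso_hom_apply hU.fromSpec E W _ _).trans ?_
  congr 1
  have h1 : X.presheaf.map (homOfLE hW).op ≫ (hU.fromSpec.appIso W).hom =
      (ΓSpecIso Γ(X, U)).inv ≫ (Spec Γ(X, U)).presheaf.map W.leTop.op := by
    rw [Scheme.Hom.appIso_hom', Scheme.Hom.map_appLE, Scheme.Hom.appLE, hU.fromSpec_app_self,
      Category.assoc, ← Functor.map_comp]
    rfl
  have h2 : (ΓSpecIso Γ(X, U)).inv ≫ (Spec Γ(X, U)).presheaf.map W.leTop.op ≫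
      (hU.fromSpec.appIso W).inv = X.presheaf.map (homOfLE hW).op := by
    rw [← Category.assoc, ← h1, Category.assoc, Iso.hom_inv_id, Category.comp_id]
  exact congr($h2 r)

/-- On an affine scheme, quasi-coherence says that sections over basic open sets are localizations.
The open set is a variable `D` with an equation, so that no rewriting inside the types of sections
is needed later. -/
lemma exists_smul_eq_of_isQuasicoherent {R : CommRingCat.{u}} (M : (Spec R).Modules)
    [hM : M.IsQuasicoherent] (f : R) (D : (Spec R).Opens)
    (hD : D = PrimeSpectrum.basicOpen f) (s : Γ(M, D)) :
    ∃ (n : ℕ) (t : Γ(M, ⊤)), M.res le_top t = f ^ n • s := by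
  subst hD
  have hloc : IsLocalizing (modulesSpecToSheaf.obj M) := by
    rw [← isIso_fromTildeΓ_iff_isLocalizing]
    infer_instance
  obtain ⟨⟨t, ⟨_, n, rfl⟩⟩, ht⟩ := (hloc f).surj s
  exact ⟨n, t, ht.symm⟩

lemma exists_smul_eq_zero_of_isQuasicoherent {R : CommRingCat.{u}} (M : (Spec R).Modules)
    [hM : M.IsQuasicoherent] (f : R) (D : (Spec R).Opens)
    (hD : D = PrimeSpectrum.basicOpen f) (t : Γ(M, ⊤)) (ht : M.res (le_top : D ≤ _) t = 0) :
    ∃ n : ℕ, f ^ n • t = 0 := by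
  subst hD
  have hloc : IsLocalizing (modulesSpecToSheaf.obj M) := by
    rw [← isIso_fromTildeΓ_iff_isLocalizing]
    infer_instance
  obtain ⟨⟨_, n, rfl⟩, hn⟩ := (@IsLocalizedModule.eq_zero_iff _ _ (.powers f) _ _ _ _ _ _ _
    (hloc f) _).mp ht
  exact ⟨n, hn⟩

lemma isLocalizingOn_of_isAffineOpen (E : X.Modules) [hE : E.IsQuasicoherent] {U : X.Opens}
    (hU : IsAffineOpen U) : E.IsLocalizingOn U := by
  have htop : hU.fromSpec ''ᵁ ⊤ = U := by simp
  have hbas (f : Γ(X, U)) : ∃ D : (Spec Γ(X, U)).Opens, D = PrimeSpectrum.basicOpen f ∧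
      hU.fromSpec ''ᵁ D = X.basicOpen f :=
    ⟨_, rfl, hU.fromSpec_image_basicOpen f⟩
  have hM : (E.restrict hU.fromSpec).IsQuasicoherent := isQuasicoherent_restrictFunctor _ _
  refine ⟨fun f s => ?_, fun f t ht => ?_⟩
  · obtain ⟨D, hD, hDf⟩ := hbas f
    obtain ⟨n, t, ht⟩ := exists_smul_eq_of_isQuasicoherent (E.restrict hU.fromSpec) f D hD
      (E.res hDf.le s)
    have h1 : E.res (hU.fromSpec.image_mono le_top) t =
        X.resFun (hDf.le.trans (X.basicOpen_le f)) (f ^ n) • E.res hDf.le s :=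
      ht.trans (smul_restrict_fromSpec E hU D _ (f ^ n) _)
    refine ⟨n, E.res htop.ge t, ?_⟩
    have h2 := congrArg (E.res hDf.ge) h1
    have h3 := (res_res hDf.ge (hU.fromSpec.image_mono le_top) t).symm.trans h2
    rw [res_smul, resFun_resFun, res_res, res_self] at h3
    exact (res_res _ htop.ge t).trans h3
  · obtain ⟨D, hD, hDf⟩ := hbas f
    obtain ⟨n, hn⟩ := exists_smul_eq_zero_of_isQuasicoherent (E.restrict hU.fromSpec) f D hD
      (E.res htop.le t) (by
        have h1 := congrArg (E.res hDf.le) ht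
        rw [res_res, map_zero] at h1
        exact (res_res (hU.fromSpec.image_mono le_top) htop.le t).trans h1)
    refine ⟨n, ?_⟩
    have h1 : X.resFun htop.le (f ^ n) • E.res htop.le t = 0 :=
      (smul_restrict_fromSpec E hU ⊤ htop.le (f ^ n) _).symm.trans hn
    have h3 := congrArg (E.res htop.ge) h1
    rw [map_zero, res_smul, resFun_resFun, resFun_self, res_res, res_self] at h3
    exact h3

end AlgebraicGeometry.Scheme.Modules

/-! ### Local bases -/

namespace AlgebraicGeometry.Scheme.Modules

variable {X : Scheme.{u}}

/-- `e₁`, `e₂` freely generate `M` over the open set `U`. -/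
structure IsBasisOn (M : X.Modules) (U : X.Opens) (e₁ e₂ : Γ(M, U)) : Prop where
  exists_eq (W : X.Opens) (h : W ≤ U) (m : Γ(M, W)) :
    ∃ r₁ r₂ : Γ(X, W), m = r₁ • M.res h e₁ + r₂ • M.res h e₂
  eq_zero (W : X.Opens) (h : W ≤ U) (r₁ r₂ : Γ(X, W))
    (hr : r₁ • M.res h e₁ + r₂ • M.res h e₂ = 0) : r₁ = 0 ∧ r₂ = 0

lemma IsBasisOn.mono {M : X.Modules} {U V : X.Opens} {e₁ e₂ : Γ(M, U)} (he : M.IsBasisOn U e₁ e₂)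
    (hV : V ≤ U) : M.IsBasisOn V (M.res hV e₁) (M.res hV e₂) where
  exists_eq W h m := by
    obtain ⟨r₁, r₂, hr⟩ := he.exists_eq W (h.trans hV) m
    exact ⟨r₁, r₂, by rw [hr, res_res, res_res]⟩
  eq_zero W h r₁ r₂ hr := he.eq_zero W (h.trans hV) r₁ r₂ (by rwa [res_res, res_res] at hr)

/-- The unit section of the structure sheaf. -/
noncomputable def oneSection (X : Scheme.{u}) (W : X.Opens) : Γ(structureModule X, W) :=
  (1 : Γ(X, W))

lemma smul_oneSection (W : X.Opens) (r : Γ(X, W)) : r • oneSection X W = (r : Γ(X, W)) :=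
  mul_one r

lemma res_oneSection {V W : X.Opens} (h : V ≤ W) :
    (structureModule X).res h (oneSection X W) = oneSection X V :=
  map_one (X.resFun h)

lemma app_smul_oneSection {M : X.Modules} (φ : structureModule X ⟶ M) (W : X.Opens) (r : Γ(X, W)) :
    φ.app W (r • oneSection X W) = r • M.res le_top (φ.app ⊤ (oneSection X ⊤)) := by
  rw [← app_res, res_oneSection, Hom.app_smul]

/-- The free module on `I`. -/
noncomputable def freeModule (Y : Scheme.{u}) (I : Type u) : Y.Modules :=
  SheafOfModules.free I

lemma freeModule_coproduct (Y : Scheme.{u}) (I : Type u) :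
    ∃ ι : I → (structureModule Y ⟶ freeModule Y I),
      (∀ (M : Y.Modules) (k : I → (structureModule Y ⟶ M)),
        ∃ d : freeModule Y I ⟶ M, ∀ i, ι i ≫ d = k i) ∧
      ∀ (M : Y.Modules) (d d' : freeModule Y I ⟶ M), (∀ i, ι i ≫ d = ι i ≫ d') → d = d' := by
  let H := SheafOfModules.isColimitFreeCofan (R := Y.ringCatSheaf) I
  exact ⟨fun i => SheafOfModules.ιFree i,
    fun M k => ⟨Limits.Cofan.IsColimit.desc H k, Limits.Cofan.IsColimit.fac H k⟩,
    fun M d d' h => Limits.Cofan.IsColimit.hom_ext H d d' h⟩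

/-- The universal property of the coproduct gives two projections to the structure sheaf, and with
the inclusions they satisfy the biproduct identities. The coefficients of a section are its images
under the projections. -/
lemma exists_isBasisOn_free (Y : Scheme.{u}) :
    ∃ e₁ e₂ : Γ(freeModule Y (ULift.{u} (Fin 2)), ⊤), IsBasisOn _ ⊤ e₁ e₂ := by
  obtain ⟨ι, hdesc, hext⟩ := freeModule_coproduct Y (ULift.{u} (Fin 2))
  generalize freeModule Y (ULift.{u} (Fin 2)) = F at *
  obtain ⟨p, hp⟩ := hdesc _ fun i => if i = ⟨0⟩ then 𝟙 _ else 0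
  obtain ⟨q, hq⟩ := hdesc _ fun i => if i = ⟨1⟩ then 𝟙 _ else 0
  have hp0 : ι ⟨0⟩ ≫ p = 𝟙 _ := by simp [hp]
  have hp1 : ι ⟨1⟩ ≫ p = 0 := by simp [hp]
  have hq0 : ι ⟨0⟩ ≫ q = 0 := by simp [hq]
  have hq1 : ι ⟨1⟩ ≫ q = 𝟙 _ := by simp [hq]
  have hsum : p ≫ ι ⟨0⟩ + q ≫ ι ⟨1⟩ = 𝟙 F := by
    refine hext _ _ _ fun ⟨i⟩ => ?_
    fin_cases i
    · simp [Preadditive.comp_add, reassoc_of% hp0, reassoc_of% hq0]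
    · simp [Preadditive.comp_add, reassoc_of% hp1, reassoc_of% hq1]
  refine ⟨(ι ⟨0⟩).app ⊤ (oneSection Y ⊤), (ι ⟨1⟩).app ⊤ (oneSection Y ⊤), fun W _ m => ?_,
    fun W _ r₁ r₂ h => ?_⟩
  · obtain ⟨r₁, hr₁⟩ : ∃ r : Γ(Y, W), r • oneSection Y W = p.app W m := ⟨_, smul_oneSection W _⟩
    obtain ⟨r₂, hr₂⟩ : ∃ r : Γ(Y, W), r • oneSection Y W = q.app W m := ⟨_, smul_oneSection W _⟩
    refine ⟨r₁, r₂, ?_⟩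
    rw [← app_smul_oneSection, ← app_smul_oneSection, hr₁, hr₂]
    exact congr(($(hsum).app W) m).symm
  · rw [← app_smul_oneSection, ← app_smul_oneSection] at h
    have e1 := congrArg (p.app W) h
    have e2 := congrArg (q.app W) h
    simp only [map_add, ← CategoryTheory.comp_apply, ← Hom.comp_app, hp0, hp1, hq0, hq1,
      map_zero] at e1 e2
    rw [smul_oneSection, smul_oneSection] at e1 e2
    exact ⟨(add_zero r₁).symm.trans e1, (zero_add r₂).symm.trans e2⟩

lemma IsBasisOn.of_iso {Y : Scheme.{u}} {F G : Y.Modules} (e : F ≅ G) {U : Y.Opens}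
    {e₁ e₂ : Γ(F, U)} (he : F.IsBasisOn U e₁ e₂) :
    G.IsBasisOn U (e.hom.app U e₁) (e.hom.app U e₂) := by
  have h1 (W) (m : Γ(F, W)) : e.inv.app W (e.hom.app W m) = m := congr(($(e.hom_inv_id).app W) m)
  have h2 (W) (m : Γ(G, W)) : e.hom.app W (e.inv.app W m) = m := congr(($(e.inv_hom_id).app W) m)
  refine ⟨fun W h m => ?_, fun W h r₁ r₂ hr => ?_⟩
  · obtain ⟨r₁, r₂, hr⟩ := he.exists_eq W h (e.inv.app W m)
    refine ⟨r₁, r₂, ?_⟩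
    rw [← h2 W m, hr, map_add, Hom.app_smul, Hom.app_smul, app_res, app_res]
  · refine he.eq_zero W h r₁ r₂ ?_
    rw [← h1 W (_ + _), map_add, Hom.app_smul, Hom.app_smul, app_res, app_res, hr, map_zero]

lemma IsBasisOn.of_restrict {E : X.Modules} {U : X.Opens} {e₁ e₂ : Γ(E.restrict U.ι, ⊤)}
    (he : (E.restrict U.ι).IsBasisOn ⊤ e₁ e₂) :
    E.IsBasisOn (U.ι ''ᵁ ⊤) ((E.restrictAppIso U.ι ⊤).hom e₁)
      ((E.restrictAppIso U.ι ⊤).hom e₂) := by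
  have hW (W : X.Opens) (h : W ≤ U.ι ''ᵁ ⊤) : U.ι ''ᵁ (U.ι ⁻¹ᵁ W) = W := by
    rw [Scheme.Hom.image_preimage_eq_opensRange_inf]
    exact inf_eq_right.mpr (h.trans (by simp))
  have hsmul (W : (U : Scheme.{u}).Opens) (r : Γ(X, U.ι ''ᵁ W)) (m : Γ(E.restrict U.ι, ⊤))
      (hle : U.ι ''ᵁ W ≤ U.ι ''ᵁ ⊤) :
      (E.restrictAppIso U.ι W).hom ((U.ι.appIso W).hom r • (E.restrict U.ι).res le_top m) =
        r • E.res hle ((E.restrictAppIso U.ι ⊤).hom m) := by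
    refine (smul_restrictAppIso_hom_apply U.ι E W _ _).trans ?_
    rw [Iso.hom_inv_id_apply]
    rfl
  refine ⟨fun W h m => ?_, fun W h r₁ r₂ hr => ?_⟩
  · obtain ⟨W', rfl⟩ : ∃ W', U.ι ''ᵁ W' = W := ⟨_, hW W h⟩
    obtain ⟨r₁, r₂, hr⟩ := he.exists_eq W' le_top ((E.restrictAppIso U.ι W').inv m)
    obtain ⟨r₁, rfl⟩ := (ConcreteCategory.bijective_of_isIso (U.ι.appIso W').hom).2 r₁
    obtain ⟨r₂, rfl⟩ := (ConcreteCategory.bijective_of_isIso (U.ι.appIso W').hom).2 r₂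
    refine ⟨r₁, r₂, ?_⟩
    rw [← hsmul, ← hsmul]
    exact hr
  · obtain ⟨W', rfl⟩ : ∃ W', U.ι ''ᵁ W' = W := ⟨_, hW W h⟩
    rw [← hsmul, ← hsmul] at hr
    obtain ⟨h1, h2⟩ := he.eq_zero W' le_top _ _ hr
    have hinj := (ConcreteCategory.bijective_of_isIso (U.ι.appIso W').hom).1
    exact ⟨hinj (h1.trans (map_zero _).symm), hinj (h2.trans (map_zero _).symm)⟩

lemma exists_isBasisOn {E : X.Modules} (hE : IsLocallyFreeOfRank E 2) (x : X) :
    ∃ (U : X.Opens) (e₁ e₂ : Γ(E, U)), x ∈ U ∧ E.IsBasisOn U e₁ e₂ := by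
  obtain ⟨U, hx, ⟨e⟩⟩ : ∃ U : X.Opens, x ∈ U ∧
      Nonempty (E.restrict U.ι ≅ freeModule (U : Scheme.{u}) (ULift.{u} (Fin 2))) := hE x
  obtain ⟨e₁, e₂, he⟩ := exists_isBasisOn_free (U : Scheme.{u})
  exact ⟨_, _, _, by simpa using hx, (he.of_iso e.symm).of_restrict⟩

end AlgebraicGeometry.Scheme.Modules

/-! ### Finite projective modules of sections -/

namespace AlgebraicGeometry.Scheme.Modules

variable {X : Scheme.{u}}

/-- Sections over a basic open subset of `U`, as a module over the functions on `U`. -/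
@[reducible]
noncomputable def moduleBasicOpen (M : X.Modules) {U : X.Opens} (f : Γ(X, U)) :
    Module Γ(X, U) Γ(M, X.basicOpen f) :=
  Module.compHom _ (X.resFun (X.basicOpen_le f))

attribute [local instance] moduleBasicOpen

instance (M : X.Modules) {U : X.Opens} (f : Γ(X, U)) :
    IsScalarTower Γ(X, U) Γ(X, X.basicOpen f) Γ(M, X.basicOpen f) :=
  .of_algebraMap_smul fun _ _ => rfl

/-- Restriction to a basic open subset as a linear map. -/
noncomputable def resₗ (M : X.Modules) {U : X.Opens} (f : Γ(X, U)) :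
    Γ(M, U) →ₗ[Γ(X, U)] Γ(M, X.basicOpen f) where
  toFun := M.res (X.basicOpen_le f)
  map_add' := map_add _
  map_smul' r m := res_smul _ r m

lemma IsLocalizingOn.isLocalizedModule {M : X.Modules} {U : X.Opens} (hM : M.IsLocalizingOn U)
    (f : Γ(X, U)) : IsLocalizedModule.Away f (M.resₗ f) := by
  refine IsLocalizedModule.Away.mk_of_addCommGroup ?_ (fun s => ?_) fun t ht => ?_
  · have h1 := isUnit_resFun_basicOpen f (le_refl (X.basicOpen f))
    rw [Module.End.isUnit_iff]
    exact MulAction.bijective (β := Γ(M, X.basicOpen f)) h1.unit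
  · obtain ⟨n, t, ht⟩ := hM.exists_smul_eq f s
    exact ⟨n, t, ht.symm⟩
  · exact hM.exists_smul_eq_zero f t ht

/-- The isomorphism with a free module given by a basis. -/
lemma IsBasisOn.exists_linearEquiv {M : X.Modules} {U : X.Opens} {e₁ e₂ : Γ(M, U)}
    (he : M.IsBasisOn U e₁ e₂) :
    Nonempty ((Γ(X, U) × Γ(X, U)) ≃ₗ[Γ(X, U)] Γ(M, U)) := by
  refine ⟨LinearEquiv.ofBijective ((LinearMap.toSpanSingleton _ _ e₁).coprod
    (LinearMap.toSpanSingleton _ _ e₂)) ⟨?_, fun m => ?_⟩⟩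
  · rw [injective_iff_map_eq_zero]
    rintro ⟨r₁, r₂⟩ h
    obtain ⟨h1, h2⟩ := he.eq_zero U le_rfl r₁ r₂ (by simpa using h)
    rw [h1, h2]
    rfl
  · obtain ⟨r₁, r₂, h⟩ := he.exists_eq U le_rfl m
    exact ⟨(r₁, r₂), by simpa using h.symm⟩

lemma finite_of_isBasisOn {M : X.Modules} {U : X.Opens} (hU : IsAffineOpen U)
    (hM : M.IsLocalizingOn U) (S : Set Γ(X, U)) (hS : Ideal.span S = ⊤)
    (hbas : ∀ f ∈ S, ∃ e₁ e₂ : Γ(M, X.basicOpen f), M.IsBasisOn _ e₁ e₂) :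
    Module.Finite Γ(X, U) Γ(M, U) := by
  have h1 (f : Γ(X, U)) := hM.isLocalizedModule f
  have h2 (f : Γ(X, U)) := hU.isLocalization_basicOpen f
  refine Module.Finite.of_localizationSpan' S hS (Rₚ := fun f => Γ(X, X.basicOpen f.1))
    (fun f => M.resₗ f.1) fun f => ?_
  obtain ⟨e₁, e₂, he⟩ := hbas f.1 f.2
  exact Module.Finite.equiv he.exists_linearEquiv.some

/-- Finiteness and flatness may be checked on a spanning family of localizations. Over a noetherian
ring a finite module is finitely presented, and finitely presented flat modules are projective. -/
lemma projective_of_isBasisOn {M : X.Modules} {U : X.Opens} (hU : IsAffineOpen U)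
    [IsNoetherianRing Γ(X, U)]
    (hM : M.IsLocalizingOn U) (S : Set Γ(X, U)) (hS : Ideal.span S = ⊤)
    (hbas : ∀ f ∈ S, ∃ e₁ e₂ : Γ(M, X.basicOpen f), M.IsBasisOn _ e₁ e₂) :
    Module.Projective Γ(X, U) Γ(M, U) := by
  have h1 (f : Γ(X, U)) := hM.isLocalizedModule f
  have h2 (f : Γ(X, U)) := hU.isLocalization_basicOpen f
  have := finite_of_isBasisOn hU hM S hS hbas
  have : Module.FinitePresentation Γ(X, U) Γ(M, U) := Module.finitePresentation_of_finite _ _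
  have : Module.Flat Γ(X, U) Γ(M, U) := by
    refine Module.flat_of_isLocalized_span Γ(X, U) Γ(M, U) S hS (fun f => Γ(M, X.basicOpen f.1))
      (fun f => M.resₗ f.1) fun f => ?_
    obtain ⟨e₁, e₂, he⟩ := hbas f.1 f.2
    have : Module.Flat Γ(X, U) Γ(X, X.basicOpen f.1) := IsLocalization.flat _ (.powers f.1)
    have : Module.Flat Γ(X, X.basicOpen f.1) Γ(M, X.basicOpen f.1) :=
      Module.Flat.of_linearEquiv he.exists_linearEquiv.some.symm
    exact Module.Flat.trans Γ(X, U) Γ(X, X.basicOpen f.1) _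
  exact Module.Flat.projective_of_finitePresentation

lemma exists_basicOpen_isBasisOn {E : X.Modules} (hE : IsLocallyFreeOfRank E 2) {U : X.Opens}
    (hU : IsAffineOpen U) {x : X} (hx : x ∈ U) (V : X.Opens) (hV : x ∈ V) :
    ∃ f : Γ(X, U), x ∈ X.basicOpen f ∧ X.basicOpen f ≤ V ∧
      ∃ e₁ e₂ : Γ(E, X.basicOpen f), E.IsBasisOn _ e₁ e₂ := by
  obtain ⟨W, e₁, e₂, hxW, he⟩ := exists_isBasisOn hE x
  obtain ⟨f, hf, hxf⟩ := hU.exists_basicOpen_le (V := V ⊓ W) ⟨x, hV, hxW⟩ hx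
  exact ⟨f, hxf, hf.trans inf_le_left, _, _, he.mono (hf.trans inf_le_right)⟩

lemma exists_span_isBasisOn {E : X.Modules} (hE : IsLocallyFreeOfRank E 2) {U : X.Opens}
    (hU : IsAffineOpen U) : Ideal.span {f : Γ(X, U) | ∃ e₁ e₂ : Γ(E, X.basicOpen f),
      E.IsBasisOn _ e₁ e₂} = ⊤ := by
  rw [← hU.self_le_iSup_basicOpen_iff]
  intro x hx
  obtain ⟨f, hxf, -, he⟩ := exists_basicOpen_isBasisOn hE hU hx U hx
  exact Opens.mem_iSup.mpr ⟨⟨f, he⟩, hxf⟩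

/-- Generators of the localized module come from sections over the affine open set. -/
lemma IsLocalizingOn.exists_pair {M : X.Modules} {U : X.Opens} (hM : M.IsLocalizingOn U)
    {f : Γ(X, U)} {e₁ e₂ : Γ(M, X.basicOpen f)} (he : M.IsBasisOn _ e₁ e₂) :
    ∃ t₁ t₂ : Γ(M, U), M.IsBasisOn _ (M.res (X.basicOpen_le f) t₁)
    (M.res (X.basicOpen_le f) t₂) := by
  obtain ⟨n₁, t₁, h₁⟩ := hM.exists_smul_eq f e₁
  obtain ⟨n₂, t₂, h₂⟩ := hM.exists_smul_eq f e₂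
  have hu (n : ℕ) {W : X.Opens} (hW : W ≤ X.basicOpen f) :
      IsUnit (X.resFun hW (X.resFun (X.basicOpen_le f) (f ^ n))) := by
    rw [map_pow, map_pow, resFun_resFun]
    exact (isUnit_resFun_basicOpen f hW).pow n
  refine ⟨t₁, t₂, ⟨fun W hW m => ?_, fun W hW r₁ r₂ hr => ?_⟩⟩
  · obtain ⟨r₁, r₂, h⟩ := he.exists_eq W hW m
    obtain ⟨u₁, hu₁⟩ := hu n₁ hW
    obtain ⟨u₂, hu₂⟩ := hu n₂ hW
    refine ⟨r₁ * u₁⁻¹.1, r₂ * u₂⁻¹.1, ?_⟩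
    rw [h₁, h₂, res_smul, res_smul, ← hu₁, ← hu₂, smul_smul, smul_smul, mul_assoc, mul_assoc,
      Units.inv_mul, Units.inv_mul, mul_one, mul_one, h]
  · rw [h₁, h₂, res_smul, res_smul, smul_smul, smul_smul] at hr
    obtain ⟨h1, h2⟩ := he.eq_zero W hW _ _ hr
    exact ⟨(hu n₁ hW).mul_left_eq_zero.mp h1, (hu n₂ hW).mul_left_eq_zero.mp h2⟩

end AlgebraicGeometry.Scheme.Modules

/-! ### The charts of the projective line -/

namespace ProjectiveLine

open MvPolynomial HomogeneousLocalization Scheme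

/-- The grading of `ℤ[x₀, x₁]` by degree. -/
abbrev grading : ℕ → Submodule ℤ (MvPolynomial (Fin 2) ℤ) :=
  MvPolynomial.homogeneousSubmodule (Fin 2) ℤ

lemma X_mem_grading (i : Fin 2) : (X i : MvPolynomial (Fin 2) ℤ) ∈ grading 1 :=
  isHomogeneous_X ℤ i

/-- The affine chart on which the coordinate `xᵢ` does not vanish. -/
noncomputable def chart (i : Fin 2) : P1Z.Opens := Proj.basicOpen grading (X i)

lemma isAffineOpen_chart (i : Fin 2) : IsAffineOpen (chart i) :=
  Proj.isAffineOpen_basicOpen grading (X i) (X_mem_grading i) one_pos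

lemma exists_mem_chart (x : P1Z) : ∃ i, x ∈ chart i := by
  have h : ⨆ i, Proj.basicOpen grading (X i : MvPolynomial (Fin 2) ℤ) = ⊤ := by
    refine Proj.iSup_basicOpen_eq_top' grading _ (fun i => ⟨1, X_mem_grading i⟩) ?_
    rw [eq_top_iff]
    rintro p -
    induction p using MvPolynomial.induction_on with
    | C a => exact Subalgebra.algebraMap_mem _ (⟨C a, isHomogeneous_C _ a⟩ : grading 0)
    | add p q hp hq => exact add_mem hp hq
    | mul_X p i hp => exact mul_mem hp (Algebra.subset_adjoin ⟨i, rfl⟩)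
  have hx : x ∈ ⨆ i, Proj.basicOpen grading (X i : MvPolynomial (Fin 2) ℤ) := h ▸ Opens.mem_top x
  exact Opens.mem_iSup.mp hx

/-- The quotient of the two coordinates, in the degree zero part of the localization. -/
noncomputable def awayCoord (i : Fin 2) : Away grading (X i : MvPolynomial (Fin 2) ℤ) :=
  Away.mk grading (X_mem_grading i) 1 (X (i + 1)) (X_mem_grading (i + 1))

/-- Substituting the quotient of the coordinates into polynomials. -/
noncomputable def toAway (i : Fin 2) :
    Polynomial ℤ →+* Away grading (X i : MvPolynomial (Fin 2) ℤ) :=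
  Polynomial.eval₂RingHom (Int.castRingHom _) (awayCoord i)

/-- The inclusion of the degree zero part. -/
noncomputable def awayVal (i : Fin 2) : Away grading (X i : MvPolynomial (Fin 2) ℤ) →+*
    Localization.Away (X i : MvPolynomial (Fin 2) ℤ) :=
  algebraMap _ _

lemma awayVal_injective (i : Fin 2) : Function.Injective (awayVal i) := val_injective _

lemma val_awayCoord (i : Fin 2) :
    (awayVal i (awayCoord i)) * algebraMap _ _ (X i : MvPolynomial (Fin 2) ℤ) =
      algebraMap _ _ (X (i + 1) : MvPolynomial (Fin 2) ℤ) := by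
  have : awayVal i (awayCoord i) = _ :=
    Away.val_mk grading 1 (X_mem_grading i) (X (i + 1)) (X_mem_grading (i + 1))
  rw [this, Localization.mk_eq_mk']
  simp

lemma toAway_X (i : Fin 2) : toAway i Polynomial.X = awayCoord i := by
  simp [toAway]

/-- Setting `xᵢ = 1` and sending the other coordinate to the variable gives a left inverse. -/
lemma toAway_injective (i : Fin 2) : Function.Injective (toAway i) := by
  let e : MvPolynomial (Fin 2) ℤ →+* Polynomial ℤ :=
    (aeval fun k => if k = i then (1 : Polynomial ℤ) else Polynomial.X).toRingHom
  have he : IsUnit (e (X i)) := by simp [e]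
  let l : Localization.Away (X i : MvPolynomial (Fin 2) ℤ) →+* Polynomial ℤ :=
    IsLocalization.Away.lift (X i) he
  have hl (p) : l (algebraMap _ _ p) = e p := IsLocalization.Away.lift_eq _ he p
  have h : ((l.comp (awayVal i)).comp (toAway i)) = RingHom.id _ := by
    refine Polynomial.ringHom_ext (fun n => by simp) ?_
    have := congrArg l (val_awayCoord i)
    rw [map_mul, hl, hl] at this
    simpa [e, toAway_X] using this
  exact Function.LeftInverse.injective (g := l.comp (awayVal i)) fun p => congr($h p)

/-- This is dehomogenization: a monomial of degree `n` divided by `xᵢ ^ n` is a power of the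
quotient of the coordinates. The equality is checked in the full localization after multiplication
by `xᵢ ^ n`. -/
lemma toAway_surjective (i : Fin 2) : Function.Surjective (toAway i) := by
  intro a
  obtain ⟨n, p, hp, rfl⟩ := Away.mk_surjective grading (X_mem_grading i) a
  have hp' : p.IsHomogeneous n := by simpa using hp
  let x := algebraMap (MvPolynomial (Fin 2) ℤ)
    (Localization.Away (X i : MvPolynomial (Fin 2) ℤ)) (X i)
  have hx : IsUnit x := IsLocalization.Away.algebraMap_isUnit _
  refine ⟨∑ v ∈ p.support, Polynomial.C (coeff v p) * Polynomial.X ^ v (i + 1),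
    awayVal_injective i ?_⟩
  refine (hx.pow n).mul_left_injective ?_
  have h1 : awayVal i (Away.mk grading (X_mem_grading i) n p hp) * x ^ n = algebraMap _ _ p := by
    have : awayVal i (Away.mk grading (X_mem_grading i) n p hp) =
        _ := Away.val_mk grading n (X_mem_grading i) p hp
    rw [this, Localization.mk_eq_mk', ← map_pow]
    exact IsLocalization.mk'_spec (M := Submonoid.powers (X i : MvPolynomial (Fin 2) ℤ))
      (Localization.Away (X i : MvPolynomial (Fin 2) ℤ)) p ⟨X i ^ n, n, rfl⟩
  dsimp only
  rw [h1]
  conv_rhs => rw [p.as_sum]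
  simp only [map_sum, Finset.sum_mul, map_mul, map_pow, toAway_X]
  refine Finset.sum_congr rfl fun v hv => ?_
  have hd : v i + v (i + 1) = n := by
    have := hp' (mem_support_iff.mp hv)
    rw [Finsupp.weight_apply, Finsupp.sum_fintype _ _ (by simp), Fin.sum_univ_two] at this
    simp only [Pi.one_apply, smul_eq_mul, mul_one] at this
    fin_cases i
    · exact this
    · exact (add_comm _ _).trans this
  have hm : monomial v (coeff v p) = C (coeff v p) * (X (i + 1) ^ v (i + 1) * X i ^ v i) := by
    rw [monomial_eq, Finsupp.prod_fintype _ _ (by simp), Fin.prod_univ_two]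
    fin_cases i
    · rw [mul_comm (X 0 ^ v 0)]; rfl
    · rfl
  rw [hm, map_mul, map_mul, map_pow, ← val_awayCoord, map_pow, mul_pow, ← hd]
  have hc (c : ℤ) : awayVal i (toAway i (Polynomial.C c)) =
      algebraMap (MvPolynomial (Fin 2) ℤ) _ (C c) := by
    simp
  rw [hc]
  change _ * x ^ _ = _ * (_ * x ^ _ * x ^ _)
  ring

/-- The ring of functions on a chart is a polynomial ring. -/
noncomputable def chartEquiv (i : Fin 2) : Polynomial ℤ ≃+* Γ(P1Z, chart i) :=
  (RingEquiv.ofBijective (toAway i) ⟨toAway_injective i, toAway_surjective i⟩).trans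
    (Proj.basicOpenIsoAway grading (X i) (X_mem_grading i) one_pos).commRingCatIsoToRingEquiv

/-- The value of a function at a point. -/
noncomputable def evalFun {W : P1Z.Opens} {x : P1Z} (hx : x ∈ W) :
    Γ(P1Z, W) →+* ProjTwist.At grading x where
  toFun a := HomogeneousLocalization.val (a.1 ⟨x, hx⟩)
  map_one' := val_one
  map_zero' := val_zero
  map_mul' a b := val_mul (a.1 ⟨x, hx⟩) (b.1 ⟨x, hx⟩)
  map_add' a b := val_add (a.1 ⟨x, hx⟩) (b.1 ⟨x, hx⟩)

lemma evalFun_res {V W : P1Z.Opens} (h : V ≤ W) {x : P1Z} (hx : x ∈ V) (a : Γ(P1Z, W)) :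
    evalFun hx (P1Z.resFun h a) = evalFun (h hx) a := rfl

lemma evalFun_ext {W : P1Z.Opens} {a b : Γ(P1Z, W)}
    (h : ∀ (x : P1Z) (hx : x ∈ W), evalFun hx a = evalFun hx b) : a = b :=
  Subtype.ext (funext fun x => HomogeneousLocalization.val_injective _ (h x.1 x.2))

/-- The value of a coordinate at a point. -/
noncomputable def coordAt (x : P1Z) (i : Fin 2) : ProjTwist.At grading x :=
  algebraMap (MvPolynomial (Fin 2) ℤ) _ (X i)

lemma isUnit_coordAt {x : P1Z} {i : Fin 2} : IsUnit (coordAt x i) ↔ x ∈ chart i :=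
  have := ProjectiveSpectrum.isPrime (𝒜 := grading) x
  IsLocalization.AtPrime.isUnit_to_map_iff (ProjTwist.At grading x)
    (ProjectiveSpectrum.asHomogeneousIdeal x).toIdeal (X i)

lemma evalFun_chartEquiv_X (i : Fin 2) {x : P1Z} (hx : x ∈ chart i) :
    evalFun hx (chartEquiv i Polynomial.X) * coordAt x i = coordAt x (i + 1) := by
  have h1 : evalFun hx (chartEquiv i Polynomial.X) = _ :=
    ProjectiveSpectrum.Proj.awayToSection_apply grading (X i) (toAway i Polynomial.X) ⟨x, hx⟩
  rw [h1, toAway_X]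
  have := ProjectiveSpectrum.isPrime (𝒜 := grading) x
  have := congrArg (IsLocalization.map (M := Submonoid.powers (X i))
    (T := (ProjectiveSpectrum.asHomogeneousIdeal x).toIdeal.primeCompl) (ProjTwist.At grading x)
        (RingHom.id _) (Submonoid.powers_le.mpr hx)) (val_awayCoord i)
  rw [map_mul, IsLocalization.map_eq, IsLocalization.map_eq] at this
  exact this

end ProjectiveLine

/-! ### The overlap and the generators of the twisting sheaves -/

namespace ProjectiveLine

open MvPolynomial HomogeneousLocalization Scheme

/-- The quotient of the coordinates as a function on a chart. -/
noncomputable def coord (i : Fin 2) : Γ(P1Z, chart i) := chartEquiv i Polynomial.X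

lemma resFun_coord_mul (i : Fin 2) {W : P1Z.Opens} (h : W ≤ chart i) (h' : W ≤ chart (i + 1)) :
    P1Z.resFun h (coord i) * P1Z.resFun h' (coord (i + 1)) = 1 := by
  refine evalFun_ext fun x hx => ?_
  have h1 := evalFun_chartEquiv_X i (h hx)
  have h2 := evalFun_chartEquiv_X (i + 1) (h' hx)
  have h3 : i + 1 + 1 = i := by fin_cases i <;> rfl
  rw [h3] at h2
  rw [map_mul, map_one, evalFun_res, evalFun_res]
  refine (isUnit_coordAt.mpr (h' hx)).mul_left_injective ?_
  change _ * _ * _ = 1 * _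
  rw [mul_assoc, coord, coord, h2, h1, one_mul]

lemma basicOpen_coord (i : Fin 2) : P1Z.basicOpen (coord i) = chart i ⊓ chart (i + 1) := by
  apply le_antisymm
  · intro x hx
    refine ⟨P1Z.basicOpen_le _ hx, isUnit_coordAt.mp ?_⟩
    rw [← evalFun_chartEquiv_X i (P1Z.basicOpen_le _ hx)]
    exact ((isUnit_resFun_basicOpen (coord i) le_rfl).map (evalFun hx)).mul
      (isUnit_coordAt.mpr (P1Z.basicOpen_le _ hx))
  · have h := IsUnit.of_mul_eq_one _ (resFun_coord_mul i
      (W := chart i ⊓ chart (i + 1)) inf_le_left inf_le_right)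
    have h1 := P1Z.basicOpen_of_isUnit h
    have h2 : P1Z.basicOpen (P1Z.resFun inf_le_left (coord i)) =
      (chart i ⊓ chart (i + 1)) ⊓ P1Z.basicOpen (coord i) := P1Z.basicOpen_res _ _
    rw [h1] at h2
    exact h2.le.trans inf_le_right

/-- The transition function `x₁ / x₀` on open subsets of the intersection of the two charts. -/
noncomputable def transition {W : P1Z.Opens} (h₀ : W ≤ chart 0) (h₁ : W ≤ chart 1) :
    Γ(P1Z, W)ˣ where
  val := P1Z.resFun h₀ (coord 0)
  inv := P1Z.resFun h₁ (coord 1)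
  val_inv := resFun_coord_mul 0 h₀ h₁
  inv_val := resFun_coord_mul 1 h₁ h₀

/-- The value of a section of `𝒪(n)` at a point. -/
noncomputable def evalTwist {n : ℤ} {W : P1Z.Opens} {x : P1Z} (hx : x ∈ W) (m : Γ(OP1Z n, W)) :
    ProjTwist.At grading x :=
  (m : ProjTwist.sections grading n W).1 ⟨x, hx⟩

lemma evalTwist_smul {n : ℤ} {W : P1Z.Opens} {x : P1Z} (hx : x ∈ W) (a : Γ(P1Z, W))
    (m : Γ(OP1Z n, W)) : evalTwist hx (a • m) = evalFun hx a * evalTwist hx m := rfl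

lemma evalTwist_res {n : ℤ} {V W : P1Z.Opens} (h : V ≤ W) {x : P1Z} (hx : x ∈ V)
    (m : Γ(OP1Z n, W)) : evalTwist hx ((OP1Z n).res h m) = evalTwist (h hx) m := rfl

lemma evalTwist_ext {n : ℤ} {W : P1Z.Opens} {m m' : Γ(OP1Z n, W)}
    (h : ∀ (x : P1Z) (hx : x ∈ W), evalTwist hx m = evalTwist hx m') : m = m' :=
  Subtype.ext (funext fun x => h x.1 x.2)

/-- The value of a coordinate at a point of its chart, as a unit. -/
noncomputable def coordUnit {x : P1Z} {i : Fin 2} (hx : x ∈ chart i) :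
    (ProjTwist.At grading x)ˣ :=
  (isUnit_coordAt.mpr hx).unit

lemma coordUnit_val {x : P1Z} {i : Fin 2} (hx : x ∈ chart i) :
    (coordUnit hx : ProjTwist.At grading x) = coordAt x i := rfl

lemma coordUnit_zpow_mul {x : P1Z} {i : Fin 2} (hx : x ∈ chart i) (n : ℤ) :
    (↑(coordUnit hx ^ n) : ProjTwist.At grading x) * coordAt x i ^ (-n).toNat =
      coordAt x i ^ n.toNat := by
  rw [← coordUnit_val hx, ← Units.val_pow_eq_pow_val, ← Units.val_pow_eq_pow_val, ← Units.val_mul,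
    ← zpow_natCast, ← zpow_natCast, ← zpow_add]
  congr 2
  omega

lemma X_pow_mem_grading (i : Fin 2) (k : ℕ) : (X i : MvPolynomial (Fin 2) ℤ) ^ k ∈ grading k := by
  simpa using SetLike.pow_mem_graded k (X_mem_grading i)

lemma X_pow_notMem {x : P1Z} {i : Fin 2} (hx : x ∈ chart i) (k : ℕ) :
    (X i : MvPolynomial (Fin 2) ℤ) ^ k ∉ ProjectiveSpectrum.asHomogeneousIdeal x := fun h =>
  hx ((ProjectiveSpectrum.isPrime (𝒜 := grading) x).mem_of_pow_mem _ h)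

lemma mk_eq_iff (x : ProjectiveSpectrum grading) {r s : MvPolynomial (Fin 2) ℤ}
    (hs : s ∈ x.asHomogeneousIdeal.toIdeal.primeCompl) (z : ProjTwist.At grading x) :
    z = Localization.mk r ⟨s, hs⟩ ↔ z * algebraMap _ _ s = algebraMap _ _ r := by
  rw [Localization.mk_eq_mk'_apply, IsLocalization.eq_mk'_iff_mul_eq]

/-- The generator `xᵢⁿ` of `𝒪(n)` on a chart. -/
noncomputable def twistGen (n : ℤ) (i : Fin 2) : Γ(OP1Z n, chart i) :=
  -- At least one of the exponents `n.toNat` and `(-n).toNat` is zero, so one fraction serves both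
  -- signs of `n`.
  (⟨fun x => ↑(coordUnit x.2 ^ n), fun x => ⟨chart i, x.2, 𝟙 _, n.toNat, (-n).toNat, by omega,
    ⟨X i ^ n.toNat, X_pow_mem_grading i _⟩, ⟨X i ^ (-n).toNat, X_pow_mem_grading i _⟩,
    fun y => X_pow_notMem y.2 _, fun y => (mk_eq_iff _ _ _).mpr (by
      rw [map_pow, map_pow]
      exact coordUnit_zpow_mul y.2 n)⟩⟩ : ProjTwist.sections grading n (chart i))

lemma evalTwist_twistGen (n : ℤ) (i : Fin 2) {x : P1Z} (hx : x ∈ chart i) :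
    evalTwist hx (twistGen n i) = ↑(coordUnit hx ^ n) := rfl

lemma smul_twistGen_injective (n : ℤ) (i : Fin 2) {W : P1Z.Opens} (h : W ≤ chart i)
    {a : Γ(P1Z, W)} (ha : a • (OP1Z n).res h (twistGen n i) = 0) : a = 0 := by
  refine evalFun_ext fun x hx => ?_
  have h1 : evalTwist hx (a • (OP1Z n).res h (twistGen n i)) = 0 := by rw [ha]; rfl
  rw [evalTwist_smul, evalTwist_res, evalTwist_twistGen] at h1
  rw [map_zero]
  exact (Units.mul_left_eq_zero _).mp h1

/-- Homogeneous fractions of degree zero. -/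
noncomputable def fraction (x : ProjectiveSpectrum grading) {d : ℕ} (r s : grading d)
    (hs : s.1 ∉ x.asHomogeneousIdeal) :
    HomogeneousLocalization.AtPrime grading x.asHomogeneousIdeal.toIdeal :=
  .mk ⟨d, r, s, hs⟩

lemma eq_val_fraction_iff (x : ProjectiveSpectrum grading) {d : ℕ} (r s : grading d)
    (hs : s.1 ∉ x.asHomogeneousIdeal) (z : ProjTwist.At grading x) :
    z = (fraction x r s hs).val ↔ z * algebraMap _ _ s.1 = algebraMap _ _ r.1 :=
  mk_eq_iff x hs z

lemma exists_fraction_of_section {n : ℤ} {W : P1Z.Opens} (m : Γ(OP1Z n, W)) {x : P1Z}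
    (hx : x ∈ W) : ∃ (V : P1Z.Opens) (hV : V ≤ W), x ∈ V ∧ ∃ (p q : ℕ) (_ : (p : ℤ) = q + n)
      (r : grading p) (s : grading q), ∀ y (hy : y ∈ V),
        s.1 ∉ ProjectiveSpectrum.asHomogeneousIdeal y ∧
        evalTwist (hV hy) m * algebraMap _ _ s.1 = algebraMap _ _ r.1 := by
  obtain ⟨V, hxV, k, p, q, hpq, r, s, hs, w⟩ := (m : ProjTwist.sections grading n W).2 ⟨x, hx⟩
  exact ⟨V, leOfHom k, hxV, p, q, hpq, r, s, fun y hy => ⟨hs ⟨y, hy⟩,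
    (mk_eq_iff y (hs ⟨y, hy⟩) _).mp (w ⟨y, hy⟩)⟩⟩

/-- Dividing a local fraction of degree `n` by `xᵢ ^ n` gives a fraction of degree zero. The power
of `xᵢ` goes to the numerator or the denominator according to the sign of `n`. -/
lemma exists_smul_twistGen (n : ℤ) (i : Fin 2) {W : P1Z.Opens} (h : W ≤ chart i)
    (m : Γ(OP1Z n, W)) : ∃ a : Γ(P1Z, W), m = a • (OP1Z n).res h (twistGen n i) := by
  have key (x : P1Z) (hx : x ∈ W) : ∃ (V : P1Z.Opens) (hV : V ≤ W), x ∈ V ∧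
      ∃ (d : ℕ) (r s : grading d)
      (hs : ∀ y ∈ V, s.1 ∉ ProjectiveSpectrum.asHomogeneousIdeal y), ∀ y (hy : y ∈ V),
      evalTwist (hV hy) m * ↑(coordUnit (h (hV hy)) ^ n)⁻¹ = (fraction y r s (hs y hy)).val := by
    obtain ⟨V, hV, hxV, p, q, hpq, r, s, hs⟩ := exists_fraction_of_section m hx
    refine ⟨V, hV, hxV, p + (-n).toNat,
      ⟨r.1 * X i ^ (-n).toNat, SetLike.mul_mem_graded r.2 (X_pow_mem_grading i _)⟩,
      ⟨s.1 * X i ^ n.toNat, ?_⟩, fun y hy => ?_, fun y hy => ?_⟩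
    · rw [show p + (-n).toNat = q + n.toNat by omega]
      exact SetLike.mul_mem_graded s.2 (X_pow_mem_grading i _)
    · exact (ProjectiveSpectrum.isPrime (𝒜 := grading) y).mul_notMem (hs y hy).1
        (X_pow_notMem (h (hV hy)) _)
    · refine (eq_val_fraction_iff y _ _ _ _).mpr ?_
      rw [map_mul, map_mul, ← (hs y hy).2, map_pow, map_pow]
      change _ * (_ * coordAt y i ^ _) = _ * coordAt y i ^ _
      rw [← coordUnit_zpow_mul (h (hV hy)) n, mul_left_comm _ (algebraMap _ _ _), mul_assoc,
        Units.inv_mul_cancel_left]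
      ring
  choose V hV hxV d r s hs w using key
  -- The fractions chosen at different points have equal values in the localizations wherever both
  -- are defined, so the pointwise choice is a section.
  let a : Γ(P1Z, W) :=
    ⟨fun x => fraction x.1 (r x.1 x.2) (s x.1 x.2) (hs x.1 x.2 x.1 (hxV x.1 x.2)), fun x =>
      ⟨V x.1 x.2, hxV x.1 x.2, homOfLE (hV x.1 x.2), d x.1 x.2, r x.1 x.2, s x.1 x.2,
        fun y => hs x.1 x.2 y.1 y.2, fun y => HomogeneousLocalization.val_injective _
          ((w y.1 (hV x.1 x.2 y.2) y.1 (hxV _ _)).symm.trans (w x.1 x.2 y.1 y.2))⟩⟩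
  refine ⟨a, evalTwist_ext fun x hx => ?_⟩
  exact (Units.mul_inv_eq_iff_eq_mul _).mp (w x hx x (hxV _ _))

/-- Here `x₁ ^ n = (x₁ / x₀) ^ n * x₀ ^ n`. This fixes the sign of the exponents in all gluing
conditions. -/
lemma res_twistGen_one (n : ℤ) {W : P1Z.Opens} (h₀ : W ≤ chart 0) (h₁ : W ≤ chart 1) :
    (OP1Z n).res h₁ (twistGen n 1) =
      (↑(transition h₀ h₁ ^ n) : Γ(P1Z, W)) • (OP1Z n).res h₀ (twistGen n 0) := by
  refine evalTwist_ext fun x hx => ?_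
  rw [evalTwist_smul, evalTwist_res, evalTwist_res, evalTwist_twistGen, evalTwist_twistGen]
  have h1 : coordUnit (h₁ hx) =
      Units.map (evalFun hx).toMonoidHom (transition h₀ h₁) * coordUnit (h₀ hx) :=
    Units.ext (evalFun_chartEquiv_X 0 (h₀ hx)).symm
  rw [h1, mul_zpow, ← map_zpow]
  rfl

end ProjectiveLine

/-! ### Transport of the algebra along isomorphisms of rings -/

namespace BundleAlgebra

open Polynomial LaurentPolynomial

section Transport

variable {R A M : Type*} [CommRing R] [CommRing A] [AddCommGroup M] [Module A M] (ψ : R ≃+* A)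

/-- The module structure obtained from an isomorphism of rings. -/
@[reducible]
noncomputable def moduleOfRingEquiv (M : Type*) [AddCommGroup M] [Module A M] : Module R M :=
  Module.compHom M ψ.toRingHom

lemma finite_of_ringEquiv [Module.Finite A M] :
    letI := moduleOfRingEquiv ψ M
    Module.Finite R M := by
  let := moduleOfRingEquiv ψ M
  let f : M →ₛₗ[(ψ.symm : A →+* R)] M :=
    { toFun := id
      map_add' := fun _ _ => rfl
      map_smul' := fun a m => by
        change a • m = ψ (ψ.symm a) • m
        rw [ψ.apply_symm_apply] }
  have : RingHomSurjective (ψ.symm : A →+* R) := ⟨ψ.symm.surjective⟩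
  exact Module.Finite.of_surjective f Function.surjective_id

lemma projective_of_ringEquiv [Module.Projective A M] :
    letI := moduleOfRingEquiv ψ M
    Module.Projective R M := by
  let := moduleOfRingEquiv ψ M
  have := RingHomInvPair.of_ringEquiv ψ.symm
  have : RingHomInvPair (ψ : R →+* A) (ψ.symm : A →+* R) := RingHomInvPair.of_ringEquiv ψ
  have : RingHomInvPair (ψ.symm : A →+* R) (ψ : R →+* A) := RingHomInvPair.of_ringEquiv ψ.symm
  let f : M ≃ₛₗ[(ψ.symm : A →+* R)] M :=
    { AddEquiv.refl M with
      map_smul' := fun a m => by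
        change a • m = ψ (ψ.symm a) • m
        rw [ψ.apply_symm_apply] }
  exact Module.Projective.of_equiv f

lemma RankTwo.of_ringEquiv (h : RankTwo A M) :
    letI := moduleOfRingEquiv ψ M
    RankTwo R M := by
  let := moduleOfRingEquiv ψ M
  obtain ⟨e₁, e₂, h0, h1⟩ := h
  refine ⟨e₁, e₂, fun a b hab => ?_, fun m => ?_⟩
  · simpa using h0 (ψ a) (ψ b) hab
  · obtain ⟨r, hr, a, b, hab⟩ := h1 m
    refine ⟨ψ.symm r, by simpa using hr, ψ.symm a, ψ.symm b, ?_⟩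
    change ψ _ • m = ψ _ • e₁ + ψ _ • e₂
    simpa using hab

/-- A linear form over a ring as a linear form over an isomorphic ring. -/
noncomputable def formOfRingEquiv (g : letI := moduleOfRingEquiv ψ M; M →ₗ[R] R) : M →ₗ[A] A :=
  let := moduleOfRingEquiv ψ M
  { toFun := fun m => ψ (g m)
    map_add' := fun m n => by rw [map_add, map_add]
    map_smul' := fun a m => by
      obtain ⟨r, rfl⟩ := ψ.surjective a
      rw [show ψ r • m = (r • m : M) from rfl, map_smul, smul_eq_mul, map_mul]
      rfl }

lemma Coprime.formOfRingEquiv {g : letI := moduleOfRingEquiv ψ M; M →ₗ[R] R}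
    (hg : letI := moduleOfRingEquiv ψ M; Coprime g) : Coprime (formOfRingEquiv ψ g) := by
  intro x y h
  obtain ⟨x, rfl⟩ := ψ.surjective x
  obtain ⟨y, rfl⟩ := ψ.surjective y
  refine map_dvd ψ (hg x y fun m => ?_)
  have := map_dvd ψ.symm (h m)
  rw [map_mul, ψ.symm_apply_apply, ψ.symm_apply_apply] at this
  refine this.trans (dvd_of_eq (congrArg _ ?_))
  exact ψ.symm_apply_apply _

end Transport

/-- `exists_extension_data` for modules over isomorphic copies of the polynomial rings. -/
theorem exists_extension_data_of_ringEquiv {A₀ A₁ B M₀ M₁ N : Type*} [CommRing A₀] [CommRing A₁]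
    [CommRing B] [AddCommGroup M₀] [AddCommGroup M₁] [AddCommGroup N] [Module A₀ M₀] [Module A₁ M₁]
    [Module B N] [Module.Finite A₀ M₀] [Module.Finite A₁ M₁] [Module.Projective A₀ M₀]
    [Module.Projective A₁ M₁] (ψ₀ : ℤ[X] ≃+* A₀) (ψ₁ : ℤ[X] ≃+* A₁) (l : ℤ[T;T⁻¹] →+* B)
    (ρ₀ : M₀ →+ N) (ρ₁ : M₁ →+ N) (hρ₀ : ∀ p m, ρ₀ (ψ₀ p • m) = l (toLaurent p) • ρ₀ m)
    (hρ₁ : ∀ p m, ρ₁ (ψ₁ p • m) = l (invLaurent p) • ρ₁ m) (inj₀ : Function.Injective ρ₀)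
    (inj₁ : Function.Injective ρ₁)
    (surj₀ : ∀ n, ∃ (k : ℕ) (m : M₀), l (toLaurent (X ^ k)) • n = ρ₀ m)
    (surj₁ : ∀ n, ∃ (k : ℕ) (m : M₁), l (invLaurent (X ^ k)) • n = ρ₁ m) (hM₀ : RankTwo A₀ M₀) :
    ∃ (a b : ℤ) (s₀ : M₀) (s₁ : M₁) (g₀ : M₀ →ₗ[A₀] A₀) (g₁ : M₁ →ₗ[A₁] A₁), b ≤ a ∧
      s₀ ≠ 0 ∧ s₁ ≠ 0 ∧ ρ₁ s₁ = l (T a) • ρ₀ s₀ ∧ Coprime g₀ ∧ Coprime g₁ ∧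
      (∀ m, g₀ m = 0 ↔ ∃ c : A₀, m = c • s₀) ∧ (∀ m, g₁ m = 0 ↔ ∃ c : A₁, m = c • s₁) ∧
      ∀ (m₀ : M₀) (m₁ : M₁) (k : ℤ), ρ₁ m₁ = l (T k) • ρ₀ m₀ →
        l (T b) * l (invLaurent (ψ₁.symm (g₁ m₁))) = l (T k) * l (toLaurent (ψ₀.symm (g₀ m₀))) := by
  let := moduleOfRingEquiv ψ₀ M₀
  let := moduleOfRingEquiv ψ₁ M₁
  let : Module ℤ[T;T⁻¹] N := Module.compHom N l
  have := finite_of_ringEquiv (M := M₀) ψ₀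
  have := finite_of_ringEquiv (M := M₁) ψ₁
  have := projective_of_ringEquiv (M := M₀) ψ₀
  have := projective_of_ringEquiv (M := M₁) ψ₁
  obtain ⟨a, b, s₀, s₁, g₀, g₁, hba, hs₀, hs₁, hs, hg₀, hg₁, hk₀, hk₁, hg⟩ :=
    exists_extension_data (M₀ := M₀) (M₁ := M₁) (N := N)
      ⟨ρ₀, hρ₀, inj₀, surj₀⟩ ⟨ρ₁, hρ₁, inj₁, surj₁⟩ (hM₀.of_ringEquiv ψ₀)
  refine ⟨a, b, s₀, s₁, formOfRingEquiv ψ₀ g₀, formOfRingEquiv ψ₁ g₁, hba, hs₀, hs₁, hs,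
    hg₀.formOfRingEquiv ψ₀, hg₁.formOfRingEquiv ψ₁, fun m => ?_, fun m => ?_, fun m₀ m₁ k h => ?_⟩
  · refine ((map_eq_zero_iff ψ₀ ψ₀.injective).trans (hk₀ m)).trans ?_
    exact ψ₀.toEquiv.exists_congr_left.trans (exists_congr fun c => by
      change m = ψ₀ (ψ₀.symm c) • s₀ ↔ _
      rw [ψ₀.apply_symm_apply])
  · refine ((map_eq_zero_iff ψ₁ ψ₁.injective).trans (hk₁ m)).trans ?_
    exact ψ₁.toEquiv.exists_congr_left.trans (exists_congr fun c => by
      change m = ψ₁ (ψ₁.symm c) • s₁ ↔ _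
      rw [ψ₁.apply_symm_apply])
  · have := congrArg l (hg m₀ m₁ k h)
    rw [map_mul, map_mul] at this
    refine Eq.trans ?_ (this.trans ?_)
    · exact congrArg (fun z => l (T b) * l (invLaurent z)) (ψ₁.symm_apply_apply _)
    · exact congrArg (fun z => l (T k) * l (toLaurent z)) (ψ₀.symm_apply_apply _).symm

end BundleAlgebra

/-! ### Clearing denominators and generic rank -/

namespace AlgebraicGeometry.Scheme.Modules

variable {X : Scheme.{u}}

lemma IsLocalizingOn.exists_smul_eq' {M : X.Modules} {U V : X.Opens} (hM : M.IsLocalizingOn U)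
    (f : Γ(X, U)) (hf : X.basicOpen f = V) (h : V ≤ U) (s : Γ(M, V)) :
    ∃ (n : ℕ) (t : Γ(M, U)), M.res h t = X.resFun h (f ^ n) • s := by
  subst hf
  exact hM.exists_smul_eq f s

lemma IsLocalizingOn.exists_smul_eq_zero' {M : X.Modules} {U V : X.Opens} (hM : M.IsLocalizingOn U)
    (f : Γ(X, U)) (hf : X.basicOpen f = V) (h : V ≤ U) (t : Γ(M, U)) (ht : M.res h t = 0) :
    ∃ n : ℕ, f ^ n • t = 0 := by
  subst hf
  exact hM.exists_smul_eq_zero f t ht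

lemma IsLocalizingOn.res_injective {M : X.Modules} {U V : X.Opens} (hM : M.IsLocalizingOn U)
    [IsDomain Γ(X, U)] [Module.IsTorsionFree Γ(X, U) Γ(M, U)]
    (f : Γ(X, U)) (hf : X.basicOpen f = V) (hf0 : f ≠ 0) (h : V ≤ U) :
    Function.Injective (M.res h) := by
  rw [injective_iff_map_eq_zero]
  intro t ht
  obtain ⟨n, hn⟩ := hM.exists_smul_eq_zero' f hf h t ht
  exact (smul_eq_zero.mp hn).resolve_left (pow_ne_zero _ hf0)

lemma exists_resFun_eq {U : X.Opens} (hU : IsAffineOpen U) (f : Γ(X, U))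
    (r : Γ(X, X.basicOpen f)) : ∃ (n : ℕ) (a : Γ(X, U)),
      X.resFun (X.basicOpen_le f) (f ^ n) * r = X.resFun (X.basicOpen_le f) a := by
  have := hU.isLocalization_basicOpen f
  obtain ⟨⟨a, ⟨_, n, rfl⟩⟩, h⟩ := IsLocalization.surj (.powers f) r
  exact ⟨n, a, (mul_comm _ _).trans h⟩

lemma exists_pow_mul_eq_zero {U : X.Opens} (hU : IsAffineOpen U) (f : Γ(X, U))
    (r : Γ(X, U)) (hr : X.resFun (X.basicOpen_le f) r = 0) : ∃ n : ℕ, f ^ n * r = 0 := by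
  have := hU.isLocalization_basicOpen f
  obtain ⟨⟨_, n, rfl⟩, hn⟩ := (IsLocalization.map_eq_zero_iff (.powers f) Γ(X, X.basicOpen f)
    r).mp hr
  exact ⟨n, hn⟩

/-- Since the basic open sets carrying a basis cover `U`, one of them has `f ≠ 0`, and its basis can
be taken from sections over `U`. Generation follows by clearing denominators twice: `n₁` and `n₂`
for the coefficients, then `k` for the identity itself. -/
lemma rankTwo_of_locallyFree {E : X.Modules} (hE : IsLocallyFreeOfRank E 2) {U : X.Opens}
    (hU : IsAffineOpen U) (hM : E.IsLocalizingOn U) [IsDomain Γ(X, U)] :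
    BundleAlgebra.RankTwo Γ(X, U) Γ(E, U) := by
  obtain ⟨f, ⟨e₁, e₂, he⟩, hf⟩ : ∃ f ∈ {f : Γ(X, U) | ∃ e₁ e₂ : Γ(E, X.basicOpen f),
      E.IsBasisOn _ e₁ e₂}, f ≠ 0 := by
    by_contra! h
    have h1 := exists_span_isBasisOn hE hU
    rw [Ideal.span_eq_bot.mpr h] at h1
    exact bot_ne_top h1
  have hinj (r : Γ(X, U)) (hr : X.resFun (X.basicOpen_le f) r = 0) : r = 0 := by
    obtain ⟨n, hn⟩ := exists_pow_mul_eq_zero hU f r hr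
    exact (mul_eq_zero.mp hn).resolve_left (pow_ne_zero _ hf)
  obtain ⟨t₁, t₂, ht⟩ := hM.exists_pair he
  refine ⟨t₁, t₂, fun a b hab => ?_, fun m => ?_⟩
  · have h1 := congrArg (E.res (X.basicOpen_le f)) hab
    rw [map_add, res_smul, res_smul, map_zero] at h1
    obtain ⟨ha, hb⟩ := ht.eq_zero _ le_rfl _ _ (by rwa [res_self, res_self])
    exact ⟨hinj a ha, hinj b hb⟩
  · obtain ⟨r₁, r₂, h⟩ := ht.exists_eq _ le_rfl (E.res (X.basicOpen_le f) m)
    rw [res_self, res_self] at h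
    obtain ⟨n₁, a₁, h₁⟩ := exists_resFun_eq hU f r₁
    obtain ⟨n₂, a₂, h₂⟩ := exists_resFun_eq hU f r₂
    obtain ⟨k, hk⟩ := hM.exists_smul_eq_zero f
      (f ^ (n₁ + n₂) • m - ((f ^ n₂ * a₁) • t₁ + (f ^ n₁ * a₂) • t₂)) (by
        rw [map_sub, map_add, res_smul, res_smul, res_smul, map_mul, map_mul, ← h₁, ← h₂, h,
          smul_add, smul_smul, smul_smul, sub_eq_zero, pow_add, map_mul]
        congr 2 <;> ring)
    refine ⟨f ^ (k + (n₁ + n₂)), pow_ne_zero _ hf, f ^ k * (f ^ n₂ * a₁), f ^ k * (f ^ n₁ * a₂), ?_⟩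
    rw [smul_sub, smul_add, smul_smul, smul_smul, smul_smul, sub_eq_zero] at hk
    rw [pow_add, hk]

end AlgebraicGeometry.Scheme.Modules

/-! ### The extension data of a bundle on the projective line -/

namespace ProjectiveLine

open Scheme Polynomial LaurentPolynomial BundleAlgebra Scheme.Modules

instance (i : Fin 2) : IsDomain Γ(P1Z, chart i) := (chartEquiv i).symm.toMulEquiv.isDomain _

instance (i : Fin 2) : IsNoetherianRing Γ(P1Z, chart i) :=
  isNoetherianRing_of_ringEquiv _ (chartEquiv i)

lemma coord_ne_zero (i : Fin 2) : coord i ≠ 0 :=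
  (map_ne_zero_iff _ (chartEquiv i).injective).mpr Polynomial.X_ne_zero

/-- The transition function on the intersection of the two charts. -/
noncomputable def overlapUnit : Γ(P1Z, chart 0 ⊓ chart 1)ˣ :=
  transition inf_le_left inf_le_right

/-- Laurent polynomials in `x₁ / x₀` are functions on the intersection of the two charts. -/
noncomputable def ofLaurent : ℤ[T;T⁻¹] →+* Γ(P1Z, chart 0 ⊓ chart 1) :=
  LaurentPolynomial.eval₂ (Int.castRingHom _) overlapUnit

lemma ofLaurent_T (k : ℤ) : ofLaurent (T k) = ↑(overlapUnit ^ k) :=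
  eval₂_T _ _ k

lemma ofLaurent_toLaurent (p : ℤ[X]) :
    ofLaurent (toLaurent p) = P1Z.resFun inf_le_left (chartEquiv 0 p) := by
  refine congr($(Polynomial.ringHom_ext (f := ofLaurent.comp toLaurent)
    (g := (P1Z.resFun inf_le_left).comp (chartEquiv 0).toRingHom) (fun n => by simp) ?_) p)
  rw [RingHom.comp_apply, toLaurent_X, ofLaurent_T, zpow_one]
  rfl

lemma ofLaurent_invLaurent (p : ℤ[X]) :
    ofLaurent (invLaurent p) = P1Z.resFun inf_le_right (chartEquiv 1 p) := by
  refine congr($(Polynomial.ringHom_ext (f := ofLaurent.comp invLaurent)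
    (g := (P1Z.resFun inf_le_right).comp (chartEquiv 1).toRingHom) (fun n => by simp) ?_) p)
  rw [RingHom.comp_apply, ← pow_one Polynomial.X, invLaurent_X_pow, ofLaurent_T, Nat.cast_one,
    zpow_neg_one, pow_one]
  rfl

/-- `exists_extension_data` for the sections of a bundle over the charts. -/
theorem exists_sections_of_locallyFree {E : P1Z.Modules} (hE : IsLocallyFreeOfRank E 2) :
    ∃ (a b : ℤ) (s : ∀ i, Γ(E, chart i))
      (g : ∀ i, Γ(E, chart i) →ₗ[Γ(P1Z, chart i)] Γ(P1Z, chart i)), b ≤ a ∧ (∀ i, s i ≠ 0) ∧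
      E.res inf_le_right (s 1) = (↑(overlapUnit ^ a) : Γ(P1Z, chart 0 ⊓ chart 1))
        • E.res inf_le_left (s 0) ∧
      (∀ i, Coprime (g i)) ∧ (∀ i m, g i m = 0 ↔ ∃ c : Γ(P1Z, chart i), m = c • s i) ∧
      ∀ (m₀ : Γ(E, chart 0)) (m₁ : Γ(E, chart 1)) (k : ℤ),
        E.res inf_le_right m₁ = (↑(overlapUnit ^ k) : Γ(P1Z, chart 0 ⊓ chart 1))
          • E.res inf_le_left m₀ →
        (↑(overlapUnit ^ b) : Γ(P1Z, chart 0 ⊓ chart 1)) *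
          P1Z.resFun inf_le_right (g 1 m₁) =
        (↑(overlapUnit ^ k) : Γ(P1Z, chart 0 ⊓ chart 1)) *
          P1Z.resFun inf_le_left (g 0 m₀) := by
  have := isQuasicoherent_of_locallyFree hE
  have hloc (i : Fin 2) : E.IsLocalizingOn (chart i) :=
    isLocalizingOn_of_isAffineOpen E (isAffineOpen_chart i)
  have hfin (i : Fin 2) := finite_of_isBasisOn (isAffineOpen_chart i) (hloc i) _
    (exists_span_isBasisOn hE (isAffineOpen_chart i)) fun f hf => hf
  have hproj (i : Fin 2) := projective_of_isBasisOn (isAffineOpen_chart i) (hloc i) _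
    (exists_span_isBasisOn hE (isAffineOpen_chart i)) fun f hf => hf
  have hb₀ := basicOpen_coord 0
  have hb₁ := (basicOpen_coord 1).trans (inf_comm (chart 1) (chart 0))
  obtain ⟨a, b, s₀, s₁, g₀, g₁, hba, hs₀, hs₁, hs, hg₀, hg₁, hk₀, hk₁, hg⟩ :=
    exists_extension_data_of_ringEquiv (chartEquiv 0) (chartEquiv 1) ofLaurent
      (E.res (inf_le_left : chart 0 ⊓ chart 1 ≤ _)) (E.res inf_le_right)
      (fun p m => by rw [res_smul, ofLaurent_toLaurent])
      (fun p m => by rw [res_smul, ofLaurent_invLaurent])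
      ((hloc 0).res_injective (coord 0) hb₀ (coord_ne_zero 0) _)
      ((hloc 1).res_injective (coord 1) hb₁ (coord_ne_zero 1) _)
      (fun n => by
        obtain ⟨k, m, h⟩ := (hloc 0).exists_smul_eq' (coord 0) hb₀ inf_le_left n
        exact ⟨k, m, by rw [h, ofLaurent_toLaurent, map_pow, coord]⟩)
      (fun n => by
        obtain ⟨k, m, h⟩ := (hloc 1).exists_smul_eq' (coord 1) hb₁ inf_le_right n
        exact ⟨k, m, by rw [h, ofLaurent_invLaurent, map_pow, coord]⟩)
      (rankTwo_of_locallyFree hE (isAffineOpen_chart 0) (hloc 0))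
  refine ⟨a, b, Fin.cons s₀ (Fin.cons s₁ finZeroElim), Fin.cons g₀ (Fin.cons g₁ finZeroElim),
    hba, ?_, ?_, ?_, ?_, fun m₀ m₁ k h => ?_⟩
  · exact Fin.forall_fin_two.mpr ⟨hs₀, hs₁⟩
  · rw [← ofLaurent_T]
    exact hs
  · exact Fin.forall_fin_two.mpr ⟨hg₀, hg₁⟩
  · exact Fin.forall_fin_two.mpr ⟨hk₀, hk₁⟩
  · have := hg m₀ m₁ k (by rw [h, ofLaurent_T])
    rw [ofLaurent_toLaurent, ofLaurent_invLaurent, RingEquiv.apply_symm_apply,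
      RingEquiv.apply_symm_apply, ofLaurent_T, ofLaurent_T] at this
    exact this

end ProjectiveLine

/-! ### Homomorphisms from linear maps on charts -/

namespace AlgebraicGeometry.Scheme.Modules

variable {X : Scheme.{u}} {M N : X.Modules}

lemma resFun_pow_isUnit {U V : X.Opens} (f : Γ(X, U)) (h : V ≤ X.basicOpen f) (n : ℕ) :
    IsUnit (X.resFun (h.trans (X.basicOpen_le f)) (f ^ n)) := by
  rw [map_pow]
  exact (isUnit_resFun_basicOpen f h).pow n

lemma IsLocalizingOn.exists_localized_section {U : X.Opens} (hM : M.IsLocalizingOn U)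
    (ψ : Γ(M, U) →ₗ[Γ(X, U)] Γ(N, U)) (f : Γ(X, U)) (m : Γ(M, X.basicOpen f)) :
    ∃ n : Γ(N, X.basicOpen f), ∀ (k : ℕ) (t : Γ(M, U)),
      M.res (X.basicOpen_le f) t = X.resFun (X.basicOpen_le f) (f ^ k) • m →
      N.res (X.basicOpen_le f) (ψ t) = X.resFun (X.basicOpen_le f) (f ^ k) • n := by
  have hu (n : ℕ) := resFun_pow_isUnit f (le_refl (X.basicOpen f)) n
  obtain ⟨k, t, h⟩ := hM.exists_smul_eq f m
  obtain ⟨u, hu'⟩ := hu k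
  refine ⟨(↑u⁻¹ : Γ(X, X.basicOpen f)) • N.res (X.basicOpen_le f) (ψ t), fun k' t' h' => ?_⟩
  obtain ⟨l, hl⟩ := hM.exists_smul_eq_zero f (f ^ k • t' - f ^ k' • t) (by
    rw [map_sub, res_smul, res_smul, h, h', smul_smul, smul_smul, mul_comm, sub_self])
  have h1 := congrArg (N.res (X.basicOpen_le f)) (congrArg ψ hl)
  rw [_root_.map_smul ψ, map_sub, _root_.map_smul ψ, _root_.map_smul ψ, res_smul, map_sub,
    res_smul, res_smul, map_zero, map_zero, (hu l).smul_eq_zero, sub_eq_zero, ← hu'] at h1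
  rw [smul_comm, ← h1, smul_smul, Units.inv_mul, one_smul]

/-- A linear map on the sections over an affine open set induces linear maps over its basic open
subsets. -/
lemma IsLocalizingOn.exists_localized {U : X.Opens} (hU : IsAffineOpen U) (hM : M.IsLocalizingOn U)
    (ψ : Γ(M, U) →ₗ[Γ(X, U)] Γ(N, U)) (f : Γ(X, U)) :
    ∃ φ : Γ(M, X.basicOpen f) →ₗ[Γ(X, X.basicOpen f)] Γ(N, X.basicOpen f),
      ∀ t, φ (M.res (X.basicOpen_le f) t) = N.res (X.basicOpen_le f) (ψ t) := by
  choose φ hφ using hM.exists_localized_section ψ f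
  have heq (m n) (k : ℕ) (h : X.resFun (X.basicOpen_le f) (f ^ k) • φ m =
      X.resFun (X.basicOpen_le f) (f ^ k) • n) : φ m = n :=
    (resFun_pow_isUnit f (le_refl (X.basicOpen f)) k).smul_left_cancel.mp h
  have hadd (m m') : φ (m + m') = φ m + φ m' := by
    obtain ⟨k, t, h⟩ := hM.exists_smul_eq f m
    obtain ⟨k', t', h'⟩ := hM.exists_smul_eq f m'
    have e (P : X.Modules) (x y : Γ(P, X.basicOpen f)) :
        X.resFun (X.basicOpen_le f) (f ^ (k + k')) • (x + y) =
        X.resFun (X.basicOpen_le f) (f ^ k') • X.resFun (X.basicOpen_le f) (f ^ k) • x +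
        X.resFun (X.basicOpen_le f) (f ^ k) • X.resFun (X.basicOpen_le f) (f ^ k') • y := by
      rw [smul_smul, smul_smul, ← map_mul, ← map_mul, smul_add, ← pow_add, ← pow_add, add_comm k]
    have h1 := hφ (m + m') (k + k') (f ^ k' • t + f ^ k • t') (by
      rw [e, map_add, res_smul, res_smul, h, h'])
    refine heq _ _ (k + k') (h1.symm.trans ?_)
    rw [e, map_add, map_add, _root_.map_smul ψ, _root_.map_smul ψ, res_smul, res_smul, hφ m k t h,
      hφ m' k' t' h']
  have hsmul (c : Γ(X, X.basicOpen f)) (m) : φ (c • m) = c • φ m := by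
    obtain ⟨k, t, h⟩ := hM.exists_smul_eq f m
    obtain ⟨l, a, ha⟩ := exists_resFun_eq hU f c
    have e (P : X.Modules) (x : Γ(P, X.basicOpen f)) :
        X.resFun (X.basicOpen_le f) (f ^ (l + k)) • c • x =
        X.resFun (X.basicOpen_le f) a • X.resFun (X.basicOpen_le f) (f ^ k) • x := by
      rw [smul_smul, smul_smul, ← ha, pow_add, map_mul, mul_right_comm]
    have h1 := hφ (c • m) (l + k) (a • t) (by rw [e, res_smul, h])
    refine heq _ _ (l + k) (h1.symm.trans ?_)
    rw [e, _root_.map_smul ψ, res_smul, hφ m k t h]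
  refine ⟨⟨⟨φ, hadd⟩, hsmul⟩, fun t => ?_⟩
  have h1 := hφ (M.res (X.basicOpen_le f) t) 0 t (by rw [pow_zero, map_one, one_smul])
  rw [pow_zero, map_one, one_smul] at h1
  exact h1.symm

/-- Homomorphisms may be given by linear maps on the sections over an affine open cover. -/
theorem exists_hom_of_charts {ι : Type*} (U : ι → X.Opens) (hcov : ∀ x, ∃ i, x ∈ U i)
    (hU : ∀ i, IsAffineOpen (U i)) (hM : ∀ i, M.IsLocalizingOn (U i))
    (ψ : ∀ i, Γ(M, U i) →ₗ[Γ(X, U i)] Γ(N, U i))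
    (hψ : ∀ i j (W : X.Opens) (hi : W ≤ U i) (hj : W ≤ U j) (t : Γ(M, U i)),
      ∃ (c : Γ(X, W)) (_ : IsUnit c) (t' : Γ(M, U j)), M.res hj t' = c • M.res hi t ∧
        N.res hj (ψ j t') = c • N.res hi (ψ i t)) :
    ∃ φ : M ⟶ N, ∀ i t, φ.app (U i) t = ψ i t := by
  choose φ hφ using fun i => (hM i).exists_localized (N := N) (hU i) (ψ i)
  -- A section over `U i` need not extend to `U j`. It agrees up to a unit with the restriction of a
  -- section over `U j`, which suffices because `φ j f` is linear.
  have hcompat (i j) (t : Γ(M, U i)) (f : Γ(X, U j)) (hf : X.basicOpen f ≤ U i) :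
      φ j f (M.res hf t) = N.res hf (ψ i t) := by
    obtain ⟨c, hc, t', h1, h2⟩ := hψ i j _ hf (X.basicOpen_le f) t
    refine hc.smul_left_cancel.mp ?_
    rw [← _root_.map_smul, ← h1, hφ, h2]
  have hbasic (W : X.Opens) (x : X) (hx : x ∈ W) : ∃ i, ∃ f : Γ(X, U i), X.basicOpen f ≤ W ∧
      x ∈ X.basicOpen f := by
    obtain ⟨i, hi⟩ := hcov x
    obtain ⟨f, hf, hxf⟩ := (hU i).exists_basicOpen_le (V := W) ⟨x, hx⟩ hi
    exact ⟨i, f, hf, hxf⟩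
  -- The graph consists of the pairs whose restrictions correspond over every basic open subset of
  -- every chart, so it is visibly stable under restriction.
  obtain ⟨Φ, hΦ⟩ := exists_hom_of_graph (M := M) (N := N)
    (fun W =>
      { carrier := {p | ∀ i (f : Γ(X, U i)) (hf : X.basicOpen f ≤ W),
          φ i f (M.res hf p.1) = N.res hf p.2}
        add_mem' := fun {p q} hp hq i f hf => by
          rw [Prod.fst_add, Prod.snd_add, map_add, map_add, map_add, hp i f hf, hq i f hf]
        zero_mem' := fun i f hf => by
          rw [Prod.fst_zero, Prod.snd_zero, map_zero, map_zero, map_zero]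
        smul_mem' := fun r p hp i f hf => by
          rw [Prod.smul_fst, Prod.smul_snd, res_smul, res_smul, _root_.map_smul, hp i f hf] })
    (fun W V h m n hmn i f hf => by
      rw [res_res, res_res]
      exact hmn i f (hf.trans h))
    (fun W n hn => by
      refine eq_of_locally_eq fun x hx => ?_
      obtain ⟨i, f, hf, hxf⟩ := hbasic W x hx
      refine ⟨_, hf, hxf, ?_⟩
      rw [← hn i f hf, map_zero, map_zero, map_zero])
    (fun W m x hx => by
      obtain ⟨i, f, hf, hxf⟩ := hbasic W x hx
      refine ⟨_, hf, hxf, φ i f (M.res hf m), fun j f' hf' => ?_⟩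
      obtain ⟨k, t, h⟩ := (hM i).exists_smul_eq f (M.res hf m)
      have hu := resFun_pow_isUnit f hf' k
      refine hu.smul_left_cancel.mp ?_
      have h1 := hφ i f t
      rw [h, _root_.map_smul] at h1
      have h2 := congrArg (N.res hf') h1
      rw [res_smul, resFun_resFun, res_res] at h2
      have h3 := congrArg (M.res hf') h
      rw [res_smul, resFun_resFun, res_res] at h3
      rw [h2, ← hcompat i j t f' (hf'.trans (X.basicOpen_le f)), h3, _root_.map_smul])
  refine ⟨Φ, fun i t => hΦ _ _ _ fun j f hf => hcompat i j t f hf⟩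

end AlgebraicGeometry.Scheme.Modules

namespace AlgebraicGeometry.Scheme.Modules

variable {X : Scheme.{u}}

lemma eq_zero_of_locally_eq_zero {U : X.Opens} {r : Γ(X, U)}
    (h : ∀ x ∈ U, ∃ (V : X.Opens) (hV : V ≤ U), x ∈ V ∧ X.resFun hV r = 0) : r = 0 :=
  eq_of_locally_eq (M := structureModule X) (m := r) (n := (0 : Γ(X, U))) fun x hx => by
    obtain ⟨V, hV, hxV, e⟩ := h x hx
    exact ⟨V, hV, hxV, e.trans (map_zero (X.resFun hV)).symm⟩

/-- A nonzero section of a torsion-free module over an integral affine open set is nowhere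
torsion. -/
lemma IsLocalizingOn.eq_zero_of_smul_eq_zero {M : X.Modules} {U : X.Opens} (hU : IsAffineOpen U)
    (hM : M.IsLocalizingOn U) [IsDomain Γ(X, U)] [Module.IsTorsionFree Γ(X, U) Γ(M, U)]
    {s : Γ(M, U)} (hs : s ≠ 0) {W : X.Opens} (h : W ≤ U) {r : Γ(X, W)} (hr : r • M.res h s = 0) :
    r = 0 := by
  refine eq_zero_of_locally_eq_zero fun x hx => ?_
  obtain ⟨f, hf, hxf⟩ := hU.exists_basicOpen_le (V := W) ⟨x, hx⟩ (h hx)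
  refine ⟨_, hf, hxf, ?_⟩
  obtain ⟨n, a, ha⟩ := exists_resFun_eq hU f (X.resFun hf r)
  have h1 : M.res (X.basicOpen_le f) (a • s) = 0 := by
    rw [res_smul, ← ha, mul_smul]
    have h2 := congrArg (M.res hf) hr
    rw [res_smul, res_res, map_zero] at h2
    rw [h2, smul_zero]
  obtain ⟨k, hk⟩ := hM.exists_smul_eq_zero f _ h1
  rw [smul_smul] at hk
  have h2 : f ^ k * a = 0 := (smul_eq_zero.mp hk).resolve_right hs
  have h3 := congrArg (X.resFun (X.basicOpen_le f)) h2
  rw [map_mul, map_zero, ← ha] at h3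
  exact (resFun_pow_isUnit f le_rfl n).mul_right_eq_zero.mp
    ((resFun_pow_isUnit f le_rfl k).mul_right_eq_zero.mp h3)

end AlgebraicGeometry.Scheme.Modules

/-! ### Homomorphisms to and from the twisting sheaves -/

namespace ProjectiveLine

open Scheme BundleAlgebra Scheme.Modules

lemma isLocalizingOn_OP1Z (n : ℤ) (i : Fin 2) : (OP1Z n).IsLocalizingOn (chart i) where
  exists_smul_eq f s := by
    obtain ⟨r, rfl⟩ := exists_smul_twistGen n i (P1Z.basicOpen_le f) s
    obtain ⟨k, a, ha⟩ := exists_resFun_eq (isAffineOpen_chart i) f r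
    exact ⟨k, a • twistGen n i, by rw [res_smul, ← ha, mul_smul]⟩
  exists_smul_eq_zero f t ht := by
    obtain ⟨a, rfl⟩ := exists_smul_twistGen n i le_rfl t
    rw [res_smul, res_res] at ht
    obtain ⟨k, hk⟩ := exists_pow_mul_eq_zero (isAffineOpen_chart i) f a
      (smul_twistGen_injective n i _ ht)
    exact ⟨k, by rw [smul_smul, hk, zero_smul]⟩

/-- On the overlap, `t` may have a pole along the zeros of `coord 1`. A power of `coord 1`, which is
the inverse of `overlapUnit`, removes it. Such pairs test compatibility of data on the two charts.
-/
lemma exists_section_chart_one {M : P1Z.Modules} (hM : ∀ i, M.IsLocalizingOn (chart i))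
    (t : Γ(M, chart 0)) : ∃ (k : ℤ) (t' : Γ(M, chart 1)), M.res inf_le_right t' =
      (↑(overlapUnit ^ k) : Γ(P1Z, chart 0 ⊓ chart 1)) • M.res inf_le_left t := by
  have hb₁ : P1Z.basicOpen (coord 1) = chart 0 ⊓ chart 1 :=
    (basicOpen_coord 1).trans (inf_comm (chart 1) (chart 0))
  obtain ⟨k, t', h⟩ := (hM 1).exists_smul_eq' (coord 1) hb₁ inf_le_right (M.res inf_le_left t)
  refine ⟨-k, t', h.trans (congrArg (· • _) ?_)⟩
  rw [zpow_neg, zpow_natCast, ← inv_pow, Units.val_pow_eq_pow_val, map_pow]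
  rfl

lemma exists_section_chart_zero {M : P1Z.Modules} (hM : ∀ i, M.IsLocalizingOn (chart i))
    (t : Γ(M, chart 1)) : ∃ (k : ℤ) (t' : Γ(M, chart 0)), M.res inf_le_right t =
      (↑(overlapUnit ^ k) : Γ(P1Z, chart 0 ⊓ chart 1)) • M.res inf_le_left t' := by
  have hb₀ : P1Z.basicOpen (coord 0) = chart 0 ⊓ chart 1 := basicOpen_coord 0
  obtain ⟨k, t', h⟩ := (hM 0).exists_smul_eq' (coord 0) hb₀ inf_le_left (M.res inf_le_right t)
  have hk : P1Z.resFun inf_le_left (coord 0 ^ k) =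
      (↑(overlapUnit ^ (k : ℤ)) : Γ(P1Z, chart 0 ⊓ chart 1)) := by
    rw [zpow_natCast, Units.val_pow_eq_pow_val, map_pow]
    rfl
  exact ⟨-k, t', by rw [h, hk, smul_smul, zpow_neg, Units.inv_mul, one_smul]⟩

/-- Homomorphisms given by linear maps on the sections over the two charts. -/
theorem exists_hom_of_two_charts {M N : P1Z.Modules} (hM : ∀ i, M.IsLocalizingOn (chart i))
    (ψ : ∀ i, Γ(M, chart i) →ₗ[Γ(P1Z, chart i)] Γ(N, chart i))
    (hψ : ∀ (m₀ : Γ(M, chart 0)) (m₁ : Γ(M, chart 1)) (k : ℤ),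
      M.res inf_le_right m₁ =
        (↑(overlapUnit ^ k) : Γ(P1Z, chart 0 ⊓ chart 1)) • M.res inf_le_left m₀ →
      N.res inf_le_right (ψ 1 m₁) =
        (↑(overlapUnit ^ k) : Γ(P1Z, chart 0 ⊓ chart 1)) • N.res inf_le_left (ψ 0 m₀)) :
    ∃ φ : M ⟶ N, ∀ i t, φ.app (chart i) t = ψ i t := by
  refine exists_hom_of_charts chart exists_mem_chart isAffineOpen_chart hM ψ ?_
  have hself (i : Fin 2) (W : P1Z.Opens) (hi hj : W ≤ chart i) (t : Γ(M, chart i)) :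
      ∃ (c : Γ(P1Z, W)) (_ : IsUnit c) (t' : Γ(M, chart i)), M.res hj t' = c • M.res hi t ∧
        N.res hj (ψ i t') = c • N.res hi (ψ i t) :=
    ⟨1, isUnit_one, t, (one_smul _ _).symm, (one_smul _ _).symm⟩
  have hunit (k : ℤ) (W : P1Z.Opens) (h : W ≤ chart 0 ⊓ chart 1) :
      IsUnit (P1Z.resFun h ↑(overlapUnit ^ k)) := (Units.isUnit _).map _
  have hinv (P : P1Z.Modules) (k : ℤ) (x y : Γ(P, chart 0 ⊓ chart 1))
      (h : x = (↑(overlapUnit ^ k) : Γ(P1Z, chart 0 ⊓ chart 1)) • y) :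
      y = (↑(overlapUnit ^ (-k)) : Γ(P1Z, chart 0 ⊓ chart 1)) • x := by
    rw [h, zpow_neg, smul_smul, Units.inv_mul, one_smul]
  refine Fin.forall_fin_two.mpr ⟨Fin.forall_fin_two.mpr ⟨hself 0, fun W h₀ h₁ t => ?_⟩,
    Fin.forall_fin_two.mpr ⟨fun W h₁ h₀ t => ?_, hself 1⟩⟩
  · obtain ⟨k, t', h⟩ := exists_section_chart_one hM t
    have h1 := congrArg (M.res (le_inf h₀ h₁)) h
    have h2 := congrArg (N.res (le_inf h₀ h₁)) (hψ t t' _ h)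
    rw [res_res, res_smul, res_res] at h1 h2
    exact ⟨_, hunit _ _ _, t', h1, h2⟩
  · obtain ⟨k, t', h⟩ := exists_section_chart_zero hM t
    have h1 := congrArg (M.res (le_inf h₀ h₁)) (hinv _ _ _ _ h)
    have h2 := congrArg (N.res (le_inf h₀ h₁)) (hinv _ _ _ _ (hψ t' t k h))
    rw [res_res, res_smul, res_res] at h1 h2
    exact ⟨_, hunit _ _ _, t', h1, h2⟩

/-- The generator of `𝒪(n)` over a chart as an isomorphism. -/
noncomputable def twistEquiv (n : ℤ) (i : Fin 2) :
    Γ(P1Z, chart i) ≃ₗ[Γ(P1Z, chart i)] Γ(OP1Z n, chart i) :=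
  .ofBijective (LinearMap.toSpanSingleton _ _ (twistGen n i))
    ⟨(injective_iff_map_eq_zero _).mpr fun a ha => smul_twistGen_injective n i le_rfl (by
      rwa [res_self]), fun m => by
      obtain ⟨a, ha⟩ := exists_smul_twistGen n i le_rfl m
      exact ⟨a, by rw [ha, res_self]; rfl⟩⟩

lemma twistEquiv_apply (n : ℤ) (i : Fin 2) (r : Γ(P1Z, chart i)) :
    twistEquiv n i r = r • twistGen n i := rfl

lemma res_twistGen_overlap (n : ℤ) :
    (OP1Z n).res inf_le_right (twistGen n 1) =
      (↑(overlapUnit ^ n) : Γ(P1Z, chart 0 ⊓ chart 1)) • (OP1Z n).res inf_le_left (twistGen n 0) :=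
  res_twistGen_one n _ _

/-- The homomorphism from `𝒪(a)` given by two sections on the charts. -/
theorem exists_hom_from_twist {E : P1Z.Modules} {a : ℤ} (s : ∀ i, Γ(E, chart i))
    (hs : E.res inf_le_right (s 1) =
      (↑(overlapUnit ^ a) : Γ(P1Z, chart 0 ⊓ chart 1)) • E.res inf_le_left (s 0)) :
    ∃ f : OP1Z a ⟶ E, ∀ i (W : P1Z.Opens) (h : W ≤ chart i) (r : Γ(P1Z, W)),
      f.app W (r • (OP1Z a).res h (twistGen a i)) = r • E.res h (s i) := by
  obtain ⟨f, hf⟩ := exists_hom_of_two_charts (M := OP1Z a) (N := E) (isLocalizingOn_OP1Z a)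
    (fun i => (LinearMap.toSpanSingleton _ _ (s i)).comp (twistEquiv a i).symm.toLinearMap)
    (fun m₀ m₁ k h => by
      obtain ⟨r₀, rfl⟩ := (twistEquiv a 0).surjective m₀
      obtain ⟨r₁, rfl⟩ := (twistEquiv a 1).surjective m₁
      rw [twistEquiv_apply, twistEquiv_apply, res_smul, res_smul, res_twistGen_overlap, smul_smul,
        smul_smul, ← sub_eq_zero, ← sub_smul] at h
      have h1 := sub_eq_zero.mp (smul_twistGen_injective a 0 _ h)
      simp only [LinearMap.comp_apply, LinearEquiv.coe_coe, LinearEquiv.symm_apply_apply,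
        LinearMap.toSpanSingleton_apply]
      rw [res_smul, res_smul, hs, smul_smul, smul_smul, h1])
  refine ⟨f, fun i W h r => ?_⟩
  rw [Hom.app_smul, app_res, hf, LinearMap.comp_apply]
  have : (twistEquiv a i).symm.toLinearMap (twistGen a i) = 1 := by
    rw [LinearEquiv.coe_coe, LinearEquiv.symm_apply_eq, twistEquiv_apply, one_smul]
  rw [this, LinearMap.toSpanSingleton_apply, one_smul]

/-- The homomorphism to `𝒪(b)` given by two linear forms on the charts. -/
theorem exists_hom_to_twist {E : P1Z.Modules} (hE : ∀ i, E.IsLocalizingOn (chart i)) {b : ℤ}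
    (g : ∀ i, Γ(E, chart i) →ₗ[Γ(P1Z, chart i)] Γ(P1Z, chart i))
    (hg : ∀ (m₀ : Γ(E, chart 0)) (m₁ : Γ(E, chart 1)) (k : ℤ),
        E.res inf_le_right m₁ =
          (↑(overlapUnit ^ k) : Γ(P1Z, chart 0 ⊓ chart 1)) • E.res inf_le_left m₀ →
        (↑(overlapUnit ^ b) : Γ(P1Z, chart 0 ⊓ chart 1)) *
          P1Z.resFun inf_le_right (g 1 m₁) =
        (↑(overlapUnit ^ k) : Γ(P1Z, chart 0 ⊓ chart 1)) *
          P1Z.resFun inf_le_left (g 0 m₀)) :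
    ∃ G : E ⟶ OP1Z b, ∀ i t, G.app (chart i) t = g i t • twistGen b i := by
  obtain ⟨G, hG⟩ := exists_hom_of_two_charts (M := E) (N := OP1Z b) hE
    (fun i => (twistEquiv b i).toLinearMap.comp (g i))
    (fun m₀ m₁ k h => by
      simp only [LinearMap.comp_apply, LinearEquiv.coe_coe, twistEquiv_apply]
      rw [res_smul, res_smul, res_twistGen_overlap, smul_smul, smul_smul, ← hg m₀ m₁ k h, mul_comm])
  exact ⟨G, hG⟩

end ProjectiveLine

/-! ### The ideal sheaf of the image -/

namespace AlgebraicGeometry.Scheme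

/-- The sheaf of ideals of the closure of a closed subscheme of an affine open set. -/
lemma exists_idealSheafData {X : Scheme.{u}} {U : X.Opens} (hU : IsAffineOpen U) [QuasiCompact U.ι]
    (I : Ideal Γ(X, U)) : ∃ J : X.IdealSheafData, ∀ (V W : X.Opens) (hV : IsAffineOpen V)
      (_ : IsAffineOpen W) (_ : U ⊓ V = W) (hWU : W ≤ U) (hWV : W ≤ V) (c : Γ(X, V)),
      c ∈ J.ideal ⟨V, hV⟩ ↔ X.resFun hWV c ∈ I.map (X.resFun hWU) := by
  have : IsAffine U := hU
  let I' : Ideal Γ(X, U.ι ''ᵁ ⊤) := I.map (X.resFun (by simp))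
  -- This is the ideal of the scheme-theoretic image: over an affine `V` it is the preimage of the
  -- ideal on `U ⊓ V`.
  refine ⟨(IdealSheafData.ofIdealTop (X := U) I').map U.ι,
    fun V W hV hW hUV hWU hWV c => ?_⟩
  obtain rfl : U.ι ''ᵁ (U.ι ⁻¹ᵁ V) = W := by
    rw [← hUV, Scheme.Hom.image_preimage_eq_opensRange_inf, Scheme.Opens.opensRange_ι]
  have H : IsAffineOpen (U.ι ⁻¹ᵁ V) := (Scheme.Hom.isAffineOpen_iff_of_isOpenImmersion U.ι).mp hW
  rw [IdealSheafData.ideal_map _ _ _ H, Ideal.mem_comap]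
  have h1 : ((U : Scheme.{u}).presheaf.map (homOfLE (le_top : U.ι ⁻¹ᵁ V ≤ ⊤)).op).hom.comp
      (X.resFun (show U.ι ''ᵁ ⊤ ≤ U by simp)) = X.resFun hWU :=
    RingHom.ext fun r => resFun_resFun (X := X)
      (show U.ι ''ᵁ (U.ι ⁻¹ᵁ V) ≤ U.ι ''ᵁ ⊤ from Scheme.Hom.image_mono _ le_top)
      (show U.ι ''ᵁ ⊤ ≤ U by simp) r
  have h2 : (U.ι.app V).hom c = X.resFun hWV c := by
    rw [Scheme.Opens.ι_app]
    rfl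
  have h3 : I'.map ((U : Scheme.{u}).presheaf.map (homOfLE (le_top : U.ι ⁻¹ᵁ V ≤ ⊤)).op).hom =
      I.map (X.resFun hWU) := by
    rw [← h1]
    exact Ideal.map_map (X.resFun (show U.ι ''ᵁ ⊤ ≤ U by simp)) _
  rw [h2]
  exact (SetLike.ext_iff.mp h3 _)

end AlgebraicGeometry.Scheme

namespace ProjectiveLine

open Scheme BundleAlgebra Scheme.Modules

instance (i : Fin 2) : QuasiCompact (chart i).ι := by
  have : P1Z.IsSeparated := by unfold P1Z; infer_instance
  have : IsAffine (chart i) := isAffineOpen_chart i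
  infer_instance

lemma isAffineOpen_overlap : IsAffineOpen (chart 0 ⊓ chart 1) := by
  have h : P1Z.basicOpen (coord 0) = chart 0 ⊓ chart 1 := basicOpen_coord 0
  rw [← h]
  exact (isAffineOpen_chart 0).basicOpen _

/-- The sheaf of ideals which is the image of a homomorphism to a line bundle. -/
theorem exists_ideal_of_forms {E : P1Z.Modules} (hE : ∀ i, E.IsLocalizingOn (chart i)) {b : ℤ}
    (g : ∀ i, Γ(E, chart i) →ₗ[Γ(P1Z, chart i)] Γ(P1Z, chart i))
    (hg : ∀ (m₀ : Γ(E, chart 0)) (m₁ : Γ(E, chart 1)) (k : ℤ),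
        E.res inf_le_right m₁ =
          (↑(overlapUnit ^ k) : Γ(P1Z, chart 0 ⊓ chart 1)) • E.res inf_le_left m₀ →
        (↑(overlapUnit ^ b) : Γ(P1Z, chart 0 ⊓ chart 1)) *
          P1Z.resFun inf_le_right (g 1 m₁) =
        (↑(overlapUnit ^ k) : Γ(P1Z, chart 0 ⊓ chart 1)) *
          P1Z.resFun inf_le_left (g 0 m₀)) :
    ∃ K : P1Z.IdealSheafData, ∀ i (c : Γ(P1Z, chart i)),
      c ∈ K.ideal ⟨chart i, isAffineOpen_chart i⟩ ↔ ∃ t, g i t = c := by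
  choose J hJ using fun i => exists_idealSheafData (isAffineOpen_chart i) (LinearMap.range (g i))
  have hself (i) (c : Γ(P1Z, chart i)) : c ∈ (J i).ideal ⟨chart i, isAffineOpen_chart i⟩ ↔
      ∃ t, g i t = c := by
    rw [hJ i (chart i) (chart i) (isAffineOpen_chart i) (isAffineOpen_chart i) (inf_idem _) le_rfl
      le_rfl]
    have : P1Z.resFun (le_refl (chart i)) = RingHom.id _ := RingHom.ext fun r => resFun_self _ r
    rw [this, Ideal.map_id]
    rfl
  -- On the chart `i` the ideal `J i` is exactly the range of `g i`. The other ideal contains this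
  -- range, because the two forms agree on the overlap up to units; hence the infimum is correct on
  -- both charts.
  refine ⟨J 0 ⊓ J 1, Fin.forall_fin_two.mpr ⟨fun c => ?_, fun c => ?_⟩⟩
  · rw [IdealSheafData.ideal_inf, Pi.inf_apply, Ideal.mem_inf, hself]
    refine and_iff_left_of_imp ?_
    rintro ⟨t, rfl⟩
    rw [hJ 1 (chart 0) (chart 0 ⊓ chart 1) (isAffineOpen_chart 0) isAffineOpen_overlap
      (inf_comm _ _)
      inf_le_right inf_le_left]
    obtain ⟨k, t', h⟩ := exists_section_chart_one hE t
    have h1 := hg t t' k h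
    rw [eq_comm, ← Units.eq_inv_mul_iff_mul_eq] at h1
    rw [h1]
    exact Ideal.mul_mem_left _ _ (Ideal.mul_mem_left _ _ (Ideal.mem_map_of_mem _ ⟨t', rfl⟩))
  · rw [IdealSheafData.ideal_inf, Pi.inf_apply, Ideal.mem_inf, hself]
    refine and_iff_right_of_imp ?_
    rintro ⟨t, rfl⟩
    rw [hJ 0 (chart 1) (chart 0 ⊓ chart 1) (isAffineOpen_chart 1) isAffineOpen_overlap rfl
      inf_le_left inf_le_right]
    obtain ⟨k, t', h⟩ := exists_section_chart_zero hE t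
    have h1 := hg t' t k h
    rw [← Units.eq_inv_mul_iff_mul_eq] at h1
    rw [h1]
    exact Ideal.mul_mem_left _ _ (Ideal.mul_mem_left _ _ (Ideal.mem_map_of_mem _ ⟨t', rfl⟩))

end ProjectiveLine

/-! ### Coprimality and regular sequences -/

namespace BundleAlgebra

/-- Coprimality is preserved by localization. -/
lemma Coprime.dvd_of_localization {R M A : Type*} [CommRing R] [IsDomain R] [IsNoetherianRing R]
    [AddCommGroup M] [Module R M] [CommRing A] [Algebra R A] {φ : M →ₗ[R] R} (hφ : Coprime φ)
    (f : R) (hf : f ≠ 0) [IsLocalization.Away f A] {x y : A}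
    (h : ∀ m, x ∣ y * algebraMap R A (φ m)) : x ∣ y := by
  have hinj : Function.Injective (algebraMap R A) :=
    IsLocalization.injective A (M := .powers f)
      (powers_le_nonZeroDivisors_of_noZeroDivisors hf)
  have hu (n : ℕ) : IsUnit (algebraMap R A (f ^ n)) := by
    rw [map_pow]
    exact (IsLocalization.Away.algebraMap_isUnit f).pow n
  obtain ⟨⟨x', ⟨_, k, rfl⟩⟩, hx⟩ := IsLocalization.surj (.powers f) x
  obtain ⟨⟨y', ⟨_, l, rfl⟩⟩, hy⟩ := IsLocalization.surj (.powers f) y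
  dsimp only at hx hy
  have h' (m) : ∃ n : ℕ, x' ∣ f ^ n * (y' * φ m) := by
    have h1 : algebraMap R A x' ∣ algebraMap R A (y' * φ m) := by
      rw [← hx, map_mul, ← hy, mul_right_comm, (hu k).mul_right_dvd]
      exact (h m).mul_right _
    obtain ⟨c, hc⟩ := h1
    obtain ⟨⟨c', ⟨_, n, rfl⟩⟩, hc'⟩ := IsLocalization.surj (.powers f) c
    refine ⟨n, c', hinj ?_⟩
    dsimp only at hc'
    rw [map_mul, hc, map_mul, ← hc']
    ring
  -- The power of `f` needed depends on the value of `φ`; finitely many generators of the range give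
  -- a common exponent.
  obtain ⟨S, hS⟩ := IsNoetherian.noetherian (LinearMap.range φ)
  have hS' (r : R) (hr : r ∈ S) : ∃ n : ℕ, x' ∣ f ^ n * (y' * r) := by
    obtain ⟨m, rfl⟩ : r ∈ LinearMap.range φ := hS ▸ Submodule.subset_span hr
    exact h' m
  choose! n hn using hS'
  have key (r : R) (hr : r ∈ Submodule.span R (S : Set R)) : x' ∣ f ^ (S.sup n) * y' * r := by
    induction hr using Submodule.span_induction with
    | mem r hr =>
      refine (hn r hr).trans ?_
      rw [mul_assoc]
      exact mul_dvd_mul_right (pow_dvd_pow _ (Finset.le_sup hr)) _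
    | zero => simp
    | add r s _ _ h1 h2 => rw [mul_add]; exact dvd_add h1 h2
    | smul a r _ h1 => rw [smul_eq_mul, mul_left_comm]; exact h1.mul_left a
  have h2 := map_dvd (algebraMap R A) (hφ x' (f ^ (S.sup n) * y') fun m => key _ (hS ▸ ⟨m, rfl⟩))
  rw [map_mul, (hu _).dvd_mul_left, ← hx, ← hy, (hu k).mul_right_dvd, (hu l).dvd_mul_right] at h2
  exact h2

/-- Two coprime elements form a regular sequence. -/
lemma isRegular_pair {A : Type*} [CommRing A] [IsDomain A] {p q : A}
    (h : ∀ x y : A, x ∣ y * p → x ∣ y * q → x ∣ y) (hne : Ideal.ofList [p, q] ≠ ⊤) :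
    RingTheory.Sequence.IsRegular A [p, q] := by
  have hp : p ≠ 0 := by
    rintro rfl
    refine hne ?_
    have h1 : IsUnit q := isUnit_of_dvd_one (h q 1 (by simp) (by simp))
    refine Ideal.eq_top_of_isUnit_mem _ (Ideal.subset_span ?_) h1
    exact List.mem_cons_of_mem _ List.mem_cons_self
  refine ⟨?_, ?_⟩
  · rw [RingTheory.Sequence.isWeaklyRegular_cons_iff, RingTheory.Sequence.isWeaklyRegular_cons_iff]
    refine ⟨IsSMulRegular.of_ne_zero hp, ?_, RingTheory.Sequence.IsWeaklyRegular.nil _ _⟩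
    rw [isSMulRegular_quotient_iff_mem_of_smul_mem]
    intro y hy
    rw [Submodule.mem_smul_pointwise_iff_exists] at hy ⊢
    obtain ⟨w, -, hw⟩ := hy
    -- From `q * y = p * w`, the element `p` divides both `y * p` and `y * q`, hence `y`.
    obtain ⟨c, hc⟩ := h p y (dvd_mul_left _ _) ⟨w, by
      rw [mul_comm]; exact hw.symm⟩
    exact ⟨c, trivial, hc.symm⟩
  · rw [smul_eq_mul, Ideal.mul_top]
    exact hne.symm

end BundleAlgebra

/-! ### The zero scheme is a local complete intersection -/

namespace ProjectiveLine

open Scheme BundleAlgebra Scheme.Modules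

variable {E : P1Z.Modules} {K : P1Z.IdealSheafData}
  {g : ∀ i, Γ(E, chart i) →ₗ[Γ(P1Z, chart i)] Γ(P1Z, chart i)}

/-- The equations of the closed subscheme over basic open subsets of the charts. -/
lemma mem_ker_subschemeι_iff
    (hK : ∀ i (c : Γ(P1Z, chart i)),
      c ∈ K.ideal ⟨chart i, isAffineOpen_chart i⟩ ↔ ∃ t, g i t = c) (i : Fin 2)
    (f : Γ(P1Z, chart i)) (c : Γ(P1Z, P1Z.basicOpen f)) :
    (K.subschemeι.app (P1Z.basicOpen f)).hom c = 0 ↔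
      ∃ (n : ℕ) (t : Γ(E, chart i)), P1Z.resFun (P1Z.basicOpen_le f) (f ^ n) * c =
        P1Z.resFun (P1Z.basicOpen_le f) (g i t) := by
  have hloc := (isAffineOpen_chart i).isLocalization_basicOpen f
  have h1 := K.ker_subschemeι_app (P1Z.affineBasicOpen (U := ⟨chart i, isAffineOpen_chart i⟩) f)
  have h2 := K.map_ideal_basicOpen ⟨chart i, isAffineOpen_chart i⟩ f
  rw [← h2] at h1
  refine (SetLike.ext_iff.mp h1 c).trans ?_
  refine (IsLocalization.mem_map_algebraMap_iff (.powers f) Γ(P1Z, P1Z.basicOpen f)).trans ?_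
  constructor
  · rintro ⟨⟨⟨r, hr⟩, ⟨_, n, rfl⟩⟩, h⟩
    obtain ⟨t, rfl⟩ := (hK i r).mp hr
    exact ⟨n, t, (mul_comm _ _).trans h⟩
  · rintro ⟨n, t, h⟩
    exact ⟨⟨⟨g i t, (hK i _).mpr ⟨t, rfl⟩⟩, ⟨_, n, rfl⟩⟩, (mul_comm _ _).trans h⟩

/-- Around each point of `Z` some basic open set carries a basis of `E` coming from sections `t₁`,
`t₂` over the chart. The values of the form at these generate the ideal, and coprimality, which
survives localization, makes them a regular sequence. -/
theorem isLocalCompleteIntersection_subschemeι (hE : IsLocallyFreeOfRank E 2)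
    (hloc : ∀ i, E.IsLocalizingOn (chart i)) (hg : ∀ i, Coprime (g i))
    (hK : ∀ i (c : Γ(P1Z, chart i)),
      c ∈ K.ideal ⟨chart i, isAffineOpen_chart i⟩ ↔ ∃ t, g i t = c) :
    IsLocalCompleteIntersection K.subschemeι 2 := by
  intro z
  obtain ⟨i, hi⟩ := exists_mem_chart (K.subschemeι z)
  obtain ⟨f, hzf, -, e₁, e₂, he⟩ := exists_basicOpen_isBasisOn hE (isAffineOpen_chart i) hi _ hi
  obtain ⟨t₁, t₂, ht⟩ := (hloc i).exists_pair he
  have hf : f ≠ 0 := by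
    rintro rfl
    rw [Scheme.basicOpen_zero] at hzf
    exact hzf
  have hA := (isAffineOpen_chart i).isLocalization_basicOpen f
  have hdom : IsDomain Γ(P1Z, P1Z.basicOpen f) := IsLocalization.isDomain_of_le_nonZeroDivisors
    (M := .powers f) (S := Γ(P1Z, P1Z.basicOpen f)) (powers_le_nonZeroDivisors_of_noZeroDivisors hf)
  obtain ⟨φ, hφ⟩ := (hloc i).exists_localized (N := structureModule P1Z) (isAffineOpen_chart i)
    (g i) f
  have hval (t : Γ(E, chart i)) : ∃ r₁ r₂ : Γ(P1Z, P1Z.basicOpen f),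
      P1Z.resFun (P1Z.basicOpen_le f) (g i t) =
        r₁ * P1Z.resFun (P1Z.basicOpen_le f) (g i t₁) +
        r₂ * P1Z.resFun (P1Z.basicOpen_le f) (g i t₂) := by
    obtain ⟨r₁, r₂, h⟩ := ht.exists_eq _ le_rfl (E.res (P1Z.basicOpen_le f) t)
    have h' := congrArg φ h
    rw [res_self, res_self, map_add, _root_.map_smul φ, _root_.map_smul φ, hφ, hφ, hφ] at h'
    exact ⟨r₁, r₂, h'⟩
  have hker : Ideal.ofList [P1Z.resFun (P1Z.basicOpen_le f) (g i t₁),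
      P1Z.resFun (P1Z.basicOpen_le f) (g i t₂)] =
      RingHom.ker (K.subschemeι.app (P1Z.basicOpen f)).hom := by
    have hmem (t) : P1Z.resFun (P1Z.basicOpen_le f) (g i t) ∈
        RingHom.ker (K.subschemeι.app (P1Z.basicOpen f)).hom :=
      (mem_ker_subschemeι_iff hK i f _).mpr ⟨0, t, by rw [pow_zero, map_one, one_mul]⟩
    refine le_antisymm (Ideal.span_le.mpr ?_) fun c hc => ?_
    · rintro c hc
      rcases List.mem_pair.mp hc with rfl | rfl
      exacts [hmem t₁, hmem t₂]
    · obtain ⟨n, t, h⟩ := (mem_ker_subschemeι_iff hK i f c).mp hc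
      obtain ⟨r₁, r₂, h'⟩ := hval t
      rw [← Ideal.unit_mul_mem_iff_mem _ (resFun_pow_isUnit f le_rfl n)]
      rw [h, h']
      exact add_mem (Ideal.mul_mem_left _ _ (Ideal.subset_span List.mem_cons_self))
        (Ideal.mul_mem_left _ _ (Ideal.subset_span (List.mem_cons_of_mem _ List.mem_cons_self)))
  refine ⟨P1Z.basicOpen f, (isAffineOpen_chart i).basicOpen f, hzf,
    [P1Z.resFun (P1Z.basicOpen_le f) (g i t₁), P1Z.resFun (P1Z.basicOpen_le f) (g i t₂)], rfl,
    isRegular_pair (fun x y h₁ h₂ => ?_) ?_, hker⟩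
  · refine (hg i).dvd_of_localization (A := Γ(P1Z, P1Z.basicOpen f)) f hf fun m => ?_
    obtain ⟨r₁, r₂, h⟩ := hval m
    change x ∣ y * P1Z.resFun (P1Z.basicOpen_le f) (g i m)
    rw [h, mul_add, mul_left_comm, mul_left_comm y r₂]
    exact dvd_add (h₁.mul_left _) (h₂.mul_left _)
  · rw [hker]
    -- The ideal is proper because the point `z` lies over this open set, so the ring of functions
    -- on its preimage is nonzero.
    have : Nonempty (K.subschemeι ⁻¹ᵁ P1Z.basicOpen f) := ⟨⟨z, hzf⟩⟩
    exact RingHom.ker_ne_top _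

end ProjectiveLine

/-! ### Kernels on sections and twists of ideal sheaves -/

namespace AlgebraicGeometry.Scheme.Modules

variable {X : Scheme.{u}} {M N : X.Modules}

/-- Sections over an open set as a functor. -/
noncomputable def sectionsFunctor (U : X.Opens) : X.Modules ⥤ Ab.{u} :=
  toPresheaf X ⋙ (CategoryTheory.evaluation _ _).obj (op U)

instance (U : X.Opens) : (sectionsFunctor U).PreservesZeroMorphisms where
  map_zero _ _ := rfl

noncomputable instance (U : X.Opens) : Limits.PreservesLimitsOfSize.{u, u} (sectionsFunctor U) :=
  have : Limits.PreservesLimitsOfSize.{u, u} (toPresheaf X) := inferInstance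
  have : Limits.PreservesLimitsOfSize.{u, u}
      ((CategoryTheory.evaluation (TopologicalSpace.Opens X)ᵒᵖ Ab.{u}).obj (op U)) :=
    Limits.evaluationPreservesLimits _
  Limits.comp_preservesLimits _ _

/-- Taking sections over a fixed open set preserves limits, so the kernel is computed on sections.
-/
lemma exact_sections_kernel (f : M ⟶ N) (U : X.Opens) :
    Function.Injective ((Limits.kernel.ι f).app U) ∧
    ∀ m : Γ(M, U), f.app U m = 0 → ∃ k, (Limits.kernel.ι f).app U k = m := by
  have h0 : Limits.PreservesFiniteLimits (sectionsFunctor U) :=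
    Limits.PreservesLimitsOfSize.preservesFiniteLimits _
  have h1 : Mono ((sectionsFunctor U).map (Limits.kernel.ι f)) := inferInstance
  refine ⟨(AddCommGrpCat.mono_iff_injective _).mp h1, ?_⟩
  have h2 := (ShortComplex.exact_kernel f).map_of_mono_of_preservesKernel (sectionsFunctor U)
    inferInstance inferInstance
  rw [ShortComplex.ab_exact_iff] at h2
  exact h2

end AlgebraicGeometry.Scheme.Modules

namespace TensorModules

open Scheme.Modules

variable {X : Scheme.{u}} {M L : X.Modules}

/-- The presheaf tensor product of two modules. -/
noncomputable def tensorPresheaf (M L : X.Modules) :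
    PresheafOfModules.{u} (X.presheaf ⋙ forget₂ CommRingCat RingCat) :=
  PresheafOfModules.Monoidal.tensorObj (R := X.presheaf) M.val L.val

open MonoidalCategory in
/-- Multiplication of sections by functions, on the presheaf tensor product. -/
noncomputable def tensorPresheafHom (κ : M ⟶ structureModule X) (L : X.Modules) :
    tensorPresheaf M L ⟶
      (PresheafOfModules.restrictScalars (𝟙 X.ringCatSheaf.obj)).obj
        ((SheafOfModules.forget X.ringCatSheaf).obj L) :=
  PresheafOfModules.Monoidal.tensorHom (R := X.presheaf) κ.val (𝟙 L.val) ≫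
    (λ_ (show PresheafOfModules.{u} (X.presheaf ⋙ forget₂ CommRingCat RingCat) from L.val)).hom

/-- Pure tensors. -/
noncomputable def tmul {U : X.Opens} (m : Γ(M, U)) (l : Γ(L, U)) :
    (tensorPresheaf M L).presheaf.obj (op U) :=
  (m ⊗ₜ[Γ(X, U)] l : TensorProduct Γ(X, U) Γ(M, U) Γ(L, U))

lemma tensorPresheafHom_tmul (κ : M ⟶ structureModule X) {U : X.Opens} (m : Γ(M, U))
    (l : Γ(L, U)) :
    (((PresheafOfModules.toPresheaf _).map (tensorPresheafHom κ L)).app (op U)).hom (tmul m l) =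
      (show Γ(X, U) from κ.app U m) • l := rfl

lemma add_tmul {U : X.Opens} (m m' : Γ(M, U)) (l : Γ(L, U)) :
    tmul (m + m') l = tmul m l + tmul m' l := TensorProduct.add_tmul _ _ _

lemma zero_tmul {U : X.Opens} (l : Γ(L, U)) :
    tmul (0 : Γ(M, U)) l = 0 := TensorProduct.zero_tmul _ _

lemma tmul_smul {U : X.Opens} (r : Γ(X, U)) (m : Γ(M, U)) (l : Γ(L, U)) :
    tmul m (r • l) = tmul (r • m) l := (TensorProduct.smul_tmul r m l).symm

lemma tmul_induction {U : X.Opens} {p : (tensorPresheaf M L).presheaf.obj (op U) → Prop}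
    (h0 : p 0) (htmul : ∀ m l, p (tmul m l)) (hadd : ∀ x y, p x → p y → p (x + y)) (x) : p x :=
  TensorProduct.induction_on (motive := p) x h0 htmul hadd

/-- Every element of the tensor product with a free module of rank one is a pure tensor. -/
lemma exists_eq_tmul {U : X.Opens} (e : Γ(L, U)) (he : ∀ l : Γ(L, U), ∃ r : Γ(X, U), l = r • e)
    (x : (tensorPresheaf M L).presheaf.obj (op U)) : ∃ m, x = tmul m e := by
  induction x using tmul_induction with
  | h0 => exact ⟨0, (zero_tmul e).symm⟩
  | htmul m l =>
    obtain ⟨r, rfl⟩ := he l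
    exact ⟨r • m, tmul_smul r m e⟩
  | hadd x y hx hy =>
    obtain ⟨m, rfl⟩ := hx
    obtain ⟨m', rfl⟩ := hy
    exact ⟨m + m', (add_tmul m m' e).symm⟩

/-- The map from the presheaf tensor product to the tensor product. -/
noncomputable def toTensor (M L : X.Modules) :
    (tensorPresheaf M L).presheaf ⟶ (tensorModules M L).presheaf :=
  CategoryTheory.toSheafify (Opens.grothendieckTopology X) (tensorPresheaf M L).presheaf

lemma exists_toTensor_eq {U : X.Opens} (s : Γ(tensorModules M L, U)) (x : X) (hx : x ∈ U) :
    ∃ (V : X.Opens) (h : V ≤ U), x ∈ V ∧ ∃ q, ((toTensor M L).app (op V)).hom q =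
      (tensorModules M L).res h s := by
  have h1 : Presheaf.IsLocallySurjective (Opens.grothendieckTopology X) (toTensor M L) :=
    inferInstanceAs (Presheaf.IsLocallySurjective _ (CategoryTheory.toSheafify _ _))
  obtain ⟨V, h, hV, hxV⟩ := Presheaf.imageSieve_mem (Opens.grothendieckTopology X)
    (toTensor M L) s x hx
  obtain ⟨q, hq⟩ := hV
  exact ⟨V, leOfHom h, hxV, q, hq⟩

/-- Multiplication of sections by functions, on the tensor product. -/
noncomputable def tensorHom (κ : M ⟶ structureModule X) (L : X.Modules) : tensorModules M L ⟶ L :=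
  (PresheafOfModules.sheafificationHomEquiv (𝟙 X.ringCatSheaf.obj)).symm (tensorPresheafHom κ L)

lemma tensorHom_toTensor (κ : M ⟶ structureModule X) {U : X.Opens}
    (q : (tensorPresheaf M L).presheaf.obj (op U)) :
    (tensorHom κ L).app U (((toTensor M L).app (op U)).hom q) =
      (((PresheafOfModules.toPresheaf _).map (tensorPresheafHom κ L)).app (op U)).hom q := by
  have h1 := PresheafOfModules.toPresheaf_map_sheafificationHomEquiv_def
    (𝟙 X.ringCatSheaf.obj) (F := L) (P := tensorPresheaf M L) (tensorHom κ L)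
  have h2 : PresheafOfModules.sheafificationHomEquiv (𝟙 X.ringCatSheaf.obj) (tensorHom κ L) =
    tensorPresheafHom κ L := Equiv.apply_symm_apply _ _
  have h3 := ((congrArg (PresheafOfModules.toPresheaf _).map h2).symm.trans h1).symm
  exact congr(($(h3).app (op U)).hom q)

end TensorModules

namespace ProjectiveLine

open Scheme Scheme.Modules TensorModules

lemma res_toTensor {X : Scheme.{u}} {M L : X.Modules} {U V : X.Opens} (h : V ≤ U)
    (q : (tensorPresheaf M L).presheaf.obj (op U)) :
    (tensorModules M L).res h (((toTensor M L).app (op U)).hom q) =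
      ((toTensor M L).app (op V)).hom (((tensorPresheaf M L).presheaf.map (homOfLE h).op).hom q) :=
  (congr(($((toTensor M L).naturality (homOfLE h).op)).hom q)).symm

/-- Sections of a twist are locally pure tensors with the generator of `𝒪(b)`. -/
lemma exists_toTensor_tmul_eq {M : P1Z.Modules} {b : ℤ} {U : P1Z.Opens}
    (l : Γ(twistP1Z M b, U)) (x : P1Z) (hx : x ∈ U) :
    ∃ (j : Fin 2) (V : P1Z.Opens) (hU : V ≤ U) (hj : V ≤ chart j), x ∈ V ∧ ∃ m : Γ(M, V),
      ((toTensor M (OP1Z b)).app (op V)).hom (tmul m ((OP1Z b).res hj (twistGen b j))) =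
        (twistP1Z M b).res hU l := by
  obtain ⟨V, hV, hxV, q, hq⟩ := exists_toTensor_eq l x hx
  obtain ⟨j, hj⟩ := exists_mem_chart x
  refine ⟨j, V ⊓ chart j, inf_le_left.trans hV, inf_le_right, ⟨hxV, hj⟩, ?_⟩
  obtain ⟨m, hm⟩ := exists_eq_tmul ((OP1Z b).res inf_le_right (twistGen b j))
    (exists_smul_twistGen b j inf_le_right)
    (((tensorPresheaf M (OP1Z b)).presheaf.map (homOfLE (inf_le_left : V ⊓ chart j ≤ V)).op).hom q)
  refine ⟨m, ?_⟩
  rw [← hm, ← res_toTensor, hq]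
  exact res_res _ _ _

lemma tensorHom_toTensor_tmul {X : Scheme.{u}} {M L : X.Modules} (κ : M ⟶ structureModule X)
    {U : X.Opens} (m : Γ(M, U)) (l : Γ(L, U)) :
    (tensorHom κ L).app U (((toTensor M L).app (op U)).hom (tmul m l)) =
      (show Γ(X, U) from κ.app U m) • l := by
  rw [tensorHom_toTensor]
  exact tensorPresheafHom_tmul κ m l

/-- Twisting preserves injectivity. -/
lemma tensorHom_twist_injective {M : P1Z.Modules} (κ : M ⟶ structureModule P1Z)
    (hκ : ∀ U, Function.Injective (κ.app U)) (b : ℤ) (U : P1Z.Opens) :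
    Function.Injective ((tensorHom κ (OP1Z b)).app U) := by
  refine (injective_iff_map_eq_zero _).mpr fun l hl => ?_
  refine eq_of_locally_eq fun x hx => ?_
  -- Locally a section is `m ⊗ e` with `e` the free generator of `𝒪(b)`, and its image is `κ m • e`;
  -- so `κ m = 0` and then `m = 0`.
  obtain ⟨j, V, hU, hj, hxV, m, hm⟩ := exists_toTensor_tmul_eq l x hx
  refine ⟨V, hU, hxV, ?_⟩
  have h1 := congrArg ((OP1Z b).res hU) hl
  rw [map_zero, ← app_res] at h1
  have h2 := smul_twistGen_injective b j hj
    ((tensorHom_toTensor_tmul κ m _).symm.trans ((congrArg _ hm).trans h1))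
  have h3 : m = 0 := hκ V (h2.trans (map_zero _).symm)
  rw [map_zero, ← map_zero ((toTensor M (OP1Z b)).app (op V)).hom, ← zero_tmul, ← h3]
  exact hm.symm

variable {Z : Scheme.{0}} (i : Z ⟶ P1Z) [IsClosedImmersion i] (b : ℤ)

/-- The inclusion `𝓘_Z(b) ⟶ 𝒪(b)`. -/
noncomputable def twistIdealHom : twistP1Z (idealSheafModule i) b ⟶ OP1Z b :=
  tensorHom (Limits.kernel.ι (structureModuleHom i)) (OP1Z b)

lemma twistIdealHom_injective (U : P1Z.Opens) : Function.Injective ((twistIdealHom i b).app U) :=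
  tensorHom_twist_injective _ (fun V => (exact_sections_kernel _ V).1) b U

lemma exists_twistIdealHom_eq {j : Fin 2} {U : P1Z.Opens} (h : U ≤ chart j) (c : Γ(P1Z, U))
    (hc : (i.app U).hom c = 0) :
    ∃ l, (twistIdealHom i b).app U l = c • (OP1Z b).res h (twistGen b j) := by
  obtain ⟨k, hk⟩ := (exact_sections_kernel (structureModuleHom i) U).2 c hc
  refine ⟨_, (tensorHom_toTensor_tmul (Limits.kernel.ι (structureModuleHom i)) k
    ((OP1Z b).res h (twistGen b j))).trans (congrArg (· • _) hk)⟩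

/-- Together with `exists_twistIdealHom_eq` this describes the image of `𝓘_Z(b)` in `𝒪(b)` locally
as the multiples of the generator by functions vanishing on `Z`; the tensor product is not needed
afterwards. -/
lemma exists_eq_smul_twistGen {U : P1Z.Opens} (l : Γ(twistP1Z (idealSheafModule i) b, U))
    (x : P1Z) (hx : x ∈ U) :
    ∃ (j : Fin 2) (V : P1Z.Opens) (hU : V ≤ U) (hj : V ≤ chart j), x ∈ V ∧ ∃ c : Γ(P1Z, V),
      (i.app V).hom c = 0 ∧
      (twistIdealHom i b).app V ((twistP1Z (idealSheafModule i) b).res hU l) =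
        c • (OP1Z b).res hj (twistGen b j) := by
  obtain ⟨j, V, hU, hj, hxV, m, hm⟩ := exists_toTensor_tmul_eq l x hx
  refine ⟨j, V, hU, hj, hxV, (Limits.kernel.ι (structureModuleHom i)).app V m, ?_, ?_⟩
  · have := congr(($(Limits.kernel.condition (structureModuleHom i))).app V m)
    exact this
  · rw [← hm]
    exact tensorHom_toTensor_tmul _ m _

end ProjectiveLine

/-! ### The exact sequence -/

namespace ProjectiveLine

open Scheme BundleAlgebra Scheme.Modules

variable {E : P1Z.Modules}

/-- Locally, sections are fractions of sections over a chart. -/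
lemma exists_fraction (hloc : ∀ j, E.IsLocalizingOn (chart j)) {U : P1Z.Opens} (m : Γ(E, U))
    (x : P1Z) (hx : x ∈ U) :
    ∃ (j : Fin 2) (f : Γ(P1Z, chart j)) (hU : P1Z.basicOpen f ≤ U), x ∈ P1Z.basicOpen f ∧
      ∃ (n : ℕ) (t : Γ(E, chart j)), E.res (P1Z.basicOpen_le f) t =
        P1Z.resFun (P1Z.basicOpen_le f) (f ^ n) • E.res hU m := by
  obtain ⟨j, hj⟩ := exists_mem_chart x
  obtain ⟨f, hf, hxf⟩ := (isAffineOpen_chart j).exists_basicOpen_le (V := U) ⟨x, hx⟩ hj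
  exact ⟨j, f, hf, hxf, (hloc j).exists_smul_eq f _⟩

/-- Homomorphisms from `𝒪(a)` which are nonzero over torsion-free charts are injective. -/
lemma injective_of_twistGen {a : ℤ} (hloc : ∀ j, E.IsLocalizingOn (chart j))
    [∀ j, Module.IsTorsionFree Γ(P1Z, chart j) Γ(E, chart j)] {s : ∀ j, Γ(E, chart j)}
    (hs : ∀ j, s j ≠ 0) {F : OP1Z a ⟶ E}
    (hF : ∀ j (W : P1Z.Opens) (h : W ≤ chart j) (r : Γ(P1Z, W)),
      F.app W (r • (OP1Z a).res h (twistGen a j)) = r • E.res h (s j)) (U : P1Z.Opens) :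
    Function.Injective (F.app U) := by
  refine (injective_iff_map_eq_zero _).mpr fun m hm => eq_of_locally_eq fun x hx => ?_
  obtain ⟨j, hj⟩ := exists_mem_chart x
  refine ⟨U ⊓ chart j, inf_le_left, ⟨hx, hj⟩, ?_⟩
  have h1 := congrArg (E.res (inf_le_left : U ⊓ chart j ≤ U)) hm
  obtain ⟨r, hr⟩ := exists_smul_twistGen a j (inf_le_right : U ⊓ chart j ≤ _)
    ((OP1Z a).res inf_le_left m)
  rw [map_zero, ← app_res, hr, hF] at h1
  rw [hr, (hloc j).eq_zero_of_smul_eq_zero (isAffineOpen_chart j) (hs j) _ h1, zero_smul, map_zero]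

/-- Everything is compared inside `𝒪(b)`. The values of `G` lie locally in the image of the
injection of `𝓘_Z(b)`, which gives `q`. Exactness in the middle and local surjectivity follow from
`hgs` and `hi`, once sections are written locally as fractions of sections over a chart. -/
theorem exists_shortExact_of_sections {a b : ℤ} (hloc : ∀ j, E.IsLocalizingOn (chart j))
    [∀ j, Module.IsTorsionFree Γ(P1Z, chart j) Γ(E, chart j)] {s : ∀ j, Γ(E, chart j)}
    {g : ∀ j, Γ(E, chart j) →ₗ[Γ(P1Z, chart j)] Γ(P1Z, chart j)} (hs : ∀ j, s j ≠ 0)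
    (hgs : ∀ j m, g j m = 0 ↔ ∃ c : Γ(P1Z, chart j), m = c • s j)
    {F : OP1Z a ⟶ E} (hF : ∀ j (W : P1Z.Opens) (h : W ≤ chart j) (r : Γ(P1Z, W)),
      F.app W (r • (OP1Z a).res h (twistGen a j)) = r • E.res h (s j))
    {G : E ⟶ OP1Z b} (hG : ∀ j t, G.app (chart j) t = g j t • twistGen b j)
    {Z : Scheme.{0}} (i : Z ⟶ P1Z) [IsClosedImmersion i]
    (hi : ∀ (j : Fin 2) (f : Γ(P1Z, chart j)) (c : Γ(P1Z, P1Z.basicOpen f)),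
      (i.app (P1Z.basicOpen f)).hom c = 0 ↔
        ∃ (n : ℕ) (t : Γ(E, chart j)), P1Z.resFun (P1Z.basicOpen_le f) (f ^ n) * c =
          P1Z.resFun (P1Z.basicOpen_le f) (g j t)) :
    ∃ (q : E ⟶ twistP1Z (idealSheafModule i) b) (w : F ≫ q = 0),
      (ShortComplex.mk F q w).ShortExact := by
  have hGr (j : Fin 2) (W : P1Z.Opens) (h : W ≤ chart j) (t : Γ(E, chart j)) :
      G.app W (E.res h t) = P1Z.resFun h (g j t) • (OP1Z b).res h (twistGen b j) := by
    rw [app_res, hG, res_smul]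
  have hinj := twistIdealHom_injective i b
  obtain ⟨q, hq⟩ := exists_lift (twistIdealHom i b) hinj G fun U m x hx => by
    obtain ⟨j, f, hU, hxf, n, t, ht⟩ := exists_fraction hloc m x hx
    obtain ⟨c, hc⟩ := exists_smul_twistGen b j (P1Z.basicOpen_le f) (G.app _ (E.res hU m))
    refine ⟨_, hU, hxf, ?_⟩
    rw [← app_res, hc]
    refine exists_twistIdealHom_eq i b _ c ((hi j f c).mpr ⟨n, t, ?_⟩)
    have h1 := congrArg (G.app _) ht
    rw [hGr, Hom.app_smul, hc, smul_smul, ← sub_eq_zero, ← sub_smul] at h1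
    exact (sub_eq_zero.mp (smul_twistGen_injective b j _ h1)).symm
  have hqG (U : P1Z.Opens) (m : Γ(E, U)) : (twistIdealHom i b).app U (q.app U m) = G.app U m :=
    congr(($hq).app U m)
  have hFG (U : P1Z.Opens) (m : Γ(OP1Z a, U)) : G.app U (F.app U m) = 0 := by
    refine eq_of_locally_eq fun x hx => ?_
    obtain ⟨j, hj⟩ := exists_mem_chart x
    refine ⟨U ⊓ chart j, inf_le_left, ⟨hx, hj⟩, ?_⟩
    obtain ⟨r, hr⟩ := exists_smul_twistGen a j (inf_le_right : U ⊓ chart j ≤ _)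
      ((OP1Z a).res inf_le_left m)
    rw [← app_res, ← app_res, hr, hF, Hom.app_smul, hGr, (hgs j (s j)).mpr ⟨1, (one_smul _ _).symm⟩,
      map_zero, map_zero, zero_smul, smul_zero]
  have w : F ≫ q = 0 := by
    ext U m
    apply hinj U
    exact (hqG U _).trans ((hFG U m).trans (map_zero _).symm)
  refine ⟨q, w, shortExact_of_sections F q w (injective_of_twistGen hloc hs hF)
    (fun U m hm x hx => ?_) fun U l x hx => ?_⟩
  · obtain ⟨j, f, hU, hxf, n, t, ht⟩ := exists_fraction hloc m x hx
    have h1 := congrArg ((OP1Z b).res hU) (hqG U m)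
    rw [hm, map_zero, map_zero, ← app_res] at h1
    have h2 := congrArg (G.app _) ht
    rw [hGr, Hom.app_smul, ← h1, smul_zero] at h2
    -- The value `g j t` vanishes only over the basic open set. Over the chart it is killed by a
    -- power of `f`, so `f ^ k • t` is a multiple of `s j`.
    obtain ⟨k, hk⟩ := exists_pow_mul_eq_zero (isAffineOpen_chart j) f _
      (smul_twistGen_injective b j _ h2)
    rw [← smul_eq_mul, ← _root_.map_smul] at hk
    obtain ⟨c, hc⟩ := (hgs j _).mp hk
    obtain ⟨u, hu⟩ := (resFun_pow_isUnit f le_rfl (k + n)).exists_left_inv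
    refine ⟨_, hU, hxf, (u * P1Z.resFun (P1Z.basicOpen_le f) c) •
      (OP1Z a).res (P1Z.basicOpen_le f) (twistGen a j), ?_⟩
    rw [hF, mul_smul, ← res_smul, ← hc, res_smul, ht, smul_smul, smul_smul, mul_assoc,
      ← map_mul, ← pow_add,
      hu, one_smul]
  · obtain ⟨j, V, hU, hj, hxV, c, hc, hl⟩ := exists_eq_smul_twistGen i b l x hx
    -- The equations of `Z` are available over basic open subsets of the charts, so `V` is shrunk to
    -- one of these.
    obtain ⟨f, hf, hxf⟩ := (isAffineOpen_chart j).exists_basicOpen_le (V := V) ⟨x, hxV⟩ (hj hxV)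
    have hc' : (i.app (P1Z.basicOpen f)).hom (P1Z.resFun hf c) = 0 := by
      have h1 := congr(($(i.naturality (homOfLE hf).op)).hom c)
      exact h1.trans ((congrArg (Z.presheaf.map _).hom hc).trans (map_zero (Z.presheaf.map _).hom))
    obtain ⟨n, t, ht⟩ := (hi j f _).mp hc'
    obtain ⟨u, hu⟩ := (resFun_pow_isUnit f le_rfl n).exists_left_inv
    refine ⟨_, hf.trans hU, hxf, u • E.res (P1Z.basicOpen_le f) t, hinj _ ?_⟩
    have hl' := congrArg ((OP1Z b).res hf) hl
    rw [← app_res, res_res, res_smul, res_res] at hl'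
    rw [hqG, hl', Hom.app_smul, hGr, ← ht, smul_smul, ← mul_assoc, hu, one_mul]

end ProjectiveLine

open ProjectiveLine Scheme.Modules in
theorem mainTheorem2 (E : P1Z.Modules) (hE : IsLocallyFreeOfRank E 2) :
    ∃ (a b : ℤ) (_ : b ≤ a) (Z : Scheme.{0}) (i : Z ⟶ P1Z) (_ : IsClosedImmersion i)
      (_ : IsLocalCompleteIntersection i 2)
      (f : OP1Z a ⟶ E) (g : E ⟶ twistP1Z (idealSheafModule i) b) (w : f ≫ g = 0),
      (ShortComplex.mk f g w).ShortExact := by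
  have := isQuasicoherent_of_locallyFree hE
  have hloc (j : Fin 2) : E.IsLocalizingOn (chart j) :=
    isLocalizingOn_of_isAffineOpen E (isAffineOpen_chart j)
  have hproj (j : Fin 2) : Module.Projective Γ(P1Z, chart j) Γ(E, chart j) :=
    projective_of_isBasisOn (isAffineOpen_chart j) (hloc j) _
      (exists_span_isBasisOn hE (isAffineOpen_chart j)) fun f hf => hf
  have htf (j : Fin 2) : Module.IsTorsionFree Γ(P1Z, chart j) Γ(E, chart j) := inferInstance
  obtain ⟨a, b, s, g, hba, hs, hs', hco, hgs, hg⟩ := exists_sections_of_locallyFree hE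
  obtain ⟨F, hF⟩ := exists_hom_from_twist s hs'
  obtain ⟨G, hG⟩ := exists_hom_to_twist hloc g hg
  obtain ⟨K, hK⟩ := exists_ideal_of_forms hloc g hg
  obtain ⟨q, w, h⟩ := exists_shortExact_of_sections hloc hs hgs hF hG K.subschemeι
    (mem_ker_subschemeι_iff hK)
  exact ⟨a, b, hba, _, K.subschemeι, inferInstance,
    isLocalCompleteIntersection_subschemeι hE hloc hco hK, F, q, w, h⟩
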